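/- Let $\Gamma$ be a finite group, $\Gamma_*$ its set of conjugacy classes, $\Gamma^*=\{\gamma_i\}$ its set of irreducible complex characters, $R(\Gamma)=\bigoplus_i\mathbb C\gamma_i$ the space of complex class functions with $\langle f,g\rangle=|\Gamma|^{-1}\sum_x f(x)g(x^{-1})$, and $\zeta_c=|\Gamma|/|c|$ for $c\in\Gamma_*$. *Groups.* Let $\Pi_n$ be the group generated by $a_1,\dots,a_n$ and a central element $z$ with $a_i^2=z$, $z^2=1$, $a_ia_j=za_ja_i$ ($i\ne j$). Let $S_n$ act on $\Gamma^n\times\Pi_n$ by $s(g_1,\dots,g_n)=(g_{s^{-1}(1)},\dots,g_{s^{-1}(n)})$ and $s(a_i)=a_{s(i)}$, and put $\tilde{H}\Gamma_n=(\Gamma^n\times\Pi_n)\rtimes S_n$. It is $\mathbb Z_2$-graded by $p(a_i)=1$, with $\Gamma^n$, $S_n$ and $z$ even. Let $R^-(n)$ be the space of spin super class functions on $\tilde{H}\Gamma_n$, i.e. class functions $f:\tilde{H}\Gamma_n\to\mathbb C$ with $f(zx)=-f(x)$ that vanish on odd elements, and $R_\Gamma=\bigoplus_{n\ge0}R^-(n)$.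 *Classes.* Let $\mathcal{OP}_n(\Gamma_*)$ be the set of functions $\rho$ that assign to every $c\in\Gamma_*$ a partition $\rho(c)$ into odd parts, with total size $\sum_c|\rho(c)|=n$; let $l(\rho)=\sum_c l(\rho(c))$ be the total number of parts, $m_i(c)$ the multiplicity of $i$ in $\rho(c)$, and $Z_\rho=\prod_{c}\zeta_c^{l(\rho(c))}\prod_{i\ge1}i^{m_i(c)}m_i(c)!$. An element $(g,s)$, $g\in\Gamma^n$, $s\in S_n$, has type $\rho$ if for each $c$ the parts of $\rho(c)$ are the lengths of the cycles $(j_1\,\cdots\,j_m)$ of $s$ (fixed points included) with $g_{j_m}g_{j_{m-1}}\cdots g_{j_1}\in c$. Let $D_\rho^+$ be the conjugacy class in $\tilde{H}\Gamma_n$ of the elements $(g,s)$ of type $\rho$, and $D_\rho^-=zD_\rho^+$. *Basic spin characters.* Let $L_n$ be the complex Clifford algebra with generators $e_1,\dots,e_n$ and relations $e_ie_j+e_je_i=-2\delta_{ij}$, on which $\Pi_n\rtimes S_n$ acts by $a_i\cdot u=e_iu$, $z\cdot u=-u$, and $s$ by the algebra automorphism $e_i\mapsto e_{s(i)}$. For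 a finite-dimensional $\Gamma$-module $V$ with character $\gamma$ let $\chi_n(\gamma)\in R^-(n)$ be the character of the spin supermodule $V^{\otimes n}\otimes L_n$, where $(g,as)$ acts by $(v_1\otimes\cdots\otimes v_n)\otimes u\mapsto(g_1v_{s^{-1}(1)}\otimes\cdots\otimes g_nv_{s^{-1}(n)})\otimes(as\cdot u)$. There is a unique extension of $\chi_n$ to a map $\chi_n:R(\Gamma)\to R^-(n)$ whose values $\chi_n(\sum_is_i\gamma_i)(x)$ are polynomial functions of the coordinates $s_i\in\mathbb C$, and for all $\beta,\gamma\in R(\Gamma)$ it satisfies $$\chi_n(\beta-\gamma)=\sum_{m=0}^n(-1)^m\,\mathrm{Ind}\,[\chi_{n-m}(\beta)\otimes\chi_m(\gamma)],$$ the induction being to $\tilde{H}\Gamma_n$ from the subgroup generated by the copies of $\tilde{H}\Gamma_{n-m}$ and $\tilde{H}\Gamma_m$ on the first $n-m$ and the last $m$ indices, and $(f\otimes h)(ts)=f(t)h(s)$ for $t$, $s$ in these copies. *Fock space and characteristic map.* Let $S$ be the symmetric algebra over $\mathbb C$ on symbols $a_{-n}(\gamma_i)$, $n\ge1$ odd,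 $\gamma_i\in\Gamma^*$. Put $a_{-n}(\gamma)=\sum_is_ia_{-n}(\gamma_i)$ for $\gamma=\sum_is_i\gamma_i\in R(\Gamma)$, $a_{-n}(c)=\sum_i\gamma_i(c^{-1})a_{-n}(\gamma_i)$ for $c\in\Gamma_*$, and $a'_{-\rho}=\prod_c\prod_{k}a_{-\rho(c)_k}(c)$. Let $\mathrm{ch}:R_\Gamma\to S$ be the linear map with $\mathrm{ch}(f)=\sum_{\rho\in\mathcal{OP}_n(\Gamma_*)}Z_\rho^{-1}f(D_\rho^+)\,a'_{-\rho}$ for $f\in R^-(n)$. **Proposition.** For every $\gamma\in R(\Gamma)$ (in particular for every virtual character), $$\sum_{n\ge0}\mathrm{ch}(\chi_n(\gamma))\,z^n=\exp\Bigl(\sum_{n\ge1,\ n\ \mathrm{odd}}\frac2n\,a_{-n}(\gamma)\,z^n\Bigr)$$ in $S[[z]]$ (here $z$ is a formal variable). Moreover, for all $n\ge0$, $\gamma\in R(\Gamma)$ and $\rho\in\mathcal{OP}_n(\Gamma_*)$, $$\chi_n(\gamma)(D_\rho^{\pm})=\pm\,2^{l(\rho)}\prod_{c\in\Gamma_*}\gamma(c)^{l(\rho(c))}.$$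 -/

import Mathlib

open scoped TensorProduct DirectSum

noncomputable section

namespace SpinHyperoctahedral

universe u

/-! ### The groups `Π_ι`, `Π_ι ⋊ S_ι` and `(Γ^ι × Π_ι) ⋊ S_ι` -/

section Groups

variable {α β ι : Type}

/-- Relators of `Π_ι`; the generator `none` is the central element `z`, and `some i` is `a_i`. -/
inductive PiRel (ι : Type) : FreeGroup (Option ι) → Prop
  | sq (i : ι) : PiRel ι (FreeGroup.of (some i) ^ 2 * (FreeGroup.of none)⁻¹)
  | zsq : PiRel ι (FreeGroup.of none ^ 2)
  | central (i : ι) : PiRel ι (FreeGroup.of none * FreeGroup.of (some i) *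
      (FreeGroup.of (some i) * FreeGroup.of none)⁻¹)
  | anti (i j : ι) (h : i ≠ j) : PiRel ι (FreeGroup.of (some i) * FreeGroup.of (some j) *
      (FreeGroup.of none * FreeGroup.of (some j) * FreeGroup.of (some i))⁻¹)

/-- The group generated by `a_i` (`i : ι`) and central `z` with `a_i ^ 2 = z`, `z ^ 2 = 1`,
`a_i a_j = z a_j a_i` for `i ≠ j`. -/
abbrev PiGroup (ι : Type) : Type := PresentedGroup {w | PiRel ι w}

/-- The central element `z` of `Π_ι`. -/
def PiGroup.z : PiGroup ι := PresentedGroup.of none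

/-- The generator `a_i` of `Π_ι`. -/
def PiGroup.a (i : ι) : PiGroup ι := PresentedGroup.of (some i)

theorem PiGroup.a_sq (i : ι) : (PiGroup.a i) ^ 2 = (PiGroup.z : PiGroup ι) :=
  PresentedGroup.mk_eq_mk_of_mul_inv_mem (PiRel.sq i)

theorem PiGroup.z_sq : (PiGroup.z : PiGroup ι) ^ 2 = 1 :=
  PresentedGroup.one_of_mem PiRel.zsq

theorem PiGroup.z_mul_a (i : ι) :
    (PiGroup.z : PiGroup ι) * PiGroup.a i = PiGroup.a i * PiGroup.z :=
  PresentedGroup.mk_eq_mk_of_mul_inv_mem (PiRel.central i)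

theorem PiGroup.a_mul_a (i j : ι) (h : i ≠ j) :
    (PiGroup.a i : PiGroup ι) * PiGroup.a j = PiGroup.z * PiGroup.a j * PiGroup.a i :=
  PresentedGroup.mk_eq_mk_of_mul_inv_mem (PiRel.anti i j h)

/-- The universal property of `Π_ι`. -/
def PiGroup.lift {G : Type*} [Group G] (z : G) (a : ι → G) (h1 : ∀ i, a i ^ 2 = z)
    (h2 : z ^ 2 = 1) (h3 : ∀ i j, i ≠ j → a i * a j = z * a j * a i) : PiGroup ι →* G :=
  PresentedGroup.toGroup (f := fun o => o.elim z a) (by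
    rintro r hr
    cases hr with
    | sq _ => simp [h1]
    | zsq => simp [h2]
    | central i =>
      have : z * a i = a i * z := by rw [← h1 i]; group
      simp [this]
    | anti i j h => simp [h3 i j h])

@[simp] theorem PiGroup.lift_z {G : Type*} [Group G] (z : G) (a : ι → G) (h1 : ∀ i, a i ^ 2 = z)
    (h2 : z ^ 2 = 1) (h3 : ∀ i j, i ≠ j → a i * a j = z * a j * a i) :
    PiGroup.lift z a h1 h2 h3 PiGroup.z = z :=
  PresentedGroup.toGroup.of _

@[simp] theorem PiGroup.lift_a {G : Type*} [Group G] (z : G) (a : ι → G) (h1 : ∀ i, a i ^ 2 = z)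
    (h2 : z ^ 2 = 1) (h3 : ∀ i j, i ≠ j → a i * a j = z * a j * a i) (i : ι) :
    PiGroup.lift z a h1 h2 h3 (PiGroup.a i) = a i :=
  PresentedGroup.toGroup.of _

theorem PiGroup.hom_ext {G : Type*} [Monoid G] {f g : PiGroup ι →* G}
    (hz : f PiGroup.z = g PiGroup.z) (ha : ∀ i, f (PiGroup.a i) = g (PiGroup.a i)) : f = g := by
  have h : f.toHomUnits = g.toHomUnits := by
    apply PresentedGroup.ext
    rintro (_ | i)
    · exact Units.ext hz
    · exact Units.ext (ha i)
  ext x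
  exact congrArg Units.val (DFunLike.congr_fun h x)

/-- The map `Π_α → Π_β`, `z ↦ z`, `a_i ↦ a_{f(i)}`, for an injection `f`. -/
def PiGroup.map (f : α ↪ β) : PiGroup α →* PiGroup β :=
  PiGroup.lift PiGroup.z (fun i => PiGroup.a (f i)) (fun _ => PiGroup.a_sq _) PiGroup.z_sq
    (fun _ _ h => PiGroup.a_mul_a _ _ (f.injective.ne h))

@[simp] theorem PiGroup.map_z (f : α ↪ β) : PiGroup.map f PiGroup.z = PiGroup.z := by
  simp [PiGroup.map]

@[simp] theorem PiGroup.map_a (f : α ↪ β) (i : α) :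
    PiGroup.map f (PiGroup.a i) = PiGroup.a (f i) := by
  simp [PiGroup.map]

theorem PiGroup.map_map {κ : Type} (f : α ↪ β) (g : β ↪ κ) (x : PiGroup α) :
    PiGroup.map g (PiGroup.map f x) = PiGroup.map (f.trans g) x := by
  have : (PiGroup.map g).comp (PiGroup.map f) = PiGroup.map (f.trans g) :=
    PiGroup.hom_ext (by simp) (by simp)
  exact DFunLike.congr_fun this x

theorem PiGroup.map_refl (x : PiGroup α) :
    PiGroup.map (Function.Embedding.refl α) x = x := by
  have : PiGroup.map (Function.Embedding.refl α) = MonoidHom.id _ :=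
    PiGroup.hom_ext (by simp) (by simp)
  exact DFunLike.congr_fun this x

/-- The parity `p : Π_ι → ℤ/2` (written multiplicatively): `p(a_i) = 1`, `p(z) = 0`. -/
def PiGroup.parity : PiGroup ι →* Multiplicative (ZMod 2) :=
  PiGroup.lift 1 (fun _ => Multiplicative.ofAdd 1) (fun _ => by decide) (by decide)
    (fun _ _ _ => by simp)

variable (Γ : Type u) [Group Γ]

/-- The action of `s ∈ S_ι` on `Γ^ι × Π_ι`: `(s g)_i = g_{s⁻¹(i)}` and `s(a_i) = a_{s(i)}`. -/
def permAct (s : Equiv.Perm ι) : ((ι → Γ) × PiGroup ι) →* ((ι → Γ) × PiGroup ι) where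
  toFun x := (fun i => x.1 (s⁻¹ i), PiGroup.map s.toEmbedding x.2)
  map_one' := by ext <;> simp
  map_mul' x y := by ext <;> simp

/-- The simultaneous permutation action of `S_ι` on `Γ^ι × Π_ι`. -/
def permAut : Equiv.Perm ι →* MulAut ((ι → Γ) × PiGroup ι) where
  toFun s :=
    { permAct Γ s with
      invFun := permAct Γ s⁻¹
      left_inv := fun x => by
        ext
        · simp [permAct]
        · simp only [permAct, MonoidHom.coe_mk, OneHom.coe_mk, PiGroup.map_map]
          convert PiGroup.map_refl x.2 using 3
          ext; simp
      right_inv := fun x => by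
        ext
        · simp [permAct]
        · simp only [permAct, MonoidHom.coe_mk, OneHom.coe_mk, PiGroup.map_map]
          convert PiGroup.map_refl x.2 using 3
          ext; simp }
  map_one' := by
    ext x
    · simp [permAct]
    · exact PiGroup.map_refl x.2
  map_mul' s t := by
    ext x
    · simp [permAct]
    · exact (PiGroup.map_map t.toEmbedding s.toEmbedding x.2).symm

/-- The group `(Γ^ι × Π_ι) ⋊ S_ι`; an element is `x = (g, a, s)` with `g = x.left.1`,
`a = x.left.2`, `s = x.right`. -/
abbrev BG (ι : Type) : Type u := ((ι → Γ) × PiGroup ι) ⋊[permAut (ι := ι) Γ] Equiv.Perm ι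

variable {Γ}

/-- The central element `z`. -/
def BG.z : BG Γ ι := ⟨(1, PiGroup.z), 1⟩

/-- The element `(g, s)` with `g ∈ Γ^ι` and `s ∈ S_ι`. -/
def BG.wreath (g : ι → Γ) (s : Equiv.Perm ι) : BG Γ ι := ⟨(g, 1), s⟩

/-- The parity of an element, with `Γ^ι` and `S_ι` in degree `0`. -/
def BG.parity (x : BG Γ ι) : Multiplicative (ZMod 2) := PiGroup.parity x.left.2

/-- The homomorphism induced by an injection `f : α → ι` of index sets: it extends tuples by `1`,
permutations by the identity, and sends `a_i` to `a_{f(i)}`, `z` to `z`. -/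
def BG.map (f : α ↪ ι) : BG Γ α →* BG Γ ι :=
  SemidirectProduct.map
    ((Function.ExtendByOne.hom Γ f).prodMap (PiGroup.map f))
    (Equiv.Perm.viaEmbeddingHom f)
    (by
      intro s
      ext x i
      · change Function.extend f (fun j => x.1 (s⁻¹ j)) 1 i
          = Function.extend f x.1 1 ((Equiv.Perm.viaEmbeddingHom f s)⁻¹ i)
        rw [← map_inv, Equiv.Perm.viaEmbeddingHom_apply]
        by_cases hi : i ∈ Set.range f
        · obtain ⟨j, rfl⟩ := hi
          rw [Equiv.Perm.viaEmbedding_apply, f.injective.extend_apply, f.injective.extend_apply]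
        · rw [Equiv.Perm.viaEmbedding_apply_of_notMem _ _ _ hi,
            Function.extend_apply' _ _ _ hi, Function.extend_apply' _ _ _ hi]
      · change PiGroup.map f (PiGroup.map s.toEmbedding x.2)
          = PiGroup.map (Equiv.Perm.viaEmbeddingHom f s).toEmbedding (PiGroup.map f x.2)
        rw [PiGroup.map_map, PiGroup.map_map]
        congr 2
        ext j
        exact (Equiv.Perm.viaEmbedding_apply s f j).symm)

instance PiGroup.instFinite [Finite ι] : Finite (PiGroup ι) := by
  classical
  let N : Subgroup (PiGroup ι) := Subgroup.zpowers PiGroup.z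
  have hz : (PiGroup.z : PiGroup ι) ∈ Subgroup.center (PiGroup ι) := by
    rw [Subgroup.mem_center_iff]
    intro g
    have h : (MulAut.conj (PiGroup.z : PiGroup ι)).toMonoidHom = MonoidHom.id _ :=
      PiGroup.hom_ext (by simp) (fun i => by simp [PiGroup.z_mul_a])
    have h2 := DFunLike.congr_fun h g
    simp only [MulEquiv.coe_toMonoidHom, MulAut.conj_apply, MonoidHom.id_apply] at h2
    exact (mul_inv_eq_iff_eq_mul.mp h2).symm
  have hN : N ≤ Subgroup.center _ := by simpa [N] using hz
  have : N.Normal := ⟨fun n hn g => by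
    have := Subgroup.mem_center_iff.mp (hN hn) g
    rw [this]; simpa using hn⟩
  have hNf : Finite N := by
    have : IsOfFinOrder (PiGroup.z : PiGroup ι) :=
      isOfFinOrder_iff_pow_eq_one.mpr ⟨2, by norm_num, PiGroup.z_sq⟩
    exact (finite_zpowers.mpr this).to_subtype
  let q : PiGroup ι →* PiGroup ι ⧸ N := QuotientGroup.mk' N
  have hqz : q PiGroup.z = 1 :=
    (QuotientGroup.eq_one_iff _).mpr (Subgroup.mem_zpowers _)
  have hc1 : ∀ i x, q (PiGroup.a i) * q x = q x * q (PiGroup.a i) := by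
    intro i x
    have h : (MulAut.conj (q (PiGroup.a i))).toMonoidHom.comp q = q := by
      refine PiGroup.hom_ext (by simp [hqz]) (fun j => ?_)
      by_cases hij : i = j
      · subst hij; simp
      · have := congrArg q (PiGroup.a_mul_a i j hij)
        simp only [map_mul, hqz, one_mul] at this
        simp [this]
    have h2 := DFunLike.congr_fun h x
    simp only [MonoidHom.comp_apply, MulEquiv.coe_toMonoidHom, MulAut.conj_apply] at h2
    exact mul_inv_eq_iff_eq_mul.mp h2
  have hc : ∀ x y, q x * q y = q y * q x := by
    intro x y
    have h : (MulAut.conj (q x)).toMonoidHom.comp q = q := by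
      refine PiGroup.hom_ext (by simp [hqz]) (fun j => ?_)
      simp [← hc1]
    have h2 := DFunLike.congr_fun h y
    simp only [MonoidHom.comp_apply, MulEquiv.coe_toMonoidHom, MulAut.conj_apply] at h2
    exact mul_inv_eq_iff_eq_mul.mp h2
  have hqs : Function.Surjective q := QuotientGroup.mk'_surjective N
  let _ : CommGroup (PiGroup ι ⧸ N) :=
    { (inferInstance : Group (PiGroup ι ⧸ N)) with
      mul_comm := fun u v => by
        obtain ⟨x, rfl⟩ := hqs u
        obtain ⟨y, rfl⟩ := hqs v
        exact hc x y }
  have hsq : ∀ x, q x ^ 2 = 1 := by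
    intro x
    have h : (powMonoidHom 2).comp q = 1 := by
      refine PiGroup.hom_ext (by simp [hqz]) (fun j => ?_)
      simp [← map_pow, PiGroup.a_sq, hqz]
    exact DFunLike.congr_fun h x
  have hfg0 : Group.FG (PiGroup ι) :=
    Group.fg_iff.mpr ⟨_, PresentedGroup.closure_range_of _, Set.finite_range _⟩
  have hfg : Group.FG (PiGroup ι ⧸ N) := Group.fg_of_surjective hqs
  have hQ : Finite (PiGroup ι ⧸ N) := by
    apply CommGroup.finite_of_fg_isMulTorsion
    intro u
    obtain ⟨x, rfl⟩ := hqs u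
    exact isOfFinOrder_iff_pow_eq_one.mpr ⟨2, by norm_num, hsq x⟩
  exact Finite.of_equiv _ (Subgroup.groupEquivQuotientProdSubgroup (s := N)).symm

instance BG.instFinite [Finite ι] [Finite Γ] : Finite (BG Γ ι) :=
  Finite.of_equiv _ SemidirectProduct.equivProd.symm

end Groups

/-! ### Spin super class functions, induction from the spin product -/

section SpinClass

variable (Γ : Type u) [Group Γ] (ι : Type)

/-- The space `R⁻` of spin super class functions on `(Γ^ι × Π_ι) ⋊ S_ι`. -/
def SpinClassFn : Submodule ℂ (BG Γ ι → ℂ) where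
  carrier := {f | (∀ x y, f (y * x * y⁻¹) = f x) ∧ (∀ x, f (BG.z * x) = -f x) ∧
    ∀ x, BG.parity x ≠ 1 → f x = 0}
  zero_mem' := by simp
  add_mem' := by
    rintro f g ⟨hf1, hf2, hf3⟩ ⟨hg1, hg2, hg3⟩
    refine ⟨fun x y => by simp [hf1, hg1], fun x => ?_, fun x hx => by simp [hf3 x hx, hg3 x hx]⟩
    simp only [Pi.add_apply, hf2, hg2]; ring
  smul_mem' := by
    rintro c f ⟨hf1, hf2, hf3⟩
    exact ⟨fun x y => by simp [hf1], fun x => by simp [hf2], fun x hx => by simp [hf3 x hx]⟩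

variable {Γ ι}

/-- The function induced from a subgroup `H` of a finite group `G`; here `F : G → ℂ` stands for a
class function of `H` extended by zero to `G`. -/
def inducedFn {G : Type*} [Group G] [Finite G] (H : Subgroup G) (F : G → ℂ) (x : G) : ℂ :=
  letI := Fintype.ofFinite G
  (Nat.card H : ℂ)⁻¹ * ∑ y : G, F (y⁻¹ * x * y)

variable {α β : Type}

/-- For a decomposition `ι = α ⊔ β`, the spin product of the groups of index sets `α` and `β`,
as the subgroup of the group of index set `ι` generated by their images. -/
def spinProd (Γ : Type u) [Group Γ] (e : α ⊕ β ≃ ι) : Subgroup (BG Γ ι) :=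
  (BG.map (Function.Embedding.inl.trans e.toEmbedding)).range ⊔
    (BG.map (Function.Embedding.inr.trans e.toEmbedding)).range

open scoped Classical in
/-- The outer tensor product `f ⊗ h` of spin super class functions, as a function on the spin
product (whose elements are the products `t · s` with `t`, `s` in the images of the two factors),
extended by zero. For characters of spin supermodules `U`, `V` this is the character of `U ⊗ V`:
the sign `(-1)^{p(s)p(u)}` in the action of `(t, s)` on `u ⊗ v` only matters for odd `s`,
where both sides vanish. -/
def outerTensor (e : α ⊕ β ≃ ι) (f : BG Γ α → ℂ) (h : BG Γ β → ℂ) (x : BG Γ ι) : ℂ :=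
  if H : ∃ ts : BG Γ α × BG Γ β,
      BG.map (Function.Embedding.inl.trans e.toEmbedding) ts.1 *
        BG.map (Function.Embedding.inr.trans e.toEmbedding) ts.2 = x
  then f H.choose.1 * h H.choose.2 else 0

/-- The decomposition of `{1, …, n}` into its first `n - m` and its last `m` elements. -/
def splitFin (n : ℕ) (m : Fin (n + 1)) : Fin (n - m) ⊕ Fin m ≃ Fin n :=
  finSumFinEquiv.trans (finCongr (by omega))

/-- `Ind (f ⊗ h)` from the spin product of the groups of ranks `n - m` and `m`
to the group of rank `n`. -/
def spinInd [Finite Γ] {n : ℕ} (m : Fin (n + 1)) (f : BG Γ (Fin (n - m)) → ℂ)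
    (h : BG Γ (Fin m) → ℂ) : BG Γ (Fin n) → ℂ :=
  inducedFn (spinProd Γ (splitFin n m)) (outerTensor (splitFin n m) f h)

end SpinClass

/-! ### The supermodule `V^{⊗n} ⊗ L_n` -/

section Basic

variable {Γ : Type u} [Group Γ] {ι : Type}

/-- The action `(g, a, s) (⊗ v_i) = ⊗ g_i v_{s⁻¹(i)}` on `V^{⊗ι}`. -/
def tensorRep {V : Type*} [AddCommGroup V] [Module ℂ V] (ρ : Representation ℂ Γ V) :
    Representation ℂ (BG Γ ι) (⨂[ℂ] _ : ι, V) where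
  toFun x := (PiTensorProduct.map fun i => ρ (x.left.1 i)) ∘ₗ
    (PiTensorProduct.reindex ℂ (fun _ : ι => V) x.right).toLinearMap
  map_one' := by
    ext v
    simp [PiTensorProduct.reindex_tprod]
    rfl
  map_mul' x y := by
    ext v
    simp only [LinearMap.compMultilinearMap_apply, LinearMap.comp_apply, Module.End.mul_apply,
      LinearEquiv.coe_coe, PiTensorProduct.reindex_tprod, PiTensorProduct.map_tprod]
    congr 1
    ext i
    change ρ (x.left.1 i * y.left.1 (x.right⁻¹ i)) (v ((x.right * y.right).symm i)) = _
    rw [map_mul]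
    rfl

variable [Fintype ι]

/-- The quadratic form `-∑ x_i ^ 2` on `ℂ^ι`. -/
def negSumSq (ι : Type) [Fintype ι] : QuadraticForm ℂ (ι → ℂ) :=
  QuadraticMap.weightedSumSquares ℂ (fun _ : ι => (-1 : ℂ))

theorem negSumSq_apply (v : ι → ℂ) : negSumSq ι v = -∑ i, v i * v i := by
  simp [negSumSq, QuadraticMap.weightedSumSquares_apply]

/-- The complex Clifford algebra with generators `e_i` (`i : ι`) and relations
`e_i e_j + e_j e_i = -2 δ_{ij}`. -/
abbrev Cliff (ι : Type) [Fintype ι] : Type := CliffordAlgebra (negSumSq ι)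

open scoped Classical in
/-- The generator `e_i`. -/
def Cliff.e (i : ι) : Cliff ι := CliffordAlgebra.ι (negSumSq ι) (Pi.single i 1)

theorem Cliff.e_mul_self (i : ι) : Cliff.e i * Cliff.e i = (-1 : Cliff ι) := by
  classical
  simp [Cliff.e, CliffordAlgebra.ι_sq_scalar, negSumSq_apply, Pi.single_apply]

theorem Cliff.e_mul_e (i j : ι) (h : i ≠ j) :
    Cliff.e i * Cliff.e j = (-(Cliff.e j * Cliff.e i) : Cliff ι) := by
  classical
  rw [eq_neg_iff_add_eq_zero, Cliff.e, Cliff.e, CliffordAlgebra.ι_mul_ι_add_swap]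
  have h1 : ∀ x, (Pi.single i 1 + Pi.single j 1 : ι → ℂ) x * (Pi.single i 1 + Pi.single j 1 :
      ι → ℂ) x = (Pi.single i 1 : ι → ℂ) x * (Pi.single i 1 : ι → ℂ) x
        + (Pi.single j 1 : ι → ℂ) x * (Pi.single j 1 : ι → ℂ) x := by
    intro x
    by_cases h2 : x = i
    · subst h2; simp [h]
    · by_cases h3 : x = j
      · subst h3; simp [h2]
      · simp [h2, h3]
  simp only [QuadraticMap.polar, negSumSq_apply, h1, Finset.sum_add_distrib]
  simp

/-- The algebra automorphism of the Clifford algebra with `s.e_i = e_{s(i)}`. -/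
def Cliff.perm (s : Equiv.Perm ι) : Cliff ι →ₐ[ℂ] Cliff ι :=
  CliffordAlgebra.map
    { LinearMap.funLeft ℂ ℂ (s⁻¹ : Equiv.Perm ι) with
      map_app' := fun v => by
        change negSumSq ι (fun i => v (s⁻¹ i)) = _
        rw [negSumSq_apply, negSumSq_apply]
        rw [Equiv.sum_comp (s⁻¹ : Equiv.Perm ι) (fun i => v i * v i)] }

theorem Cliff.perm_e (s : Equiv.Perm ι) (i : ι) : Cliff.perm s (Cliff.e i) = Cliff.e (s i) := by
  classical
  rw [Cliff.e, Cliff.e, Cliff.perm, CliffordAlgebra.map_apply_ι]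
  congr 1
  ext j
  change (Pi.single i (1 : ℂ) : ι → ℂ) (s⁻¹ j) = _
  have : s⁻¹ j = i ↔ j = s i := by rw [Equiv.Perm.inv_eq_iff_eq]
  simp only [Pi.single_apply, this]

theorem Cliff.algHom_ext {A : Type*} [Ring A] [Algebra ℂ A] {f g : Cliff ι →ₐ[ℂ] A}
    (h : ∀ i, f (Cliff.e i) = g (Cliff.e i)) : f = g := by
  classical
  apply CliffordAlgebra.hom_ext
  refine LinearMap.pi_ext' fun i => ?_
  ext
  exact h i

/-- The unit of the Clifford algebra attached to an element of `Π_ι`: `a_i ↦ e_i`, `z ↦ -1`. -/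
def Cliff.unit : PiGroup ι →* (Cliff ι)ˣ :=
  PiGroup.lift (-1)
    (fun i => ⟨Cliff.e i, -Cliff.e i, by simp [Cliff.e_mul_self], by simp [Cliff.e_mul_self]⟩)
    (fun i => by ext; simp [pow_two, Cliff.e_mul_self])
    (by simp)
    (fun i j h => by ext; simp [Cliff.e_mul_e i j h])

theorem Cliff.perm_unit (s : Equiv.Perm ι) (a : PiGroup ι) :
    Cliff.perm s (Cliff.unit a : Cliff ι) = (Cliff.unit (PiGroup.map s.toEmbedding a) : Cliff ι) := by
  have h : (Units.map (Cliff.perm s : Cliff ι →* Cliff ι)).comp Cliff.unit =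
      Cliff.unit.comp (PiGroup.map s.toEmbedding) :=
    PiGroup.hom_ext (by ext; simp [Cliff.unit])
      (fun i => by ext; simp [Cliff.unit, Cliff.perm_e])
  exact congrArg Units.val (DFunLike.congr_fun h a)

/-- The basic spin supermodule: the element `(g, a, s)` acts on the Clifford algebra by `(a, s)`,
where `a_i.u = e_i u`, `z.u = -u`, and `s` acts by the automorphism `s.e_i = e_{s(i)}`. -/
def cliffRep (Γ : Type u) [Group Γ] (ι : Type) [Fintype ι] :
    Representation ℂ (BG Γ ι) (Cliff ι) where
  toFun x := LinearMap.mulLeft ℂ (Cliff.unit x.left.2 : Cliff ι) ∘ₗ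
    (Cliff.perm x.right).toLinearMap
  map_one' := by
    have : Cliff.perm (1 : Equiv.Perm ι) = AlgHom.id ℂ (Cliff ι) :=
      Cliff.algHom_ext fun i => by simp [Cliff.perm_e]
    ext u
    simp [this]
  map_mul' x y := by
    have h1 : Cliff.perm (x * y).right = (Cliff.perm x.right).comp (Cliff.perm y.right) :=
      Cliff.algHom_ext fun i => by simp [Cliff.perm_e]
    have h2 : (Cliff.unit (x * y).left.2 : Cliff ι) =
        Cliff.unit x.left.2 * Cliff.perm x.right (Cliff.unit y.left.2 : Cliff ι) := by
      rw [Cliff.perm_unit, ← Units.val_mul, ← map_mul]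
      rfl
    apply LinearMap.ext
    intro u
    rw [h1, h2]
    simp only [LinearMap.comp_apply, Module.End.mul_apply, AlgHom.toLinearMap_apply,
      LinearMap.mulLeft_apply, AlgHom.comp_apply, map_mul, mul_assoc]

/-- The supermodule `V^{⊗ι} ⊗ L_ι`. -/
def basicRep (ι : Type) [Fintype ι] (V : FDRep ℂ Γ) :
    Representation ℂ (BG Γ ι) ((⨂[ℂ] _ : ι, V) ⊗[ℂ] Cliff ι) :=
  (tensorRep V.ρ).tprod (cliffRep Γ ι)

theorem involute_unit (a : PiGroup ι) :
    Units.map ((CliffordAlgebra.involute : Cliff ι →ₐ[ℂ] Cliff ι) : Cliff ι →* Cliff ι) (Cliff.unit a) = Cliff.unit a ∧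
      PiGroup.parity a = 1 ∨
    Units.map ((CliffordAlgebra.involute : Cliff ι →ₐ[ℂ] Cliff ι) : Cliff ι →* Cliff ι) (Cliff.unit a) = -Cliff.unit a ∧
      PiGroup.parity a ≠ 1 := by
  have hp : ∀ p q : Multiplicative (ZMod 2), p ≠ 1 → q ≠ 1 → p * q = 1 := by decide
  have ha : a ∈ Subgroup.closure (Set.range (PresentedGroup.of (rels := {w | PiRel ι w}))) := by
    rw [PresentedGroup.closure_range_of]; trivial
  induction ha using Subgroup.closure_induction with
  | mem x hx =>
    obtain ⟨o, rfl⟩ := hx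
    rcases o with _ | i
    · left
      change Units.map _ (Cliff.unit PiGroup.z) = Cliff.unit PiGroup.z ∧
        PiGroup.parity PiGroup.z = 1
      refine ⟨?_, by simp [PiGroup.parity]⟩
      ext
      simp [Cliff.unit]
    · right
      change Units.map _ (Cliff.unit (PiGroup.a i)) = -Cliff.unit (PiGroup.a i) ∧
        PiGroup.parity (PiGroup.a i) ≠ 1
      refine ⟨?_, by simp [PiGroup.parity]⟩
      ext
      simp [Cliff.unit, Cliff.e]
  | one => left; simp
  | mul x y _ _ hx hy =>
    rcases hx with ⟨h1, h2⟩ | ⟨h1, h2⟩ <;> rcases hy with ⟨h3, h4⟩ | ⟨h3, h4⟩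
    · left; simp only [map_mul, h1, h2, h3, h4]; simp
    · right; simp only [map_mul, h1, h2, h3]; simpa using h4
    · right; simp only [map_mul, h1, h4, h3]; simpa using h2
    · left; simp only [map_mul, h1, h3]; exact ⟨by simp, hp _ _ h2 h4⟩
  | inv x _ hx =>
    rcases hx with ⟨h1, h2⟩ | ⟨h1, h2⟩
    · left; rw [map_inv, map_inv, map_inv, h1, h2]; simp
    · right; rw [map_inv, map_inv, map_inv, h1]; exact ⟨by simp, by simpa using h2⟩

/-- The character of the spin supermodule `V^{⊗ι} ⊗ L_ι`, as an element of `R⁻`. -/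
def basicChar (ι : Type) [Fintype ι] (V : FDRep ℂ Γ) : SpinClassFn Γ ι :=
  ⟨fun x => LinearMap.trace ℂ _ (basicRep ι V x), by
    refine ⟨fun x y => ?_, fun x => ?_, fun x hx => ?_⟩
    · change LinearMap.trace ℂ _ (basicRep ι V (y * x * y⁻¹)) =
        LinearMap.trace ℂ _ (basicRep ι V x)
      rw [map_mul, LinearMap.trace_mul_comm, ← map_mul]
      simp
    · change LinearMap.trace ℂ _ (basicRep ι V (BG.z * x)) =
        -LinearMap.trace ℂ _ (basicRep ι V x)
      have hz : basicRep ι V BG.z = (-1 : ℂ) • 1 := by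
        have h1 : tensorRep V.ρ (BG.z : BG Γ ι) = 1 := by
          have : tensorRep V.ρ (BG.z : BG Γ ι) = tensorRep V.ρ (1 : BG Γ ι) := rfl
          rw [this, map_one]
        have h2 : cliffRep Γ ι BG.z = (-1 : ℂ) • cliffRep Γ ι 1 := by
          apply LinearMap.ext
          intro u
          change ((Cliff.unit PiGroup.z : (Cliff ι)ˣ) : Cliff ι) * Cliff.perm 1 u =
            (-1 : ℂ) • (((Cliff.unit 1 : (Cliff ι)ˣ) : Cliff ι) * Cliff.perm 1 u)
          simp [Cliff.unit]
        rw [basicRep, Representation.tprod_apply, h1, h2, map_one, TensorProduct.map_smul_right]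
        exact congrArg _ TensorProduct.map_id
      rw [map_mul, hz, smul_mul_assoc, one_mul, map_smul, neg_one_smul]
    · change LinearMap.trace ℂ _ (basicRep ι V x) = 0
      obtain ⟨-, h⟩ | ⟨h, -⟩ := involute_unit x.left.2
      · exact absurd h hx
      let J : Module.End ℂ (Cliff ι) := CliffordAlgebra.involute.toLinearMap
      let K : Module.End ℂ ((⨂[ℂ] _ : ι, V) ⊗[ℂ] Cliff ι) := TensorProduct.map LinearMap.id J
      have hJJ : J * J = 1 := LinearMap.ext fun u => CliffordAlgebra.involute_involute u
      have hKK : K * K = 1 := by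
        rw [Module.End.mul_eq_comp, ← TensorProduct.map_comp, ← Module.End.mul_eq_comp J, hJJ]
        exact TensorProduct.map_id
      have hperm : ∀ u : Cliff ι, CliffordAlgebra.involute (Cliff.perm x.right u) =
          Cliff.perm x.right (CliffordAlgebra.involute u) := by
        have : (CliffordAlgebra.involute : Cliff ι →ₐ[ℂ] Cliff ι).comp (Cliff.perm x.right) =
            (Cliff.perm x.right).comp CliffordAlgebra.involute :=
          Cliff.algHom_ext fun i => by
            have he : ∀ i : ι, CliffordAlgebra.involute (Cliff.e i) = -(Cliff.e i : Cliff ι) :=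
              fun i => CliffordAlgebra.involute_ι _
            simp [Cliff.perm_e, he]
        exact fun u => DFunLike.congr_fun this u
      have hu : CliffordAlgebra.involute (Cliff.unit x.left.2 : Cliff ι) =
          -(Cliff.unit x.left.2 : Cliff ι) := congrArg Units.val h
      have hJ : J * cliffRep Γ ι x = (-1 : ℂ) • (cliffRep Γ ι x * J) := by
        apply LinearMap.ext
        intro u
        change CliffordAlgebra.involute ((Cliff.unit x.left.2 : Cliff ι) * Cliff.perm x.right u) =
          (-1 : ℂ) • ((Cliff.unit x.left.2 : Cliff ι) *
            Cliff.perm x.right (CliffordAlgebra.involute u))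
        rw [map_mul, hu, hperm, neg_mul, neg_one_smul]
      have hK : K * basicRep ι V x = (-1 : ℂ) • (basicRep ι V x * K) := by
        rw [basicRep, Representation.tprod_apply, Module.End.mul_eq_comp, Module.End.mul_eq_comp,
          ← TensorProduct.map_comp, ← TensorProduct.map_comp, ← Module.End.mul_eq_comp J,
          ← Module.End.mul_eq_comp _ J, hJ, TensorProduct.map_smul_right]
        rfl
      have h1 : LinearMap.trace ℂ _ (basicRep ι V x) =
          -LinearMap.trace ℂ _ (basicRep ι V x) := by
        conv_lhs => rw [← mul_one (basicRep ι V x), ← hKK, ← mul_assoc, LinearMap.trace_mul_comm,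
          ← mul_assoc, hK]
        rw [smul_mul_assoc, mul_assoc, hKK, mul_one, map_smul, neg_one_smul]
      exact self_eq_neg.mp h1⟩

end Basic

/-! ### Class functions and irreducible characters of `Γ` -/

section Gamma

variable (Γ : Type u) [Group Γ]

/-- The space `R(Γ)` of complex class functions on `Γ`. -/
def ClassFn : Submodule ℂ (Γ → ℂ) where
  carrier := {f | ∀ x y, f (y * x * y⁻¹) = f x}
  zero_mem' := by simp
  add_mem' := fun hf hg x y => by simp [hf x y, hg x y]
  smul_mem' := fun c f hf x y => by simp [hf x y]

variable {Γ}

/-- The character of a finite-dimensional representation, as an element of `R(Γ)`. -/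
def charFn (V : FDRep ℂ Γ) : ClassFn Γ := ⟨V.character, fun x y => V.char_conj x y⟩

variable (Γ)

/-- The set `Γ^*` of irreducible complex characters. -/
def Irr : Type u := {f : ClassFn Γ // ∃ V : FDRep ℂ Γ, CategoryTheory.Simple V ∧ charFn V = f}

variable {Γ}

/-- The value of a class function at a conjugacy class. -/
def ClassFn.evalAt (f : ClassFn Γ) (c : ConjClasses Γ) : ℂ := f.1 (Quotient.out c)

/-- The value of a class function at the inverse `c⁻¹` of a conjugacy class. -/
def ClassFn.evalAtInv (f : ClassFn Γ) (c : ConjClasses Γ) : ℂ := f.1 (Quotient.out c)⁻¹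

variable [Fintype Γ]

/-- The bilinear form `⟨f, g⟩ = |Γ|⁻¹ ∑ f(x) g(x⁻¹)`. -/
def pairing (f g : ClassFn Γ) : ℂ := (Fintype.card Γ : ℂ)⁻¹ * ∑ x : Γ, f.1 x * g.1 x⁻¹

theorem pairing_irr (f g : Irr Γ) : (f = g → pairing f.1 g.1 = 1) ∧
    (f ≠ g → pairing f.1 g.1 = 0) := by
  obtain ⟨f, V, hV, rfl⟩ := f
  obtain ⟨g, W, hW, rfl⟩ := g
  let _ : Invertible (Nat.card Γ : ℂ) := invertibleOfNonzero (by simp [Nat.card_eq_fintype_card])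
  have h := FDRep.char_orthonormal V W
  rw [Nat.card_eq_fintype_card] at h
  constructor
  · intro e
    have e1 : charFn V = charFn W := congrArg Subtype.val e
    change pairing (charFn V) (charFn W) = 1
    rw [← e1]
    have h' := FDRep.char_orthonormal V V
    rw [Nat.card_eq_fintype_card, if_pos ⟨CategoryTheory.Iso.refl V⟩] at h'
    exact h'
  · intro e
    change pairing (charFn V) (charFn W) = 0
    refine h.trans (if_neg ?_)
    rintro ⟨i⟩
    exact e (Subtype.ext (Subtype.ext (FDRep.char_iso i)))

instance Irr.instFinite : Finite (Irr Γ) := by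
  have h : LinearIndependent ℂ (fun i : Irr Γ => (i.1 : ClassFn Γ)) := by
    rw [linearIndependent_iff']
    intro s c hc i hi
    have h1 : ∑ j ∈ s, c j * pairing j.1 i.1 = 0 := by
      have h2 : ∀ x : Γ, ∑ j ∈ s, c j * j.1.1 x = 0 := fun x => by
        have := congrFun (congrArg Subtype.val hc) x
        simpa using this
      calc ∑ j ∈ s, c j * pairing j.1 i.1
          = (Fintype.card Γ : ℂ)⁻¹ * ∑ x : Γ, (∑ j ∈ s, c j * j.1.1 x) * i.1.1 x⁻¹ := by
            simp only [pairing, Finset.mul_sum, Finset.sum_mul]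
            rw [Finset.sum_comm]
            refine Finset.sum_congr rfl fun x _ => Finset.sum_congr rfl fun j _ => ?_
            ring
        _ = 0 := by simp [h2]
    rw [Finset.sum_eq_single i (fun j _ hj => by rw [(pairing_irr j i).2 hj, mul_zero])
      (fun h => absurd hi h), (pairing_irr i i).1 rfl, mul_one] at h1
    exact h1
  exact h.finite

instance Irr.instFintype : Fintype (Irr Γ) := Fintype.ofFinite _

end Gamma

/-! ### Partition-valued functions and split conjugacy classes -/

section Classes

variable (Γ : Type u) [Group Γ] [Fintype Γ]

open scoped Classical in
/-- Functions `ρ` on the conjugacy classes of `Γ` whose values are partitions into odd parts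
(given by their multisets of parts), of total size `n`. -/
def OP (n : ℕ) : Type u :=
  {ρ : ConjClasses Γ → Multiset ℕ // (∀ c, ∀ i ∈ ρ c, Odd i) ∧ ∑ c, (ρ c).sum = n}

instance OP.instFinite (n : ℕ) : Finite (OP Γ n) := by
  classical
  have h1 : (⋃ k : Fin (n + 1), Set.range (Nat.Partition.parts (n := (k : ℕ)))).Finite :=
    Set.finite_iUnion fun k => Set.finite_range _
  have h2 := Set.Finite.pi (ι := ConjClasses Γ) (fun _ => h1)
  refine (h2.subset ?_).to_subtype
  rintro ρ ⟨ho, hs⟩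
  simp only [Set.mem_pi, Set.mem_univ, true_implies, Set.mem_iUnion]
  intro c
  have hle : (ρ c).sum ≤ n := by
    rw [← hs]
    exact Finset.single_le_sum (f := fun c => (ρ c).sum) (fun _ _ => Nat.zero_le _)
      (Finset.mem_univ c)
  exact ⟨⟨(ρ c).sum, by omega⟩, ⟨ρ c, fun {i} hi => (ho c i hi).pos, rfl⟩, rfl⟩

instance OP.instFintype (n : ℕ) : Fintype (OP Γ n) := Fintype.ofFinite _

variable {Γ} {n : ℕ}

open scoped Classical in
/-- The length `l(ρ)`, the total number of parts. -/
def OP.length (ρ : OP Γ n) : ℕ := ∑ c, Multiset.card (ρ.1 c)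

/-- The order `ζ_c = |Γ| / |c|` of the centralizer of an element of `c`. -/
def zeta (c : ConjClasses Γ) : ℂ := (Nat.card Γ : ℂ) / (Nat.card c.carrier : ℂ)

open scoped Classical in
/-- `Z_ρ = ∏_c ζ_c ^ l(ρ(c)) ∏_i i ^ m_i(c) m_i(c)!`, with `m_i(c)` the multiplicity of the part
`i` in `ρ(c)`. -/
def OP.Z (ρ : OP Γ n) : ℂ :=
  ∏ c, (zeta c ^ Multiset.card (ρ.1 c) *
    ∏ i ∈ (ρ.1 c).toFinset, ((i : ℂ) ^ (ρ.1 c).count i * ((ρ.1 c).count i).factorial))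

open scoped Classical in
/-- `∏_c γ(c) ^ l(ρ(c))`. -/
def OP.evalProd (ρ : OP Γ n) (γ : ClassFn Γ) : ℂ := ∏ c, ClassFn.evalAt γ c ^ Multiset.card (ρ.1 c)

/-- The cycle product `g_i g_{s⁻¹(i)} g_{s⁻²(i)} ⋯` along the cycle of `s` through `i`. -/
def cycleProd {ι : Type} (g : ι → Γ) (s : Equiv.Perm ι) (i : ι) : Γ :=
  ((List.range (Function.minimalPeriod s i)).map fun k => g ((s ^ k)⁻¹ i)).prod

open scoped Classical in
/-- The type of `(g, s) ∈ Γ^n ⋊ S_n`: at `c` it is the multiset of lengths of those cycles of `s`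
(fixed points included) whose cycle product lies in `c`. -/
def wreathType (g : Fin n → Γ) (s : Equiv.Perm (Fin n)) (c : ConjClasses Γ) : Multiset ℕ :=
  (Finset.univ.filter fun q : Quotient (Equiv.Perm.SameCycle.setoid s) =>
    ConjClasses.mk (cycleProd g s q.out) = c).val.map fun q => Function.minimalPeriod s q.out

/-- The class `D_ρ^+`: all conjugates of elements `(g, s)` of type `ρ`. -/
def Dpos (ρ : OP Γ n) : Set (BG Γ (Fin n)) :=
  {x | ∃ g s, wreathType g s = ρ.1 ∧ IsConj (BG.wreath g s) x}

/-- The class `D_ρ^- = z D_ρ^+`. -/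
def Dneg (ρ : OP Γ n) : Set (BG Γ (Fin n)) := {x | ∃ y ∈ Dpos ρ, x = BG.z * y}

/-- The value `f_ρ = f(D_ρ^+)`. -/
def classValue (f : SpinClassFn Γ (Fin n)) (ρ : OP Γ n) : ℂ :=
  f.1 (Classical.epsilon fun x => x ∈ Dpos ρ)

end Classes

/-! ### The Fock space, the characteristic map, and the characters `χ_n(γ)` -/

section Fock

variable (Γ : Type u) [Group Γ] [Fintype Γ]

/-- The Fock space: the symmetric algebra on the symbols `a_{-n}(γ)`, `n ≥ 1` odd,
`γ ∈ Γ^*`. -/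
abbrev Fock : Type u := MvPolynomial (Irr Γ × {n : ℕ // Odd n}) ℂ

/-- `R_Γ = ⨁_n R⁻(n)`. -/
abbrev RGamma : Type u := ⨁ n : ℕ, SpinClassFn Γ (Fin n)

variable {Γ}

/-- `a_{-n}(γ) = ∑_i s_i a_{-n}(γ_i)` for `γ = ∑_i s_i γ_i`, where `s_i = ⟨γ, γ_i⟩`. -/
def fockA (n : {n : ℕ // Odd n}) (γ : ClassFn Γ) : Fock Γ :=
  ∑ i : Irr Γ, pairing γ i.1 • MvPolynomial.X (i, n)

/-- `a_{-n}(c) = ∑_i γ_i(c⁻¹) a_{-n}(γ_i)`. -/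
def fockC (n : {n : ℕ // Odd n}) (c : ConjClasses Γ) : Fock Γ :=
  ∑ i : Irr Γ, ClassFn.evalAtInv i.1 c • MvPolynomial.X (i, n)

open scoped Classical in
/-- `a'_{-ρ} = ∏_c ∏_{i ∈ ρ(c)} a_{-i}(c)`. -/
def fockRho {n : ℕ} (ρ : OP Γ n) : Fock Γ :=
  ∏ c, ((ρ.1 c).attach.map fun i => fockC ⟨i.1, ρ.2.1 c i.1 i.2⟩ c).prod

/-- The characteristic map in degree `n`: `ch(f) = ∑_ρ Z_ρ⁻¹ f_ρ a'_{-ρ}`. -/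
def chDeg (n : ℕ) : SpinClassFn Γ (Fin n) →ₗ[ℂ] Fock Γ where
  toFun f := ∑ ρ : OP Γ n, (ρ.Z⁻¹ * classValue f ρ) • fockRho ρ
  map_add' f g := by
    rw [← Finset.sum_add_distrib]
    refine Finset.sum_congr rfl fun ρ _ => ?_
    rw [← add_smul, ← mul_add]
    rfl
  map_smul' r f := by
    rw [Finset.smul_sum]
    refine Finset.sum_congr rfl fun ρ _ => ?_
    rw [smul_smul]
    change (ρ.Z⁻¹ * (r * classValue f ρ)) • _ = (r * (ρ.Z⁻¹ * classValue f ρ)) • _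
    congr 1
    ring

/-- The characteristic map on `⨁_n R⁻(n)`. -/
def ch : RGamma Γ →ₗ[ℂ] Fock Γ := DirectSum.toModule ℂ ℕ (Fock Γ) chDeg

open scoped Classical in
/-- The generating function `∑_{n odd} (2/n) a_{-n}(γ) z^n`. -/
def heisenbergSeries (γ : ClassFn Γ) : PowerSeries (Fock Γ) :=
  PowerSeries.mk fun n => if h : Odd n then (2 / (n : ℂ)) • fockA ⟨n, h⟩ γ else 0

/-- A family of maps `χ_n : R(Γ) → R⁻(n)` is the extension of the basic spin characters to `R(Γ)`
if `χ_n(γ)` is the character of `V^{⊗n} ⊗ L_n` whenever `γ` is the character of a module `V`,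
and the values of `χ_n(∑_i s_i γ_i)` are polynomial functions of the coordinates `s_i ∈ ℂ` with
respect to the irreducible characters `γ_i`. -/
structure IsBasicSpinExtension (χ : ∀ n : ℕ, ClassFn Γ → SpinClassFn Γ (Fin n)) : Prop where
  char : ∀ (n : ℕ) (V : FDRep ℂ Γ), χ n (charFn V) = basicChar (Fin n) V
  poly : ∀ (n : ℕ) (x : BG Γ (Fin n)), ∃ P : MvPolynomial (Irr Γ) ℂ, ∀ s : Irr Γ → ℂ,
    (χ n (∑ i, s i • i.1)).1 x = MvPolynomial.eval s P

end Fock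

end SpinHyperoctahedral

end

noncomputable section

namespace SpinHyperoctahedral

universe u

/-! ### The structure of `Π_ι` -/

section PiStructure

variable {α β ι : Type}

/-! Everything follows from one explicit formula, `spinExt`: for x = (g, a, s), the value χ_n(γ)(x)
is the trace of x on the Clifford algebra times the product, over the cycles of s, of γ at the cycle
products of g. When γ is the character of V this is the character of V^{⊗n} ⊗ L_n: in a product
basis a diagonal entry of x on V^{⊗n} is a product of matrix entries running along the cycles of s,
so that summation leaves one trace per cycle (`trace_tensorRep`). Each cycle factor is linear in γ,
hence the formula is polynomial in the coordinates. The irreducible characters span R(Γ)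
(`ClassFn.mem_span_irr`), and a polynomial is determined by its values at points with natural-number
coordinates, which come from modules; so every extension equals `spinExt`
(`IsBasicSpinExtension.unique`).

The Clifford trace `cliffChar` is computed on monomials in the e_i, one for each multidegree in
{±1}^ι (`cliffChar_eq_sum`). At (g, s) it vanishes if s has a cycle of even length, because (g, s)
is then conjugate to z(g, s). Otherwise s fixes every monomial of s-invariant multidegree, and there
is one such multidegree for each choice of a sign per cycle, which gives 2^{number of cycles}.
Together with the cycle factors these are the values on D_ρ^±.

For the subtraction formula, the Clifford trace is multiplicative on spin products
(`cliffChar_map_mul_map`), and a spin product is the stabilizer of a block of indices. Hence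
Ind[χ_{n-m}(β) ⊗ χ_m(γ)](x) is a sum over the s-stable subsets A of size n - m, with β on the cycles
inside A and γ on those outside. Summing over m expands a product of sums β + γ over the cycles. The
sign (-1)^m replaces γ by -γ because the Clifford trace is supported on elements with odd cycles
only (`spinExt_neg`).

For the characteristic, a_{-j}(γ) is rewritten as the sum of ζ_c⁻¹ γ(c) a_{-j}(c) over c. The
multinomial theorem then expands the exponential into a sum over multiplicity functions k(c, j) with
j odd, that is, over ρ, and its terms are exactly those of ch(χ_n(γ)). -/

theorem PiGroup.z_mul_self : (PiGroup.z : PiGroup ι) * PiGroup.z = 1 := by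
  rw [← pow_two, PiGroup.z_sq]

theorem PiGroup.z_inv : (PiGroup.z : PiGroup ι)⁻¹ = PiGroup.z :=
  inv_eq_of_mul_eq_one_left PiGroup.z_mul_self

theorem PiGroup.z_mul_comm (p : PiGroup ι) : PiGroup.z * p = p * PiGroup.z := by
  have h : (MulAut.conj (PiGroup.z : PiGroup ι)).toMonoidHom = MonoidHom.id _ :=
    PiGroup.hom_ext (by simp) (fun i => by simp [PiGroup.z_mul_a])
  have h2 := DFunLike.congr_fun h p
  simp only [MulEquiv.coe_toMonoidHom, MulAut.conj_apply, MonoidHom.id_apply] at h2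
  exact mul_inv_eq_iff_eq_mul.mp h2

theorem PiGroup.zpow_mul_comm (k : ℕ) (p : PiGroup ι) :
    PiGroup.z ^ k * p = p * PiGroup.z ^ k :=
  ((show Commute PiGroup.z p from PiGroup.z_mul_comm p).pow_left k).eq

theorem PiGroup.z_mul_z_mul (p : PiGroup ι) : PiGroup.z * (PiGroup.z * p) = p := by
  rw [← mul_assoc, PiGroup.z_mul_self, one_mul]

theorem PiGroup.z_pow_eq (k : ℕ) :
    (PiGroup.z : PiGroup ι) ^ k = 1 ∨ (PiGroup.z : PiGroup ι) ^ k = PiGroup.z := by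
  induction k with
  | zero => simp
  | succ k ih =>
    rcases ih with h | h
    · right; rw [pow_succ, h, one_mul]
    · left; rw [pow_succ, h, PiGroup.z_mul_self]

/-- Inverses of generators need no separate case, since z⁻¹ = z and a_i⁻¹ = z a_i. -/
theorem PiGroup.induction_left {P : PiGroup ι → Prop} (one : P 1)
    (z_mul : ∀ p, P p → P (PiGroup.z * p)) (a_mul : ∀ i p, P p → P (PiGroup.a i * p))
    (p : PiGroup ι) : P p := by
  have hp : p ∈ Subgroup.closure (Set.range (PresentedGroup.of (rels := {w | PiRel ι w}))) := by
    rw [PresentedGroup.closure_range_of]; trivial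
  induction hp using Subgroup.closure_induction_left with
  | one => exact one
  | mul_left x hx y _ h =>
    obtain ⟨o | i, rfl⟩ := hx
    · exact z_mul _ h
    · exact a_mul _ _ h
  | inv_mul_cancel x hx y _ h =>
    obtain ⟨o | i, rfl⟩ := hx
    · change P (PiGroup.z⁻¹ * y)
      rw [PiGroup.z_inv]
      exact z_mul _ h
    · change P ((PiGroup.a i)⁻¹ * y)
      have : (PiGroup.a i : PiGroup ι)⁻¹ = PiGroup.z * PiGroup.a i := by
        rw [inv_eq_iff_mul_eq_one, PiGroup.z_mul_comm, ← mul_assoc, ← pow_two, PiGroup.a_sq,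
          PiGroup.z_mul_self]
      rw [this, mul_assoc]
      exact z_mul _ (a_mul _ _ h)

/-- The product of the generators along a list of indices. -/
def PiGroup.listProd (l : List ι) : PiGroup ι := (l.map PiGroup.a).prod

@[simp] theorem PiGroup.listProd_nil : PiGroup.listProd ([] : List ι) = 1 := rfl

@[simp] theorem PiGroup.listProd_cons (i : ι) (l : List ι) :
    PiGroup.listProd (i :: l) = PiGroup.a i * PiGroup.listProd l := by simp [PiGroup.listProd]

@[simp] theorem PiGroup.listProd_append (l l' : List ι) :
    PiGroup.listProd (l ++ l') = PiGroup.listProd l * PiGroup.listProd l' := by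
  simp [PiGroup.listProd]

theorem PiGroup.map_listProd (f : α ↪ β) (l : List α) :
    PiGroup.map f (PiGroup.listProd l) = PiGroup.listProd (l.map f) := by
  induction l with
  | nil => simp
  | cons i l ih => simp [ih]

theorem PiGroup.a_mul_listProd (i : ι) (l : List ι) (h : i ∉ l) :
    PiGroup.a i * PiGroup.listProd l =
      PiGroup.z ^ l.length * (PiGroup.listProd l * PiGroup.a i) := by
  induction l with
  | nil => simp
  | cons j l ih =>
    simp only [List.mem_cons, not_or] at h
    rw [PiGroup.listProd_cons, ← mul_assoc, PiGroup.a_mul_a i j h.1, mul_assoc, ih h.2,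
      List.length_cons, pow_succ', mul_assoc, mul_assoc, ← mul_assoc (PiGroup.a j),
      ← PiGroup.zpow_mul_comm]
    simp only [mul_assoc]

/-- Normal form up to ordering. Left multiplication by a_i prepends i if it is absent; otherwise a_i
is carried through to its twin at the cost of one z per crossing, and a_i² = z removes both. -/
theorem PiGroup.exists_listProd (p : PiGroup ι) :
    ∃ (k : ℕ) (l : List ι), l.Nodup ∧ p = PiGroup.z ^ k * PiGroup.listProd l := by
  induction p using PiGroup.induction_left with
  | one => exact ⟨0, [], by simp, by simp⟩
  | z_mul p h =>
    obtain ⟨k, l, hl, rfl⟩ := h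
    exact ⟨k + 1, l, hl, by rw [pow_succ', mul_assoc]⟩
  | a_mul i p h =>
    obtain ⟨k, l, hl, rfl⟩ := h
    by_cases hi : i ∈ l
    · obtain ⟨l1, l2, rfl⟩ := List.append_of_mem hi
      have hi1 : i ∉ l1 := fun h => by
        rw [List.nodup_append] at hl
        exact hl.2.2 i h i (by simp) rfl
      refine ⟨k + l1.length + 1, l1 ++ l2, hl.sublist (by simp), ?_⟩
      rw [← mul_assoc, ← PiGroup.zpow_mul_comm, mul_assoc, PiGroup.listProd_append,
        PiGroup.listProd_append, PiGroup.listProd_cons, ← mul_assoc (PiGroup.a i),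
        PiGroup.a_mul_listProd i l1 hi1, pow_succ, pow_add]
      simp only [mul_assoc]
      rw [← mul_assoc (PiGroup.a i), ← pow_two, PiGroup.a_sq, PiGroup.z_mul_comm,
        PiGroup.z_mul_comm, mul_assoc]
    · exact ⟨k, i :: l, List.nodup_cons.2 ⟨hi, hl⟩, by
        rw [← mul_assoc, ← PiGroup.zpow_mul_comm, mul_assoc, PiGroup.listProd_cons]⟩

/-- The sign character `a_i ↦ ε_i`, `z ↦ 1` of `Π_ι`. -/
def PiGroup.sgn (ε : ι → ℤˣ) : PiGroup ι →* ℤˣ :=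
  PiGroup.lift 1 ε (fun _ => Int.units_sq _) (by simp) (fun _ _ _ => by simp [mul_comm])

@[simp] theorem PiGroup.sgn_z (ε : ι → ℤˣ) : PiGroup.sgn ε PiGroup.z = 1 := by
  simp [PiGroup.sgn]

@[simp] theorem PiGroup.sgn_a (ε : ι → ℤˣ) (i : ι) : PiGroup.sgn ε (PiGroup.a i) = ε i := by
  simp [PiGroup.sgn]

theorem PiGroup.sgn_mul (ε ε' : ι → ℤˣ) (p : PiGroup ι) :
    PiGroup.sgn (ε * ε') p = PiGroup.sgn ε p * PiGroup.sgn ε' p := by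
  have : PiGroup.sgn (ε * ε') = PiGroup.sgn ε * PiGroup.sgn ε' :=
    PiGroup.hom_ext (by simp) (by simp)
  exact DFunLike.congr_fun this p

open scoped Classical in
/-- The multidegree of an element of `Π_ι`: at `i` it is the parity, written as a sign, of the
number of factors `a_i`. -/
def PiGroup.eta : PiGroup ι →* (ι → ℤˣ) :=
  MonoidHom.pi fun i => PiGroup.sgn (Pi.mulSingle i (-1))

open scoped Classical in
theorem PiGroup.eta_apply (p : PiGroup ι) (i : ι) :
    PiGroup.eta p i = PiGroup.sgn (Pi.mulSingle i (-1)) p := rfl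

@[simp] theorem PiGroup.eta_z : PiGroup.eta (PiGroup.z : PiGroup ι) = 1 := by
  ext i; simp [PiGroup.eta_apply]

@[simp] theorem PiGroup.eta_a_self (i : ι) : PiGroup.eta (PiGroup.a i) i = -1 := by
  simp [PiGroup.eta_apply]

theorem PiGroup.eta_a_of_ne {i j : ι} (h : j ≠ i) : PiGroup.eta (PiGroup.a i) j = 1 := by
  simp [PiGroup.eta_apply, h.symm]

theorem PiGroup.eta_listProd (l : List ι) (i : ι) (h : i ∉ l) :
    PiGroup.eta (PiGroup.listProd l) i = 1 := by
  induction l with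
  | nil => simp
  | cons j l ih =>
    simp only [List.mem_cons, not_or] at h
    simp [ih h.2, PiGroup.eta_a_of_ne h.1]

/-- In a normal form without repetition the first letter i of a nonempty word forces multidegree -1
at i. So the multidegree determines an element up to the factor z. -/
theorem PiGroup.eta_eq_one {p : PiGroup ι} :
    PiGroup.eta p = 1 ↔ p = 1 ∨ p = PiGroup.z := by
  constructor
  · intro h
    obtain ⟨k, l, hl, rfl⟩ := PiGroup.exists_listProd p
    cases l with
    | nil => simpa using PiGroup.z_pow_eq k
    | cons i l =>
      have h1 := congrFun h i
      simp [PiGroup.eta_listProd l i (List.nodup_cons.1 hl).1] at h1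
  · rintro (rfl | rfl) <;> simp

theorem PiGroup.eta_eq_iff {p q : PiGroup ι} :
    PiGroup.eta p = PiGroup.eta q ↔ p = q ∨ p = PiGroup.z * q := by
  rw [← mul_inv_eq_one, ← map_inv, ← map_mul, PiGroup.eta_eq_one, mul_inv_eq_one,
    mul_inv_eq_iff_eq_mul]

theorem PiGroup.eta_surjective [Finite ι] :
    Function.Surjective (PiGroup.eta : PiGroup ι → (ι → ℤˣ)) := by
  classical
  have := Fintype.ofFinite ι
  intro v
  change v ∈ PiGroup.eta.range
  rw [← Finset.univ_prod_mulSingle v]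
  refine Subgroup.prod_mem _ fun i _ => ?_
  rcases Int.units_eq_one_or (v i) with h | h
  · rw [h, Pi.mulSingle_one]; exact one_mem _
  · refine ⟨PiGroup.a i, ?_⟩
    ext j
    rw [h]
    by_cases hj : j = i
    · subst hj; simp
    · simp [PiGroup.eta_a_of_ne hj, hj]

theorem PiGroup.eta_map_apply (f : α ↪ β) (p : PiGroup α) (i : α) :
    PiGroup.eta (PiGroup.map f p) (f i) = PiGroup.eta p i := by
  have : ((Pi.evalMonoidHom _ (f i)).comp PiGroup.eta).comp (PiGroup.map f) =
      (Pi.evalMonoidHom _ i).comp PiGroup.eta := by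
    refine PiGroup.hom_ext (by simp) fun j => ?_
    by_cases h : i = j
    · subst h; simp
    · simp [PiGroup.eta_a_of_ne h, PiGroup.eta_a_of_ne (f.injective.ne h)]
  exact DFunLike.congr_fun this p

theorem PiGroup.eta_map_of_notMem (f : α ↪ β) (p : PiGroup α) (i : β) (hi : i ∉ Set.range f) :
    PiGroup.eta (PiGroup.map f p) i = 1 := by
  have : ((Pi.evalMonoidHom _ i).comp PiGroup.eta).comp (PiGroup.map f) = 1 := by
    refine PiGroup.hom_ext (by simp) fun j => ?_
    have : i ≠ f j := fun h => hi ⟨j, h.symm⟩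
    simp [PiGroup.eta_a_of_ne this]
  exact DFunLike.congr_fun this p

theorem PiGroup.eta_map_perm (s : Equiv.Perm ι) (p : PiGroup ι) (i : ι) :
    PiGroup.eta (PiGroup.map s.toEmbedding p) i = PiGroup.eta p (s⁻¹ i) := by
  have := PiGroup.eta_map_apply s.toEmbedding p (s⁻¹ i)
  simpa using this

instance Cliff.instNontrivial [Fintype ι] : Nontrivial (Cliff ι) :=
  let _ : Invertible (2 : ℂ) := invertibleOfNonzero two_ne_zero
  inferInstance

@[simp] theorem Cliff.unit_z [Fintype ι] :
    (Cliff.unit (PiGroup.z : PiGroup ι) : (Cliff ι)ˣ) = -1 := by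
  simp [Cliff.unit]

@[simp] theorem Cliff.unit_a [Fintype ι] (i : ι) :
    ((Cliff.unit (PiGroup.a i : PiGroup ι) : (Cliff ι)ˣ) : Cliff ι) = Cliff.e i := by
  simp [Cliff.unit]

/-- The presentation alone does not show that z survives; the Clifford algebra, where z becomes -1 ≠
1, does. -/
theorem PiGroup.z_ne_one [Finite ι] : (PiGroup.z : PiGroup ι) ≠ 1 := by
  have := Fintype.ofFinite ι
  intro h
  have h1 : ((Cliff.unit (PiGroup.z : PiGroup ι) : (Cliff ι)ˣ) : Cliff ι) = 1 := by simp [h]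
  have h2 : (-1 : Cliff ι) = 1 := by simpa using h1
  have h3 : (2 : ℂ) • (1 : Cliff ι) = 0 := by
    rw [two_smul]; nth_rewrite 1 [← h2]; simp
  rcases smul_eq_zero.1 h3 with h4 | h4
  · exact two_ne_zero h4
  · exact one_ne_zero h4

open scoped Classical in
/-- The function on `Π_ι` supported on `{1, z}` with values `1` at `1` and `-1` at `z`. -/
def PiGroup.delta (p : PiGroup ι) : ℂ := if p = 1 then 1 else if p = PiGroup.z then -1 else 0

@[simp] theorem PiGroup.delta_one : PiGroup.delta (1 : PiGroup ι) = 1 := by simp [PiGroup.delta]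

theorem PiGroup.delta_z [Finite ι] : PiGroup.delta (PiGroup.z : PiGroup ι) = -1 := by
  simp [PiGroup.delta, PiGroup.z_ne_one]

theorem PiGroup.delta_of_eta_ne {p : PiGroup ι} (h : PiGroup.eta p ≠ 1) : PiGroup.delta p = 0 := by
  rw [Ne, PiGroup.eta_eq_one, not_or] at h
  simp [PiGroup.delta, h.1, h.2]

theorem PiGroup.delta_z_mul [Finite ι] (p : PiGroup ι) :
    PiGroup.delta (PiGroup.z * p) = -PiGroup.delta p := by
  by_cases h : PiGroup.eta p = 1
  · rcases PiGroup.eta_eq_one.1 h with rfl | rfl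
    · simp [PiGroup.delta_z]
    · simp [PiGroup.z_mul_self, PiGroup.delta_z]
  · rw [PiGroup.delta_of_eta_ne h, PiGroup.delta_of_eta_ne (by simpa using h), neg_zero]

theorem PiGroup.delta_mul_of_eta_eq_one [Finite ι] {p : PiGroup ι} (h : PiGroup.eta p = 1)
    (q : PiGroup ι) : PiGroup.delta (p * q) = PiGroup.delta p * PiGroup.delta q := by
  rcases PiGroup.eta_eq_one.1 h with rfl | rfl
  · simp
  · simp [PiGroup.delta_z_mul, PiGroup.delta_z]

theorem PiGroup.delta_map [Finite α] [Finite β] (f : α ↪ β) (p : PiGroup α) :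
    PiGroup.delta (PiGroup.map f p) = PiGroup.delta p := by
  by_cases h : PiGroup.eta p = 1
  · rcases PiGroup.eta_eq_one.1 h with rfl | rfl
    · simp
    · simp [PiGroup.delta_z]
  · rw [PiGroup.delta_of_eta_ne h, PiGroup.delta_of_eta_ne]
    contrapose! h
    ext i
    rw [← PiGroup.eta_map_apply f, h]
    simp

variable {Γ : Type u} [Group Γ]

/-- Two elements of equal multidegree differ at most by the central z, which occurs twice here and
cancels. Diagonal coefficients thus do not depend on the chosen lift of a multidegree. -/
theorem delta_diag_congr (x : BG Γ ι) {p q : PiGroup ι} (h : PiGroup.eta p = PiGroup.eta q) :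
    PiGroup.delta (p⁻¹ * (x.left.2 * PiGroup.map x.right.toEmbedding p)) =
      PiGroup.delta (q⁻¹ * (x.left.2 * PiGroup.map x.right.toEmbedding q)) := by
  rcases PiGroup.eta_eq_iff.1 h with rfl | rfl
  · rfl
  · congr 1
    rw [mul_inv_rev, PiGroup.z_inv, map_mul, PiGroup.map_z, ← mul_assoc x.left.2,
      ← PiGroup.z_mul_comm x.left.2, mul_assoc, mul_assoc, PiGroup.z_mul_z_mul]

end PiStructure

/-! ### The trace on the Clifford algebra -/

section CliffTrace

variable {ι : Type} [Fintype ι]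

/-- The automorphism `e_i ↦ ε_i e_i` of the Clifford algebra. -/
def Cliff.flip (ε : ι → ℤˣ) : Cliff ι →ₐ[ℂ] Cliff ι :=
  CliffordAlgebra.map
    { LinearMap.pi fun i => (((ε i : ℤ) : ℂ)) • LinearMap.proj i with
      map_app' := fun v => by
        change negSumSq ι (fun i => ((ε i : ℤ) : ℂ) * v i) = _
        rw [negSumSq_apply, negSumSq_apply]
        congr 1
        refine Finset.sum_congr rfl fun i _ => ?_
        rcases Int.units_eq_one_or (ε i) with h | h <;> simp [h] }

theorem Cliff.flip_e (ε : ι → ℤˣ) (i : ι) :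
    Cliff.flip ε (Cliff.e i) = ((ε i : ℤ) : ℂ) • Cliff.e i := by
  classical
  rw [Cliff.e, Cliff.flip, CliffordAlgebra.map_apply_ι, ← map_smul]
  congr 1
  ext j
  change ((ε j : ℤ) : ℂ) * (Pi.single i (1 : ℂ) : ι → ℂ) j = _
  by_cases h : j = i
  · subst h; simp
  · simp [h]

theorem Cliff.flip_unit (ε : ι → ℤˣ) (p : PiGroup ι) :
    Cliff.flip ε (Cliff.unit p : Cliff ι) =
      ((PiGroup.sgn ε p : ℤ) : ℂ) • (Cliff.unit p : Cliff ι) := by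
  induction p using PiGroup.induction_left with
  | one => simp
  | z_mul p h => simp [h]
  | a_mul i p h => simp [h, Cliff.flip_e, mul_smul, smul_comm (((ε i : ℤ)) : ℂ)]

/-- Orthogonality of characters of {±1}^ι: if p has multidegree -1 at i, changing the sign of ε_i
negates the sum. -/
theorem PiGroup.sum_sgn (p : PiGroup ι) [DecidableEq ι] [Decidable (PiGroup.eta p = 1)] :
    ∑ ε : ι → ℤˣ, ((PiGroup.sgn ε p : ℤ) : ℂ) =
      if PiGroup.eta p = 1 then (Fintype.card (ι → ℤˣ) : ℂ) else 0 := by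
  split_ifs with h
  · have : ∀ ε : ι → ℤˣ, PiGroup.sgn ε p = 1 := fun ε => by
      rcases PiGroup.eta_eq_one.1 h with rfl | rfl <;> simp
    simp [this]
  · obtain ⟨i, hi⟩ := Function.ne_iff.1 h
    have h1 : PiGroup.sgn (Pi.mulSingle i (-1)) p = -1 := by
      have := (Int.units_eq_one_or (PiGroup.eta p i)).resolve_left hi
      rw [PiGroup.eta_apply] at this
      convert this
    have h2 := Equiv.sum_comp (Equiv.mulLeft (Pi.mulSingle i (-1) : ι → ℤˣ))
      (fun ε : ι → ℤˣ => ((PiGroup.sgn ε p : ℤ) : ℂ))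
    simp only [Equiv.coe_mulLeft, PiGroup.sgn_mul, h1] at h2
    simp only [neg_mul, one_mul, Units.val_neg, Int.cast_neg, Finset.sum_neg_distrib] at h2
    exact self_eq_neg.1 h2.symm

/-- The constant-coefficient functional, obtained without a basis: averaging over all sign
automorphisms e_i ↦ ε_i e_i kills every monomial of nontrivial multidegree, and any linear form with
value 1 at 1 reads off what remains. -/
theorem Cliff.exists_functional :
    ∃ τ : Cliff ι →ₗ[ℂ] ℂ, ∀ p : PiGroup ι, τ (Cliff.unit p : Cliff ι) = PiGroup.delta p := by
  classical
  obtain ⟨l, hl⟩ : ∃ l : Cliff ι →ₗ[ℂ] ℂ, l 1 = 1 :=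
    Module.Projective.exists_dual_eq_one ℂ one_ne_zero
  refine ⟨(Fintype.card (ι → ℤˣ) : ℂ)⁻¹ • l ∘ₗ ∑ ε : ι → ℤˣ, (Cliff.flip ε).toLinearMap,
    fun p => ?_⟩
  simp only [LinearMap.smul_apply, LinearMap.comp_apply, LinearMap.sum_apply,
    AlgHom.toLinearMap_apply, Cliff.flip_unit, ← Finset.sum_smul, PiGroup.sum_sgn]
  split_ifs with h
  · rw [map_smul, smul_eq_mul, smul_eq_mul, inv_mul_cancel_left₀ (by simp)]
    rcases PiGroup.eta_eq_one.1 h with rfl | rfl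
    · simp [hl]
    · simp [hl, PiGroup.delta_z]
  · simp [PiGroup.delta_of_eta_ne h]

theorem Cliff.span_unit :
    Submodule.span ℂ (Set.range fun p : PiGroup ι => (Cliff.unit p : Cliff ι)) = ⊤ := by
  classical
  rw [eq_top_iff]
  rintro u -
  induction u using CliffordAlgebra.induction with
  | algebraMap r =>
    rw [Algebra.algebraMap_eq_smul_one]
    exact Submodule.smul_mem _ _ (Submodule.subset_span ⟨1, by simp⟩)
  | ι v =>
    have : v = ∑ i, v i • (Pi.single i 1 : ι → ℂ) := by
      ext j; simp [Finset.sum_apply, Pi.single_apply]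
    rw [this, map_sum]
    refine Submodule.sum_mem _ fun i _ => ?_
    rw [map_smul]
    refine Submodule.smul_mem _ _ (Submodule.subset_span ⟨PiGroup.a i, ?_⟩)
    simp only [Cliff.unit_a, Cliff.e]
  | mul u v hu hv =>
    have := Submodule.mul_mem_mul hu hv
    rw [Submodule.span_mul_span] at this
    refine Submodule.span_mono ?_ this
    rintro _ ⟨_, ⟨p, rfl⟩, _, ⟨q, rfl⟩, rfl⟩
    exact ⟨p * q, by simp⟩
  | add u v hu hv => exact Submodule.add_mem _ hu hv

instance Cliff.instFinite : Module.Finite ℂ (Cliff ι) :=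
  ⟨Submodule.fg_def.2 ⟨_, Set.finite_range _, Cliff.span_unit⟩⟩

/-- A chosen element of `Π_ι` of given multidegree. -/
def PiGroup.sec (v : ι → ℤˣ) : PiGroup ι := (PiGroup.eta_surjective v).choose

@[simp] theorem PiGroup.eta_sec (v : ι → ℤˣ) : PiGroup.eta (PiGroup.sec v) = v :=
  (PiGroup.eta_surjective v).choose_spec

/-- The identity of the Clifford algebra factors as π ∘ j through ℂ^{2^ι}, where j takes
coefficients and π reassembles. Then tr T = tr(j T π), so only the spanning property of the
monomials is used, not their independence. -/
theorem Cliff.trace_eq_sum [DecidableEq ι] (τ : Cliff ι →ₗ[ℂ] ℂ)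
    (hτ : ∀ p : PiGroup ι, τ (Cliff.unit p : Cliff ι) = PiGroup.delta p)
    (T : Module.End ℂ (Cliff ι)) :
    LinearMap.trace ℂ _ T = ∑ v : ι → ℤˣ,
      τ ((Cliff.unit (PiGroup.sec v)⁻¹ : Cliff ι) * T (Cliff.unit (PiGroup.sec v) : Cliff ι)) := by
  let π : ((ι → ℤˣ) → ℂ) →ₗ[ℂ] Cliff ι :=
    ∑ v : ι → ℤˣ, (LinearMap.proj v : ((ι → ℤˣ) → ℂ) →ₗ[ℂ] ℂ).smulRight (Cliff.unit (PiGroup.sec v) : Cliff ι)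
  let j : Cliff ι →ₗ[ℂ] ((ι → ℤˣ) → ℂ) :=
    LinearMap.pi fun v => τ ∘ₗ LinearMap.mulLeft ℂ (Cliff.unit (PiGroup.sec v)⁻¹ : Cliff ι)
  have hπj : π ∘ₗ j = LinearMap.id := by
    apply LinearMap.ext_on_range Cliff.span_unit
    intro p
    have h1 : ∀ v : ι → ℤˣ, v ≠ PiGroup.eta p → τ ((Cliff.unit (PiGroup.sec v)⁻¹ : Cliff ι) * (Cliff.unit p : Cliff ι)) = 0 := by
      intro v hv
      rw [← Units.val_mul, ← map_mul, hτ, PiGroup.delta_of_eta_ne]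
      rw [map_mul, map_inv, PiGroup.eta_sec, Ne, inv_mul_eq_one]
      exact hv
    simp only [π, j, LinearMap.comp_apply, LinearMap.sum_apply, LinearMap.smulRight_apply,
      LinearMap.proj_apply, LinearMap.pi_apply, LinearMap.mulLeft_apply, LinearMap.id_apply]
    rw [Finset.sum_eq_single (PiGroup.eta p) (fun v _ hv => by rw [h1 v hv, zero_smul])
      (by simp), ← Units.val_mul, ← map_mul, hτ]
    -- The chosen lift of the multidegree of p is p or z p; in the second case the -1 from `delta`
    -- cancels the -1 from `Cliff.unit`.
    rcases PiGroup.eta_eq_iff.1 (PiGroup.eta_sec (PiGroup.eta p)) with h | h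
    · rw [h]; simp
    · rw [h, mul_inv_rev, PiGroup.z_inv, mul_assoc, PiGroup.z_mul_comm, inv_mul_cancel_left,
        PiGroup.delta_z]
      simp
  calc LinearMap.trace ℂ _ T = LinearMap.trace ℂ _ ((T ∘ₗ π) ∘ₗ j) := by
        rw [LinearMap.comp_assoc, hπj, LinearMap.comp_id]
    _ = LinearMap.trace ℂ _ (j ∘ₗ (T ∘ₗ π)) := LinearMap.trace_comp_comm' _ _
    _ = _ := by
        rw [LinearMap.trace_eq_matrix_trace ℂ (Pi.basisFun ℂ (ι → ℤˣ)), Matrix.trace]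
        refine Finset.sum_congr rfl fun v _ => ?_
        simp [j, π, Pi.single_apply]

variable {Γ : Type u} [Group Γ]

/-- The character of the basic spin supermodule `L_ι`. -/
def cliffChar (x : BG Γ ι) : ℂ := LinearMap.trace ℂ _ (cliffRep Γ ι x)

theorem cliffChar_eq_sum [DecidableEq ι] (x : BG Γ ι) :
    cliffChar x = ∑ v : ι → ℤˣ, PiGroup.delta
      ((PiGroup.sec v)⁻¹ * (x.left.2 * PiGroup.map x.right.toEmbedding (PiGroup.sec v))) := by
  obtain ⟨τ, hτ⟩ := Cliff.exists_functional (ι := ι)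
  rw [cliffChar, Cliff.trace_eq_sum τ hτ]
  refine Finset.sum_congr rfl fun v _ => ?_
  rw [← hτ, map_mul Cliff.unit, map_mul Cliff.unit, Units.val_mul, Units.val_mul, ← Cliff.perm_unit]
  rfl

end CliffTrace

/-! ### Values of the basic spin character on `(g, s)` and on spin products -/

section CliffCharValues

variable {ι : Type} {Γ : Type u} [Group Γ]

theorem BG.conj_pi (x : BG Γ ι) (p : PiGroup ι) :
    (⟨(1, p), 1⟩ : BG Γ ι)⁻¹ * x * (⟨(1, p), 1⟩ : BG Γ ι) =
      ⟨(x.left.1, p⁻¹ * (x.left.2 * PiGroup.map x.right.toEmbedding p)), x.right⟩ := by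
  rw [mul_assoc, inv_mul_eq_iff_eq_mul]
  refine SemidirectProduct.ext (Prod.ext ?_ ?_) ?_
  · change x.left.1 * (fun _ => 1) = (1 : ι → Γ) * fun i => x.left.1 i
    ext i; simp
  · change x.left.2 * PiGroup.map x.right.toEmbedding p = p * PiGroup.map (Function.Embedding.refl ι)
      (p⁻¹ * (x.left.2 * PiGroup.map x.right.toEmbedding p))
    rw [PiGroup.map_refl, mul_inv_cancel_left]
  · change x.right * 1 = 1 * x.right
    simp

theorem BG.z_pow_mul_wreath (k : ℕ) (g : ι → Γ) (s : Equiv.Perm ι) :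
    (BG.z : BG Γ ι) ^ k * BG.wreath g s = ⟨(g, PiGroup.z ^ k), s⟩ := by
  induction k with
  | zero => rw [pow_zero, pow_zero, one_mul]; rfl
  | succ k ih =>
    rw [pow_succ', mul_assoc, ih]
    refine SemidirectProduct.ext (Prod.ext ?_ ?_) ?_
    · change (1 : ι → Γ) * (fun i => g i) = g
      rw [one_mul]
    · change PiGroup.z * PiGroup.map (Function.Embedding.refl ι) (PiGroup.z ^ k) = _
      rw [PiGroup.map_refl, ← pow_succ']
    · change 1 * s = s
      rw [one_mul]

theorem minimalPeriod_perm_pos [Finite ι] (s : Equiv.Perm ι) (i : ι) :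
    0 < Function.minimalPeriod s i :=
  Function.minimalPeriod_pos_of_mem_periodicPts (s.injective.mem_periodicPts i)

/-- Take p to be the product of the generators along the cycle of i. Applying s rotates this product
cyclically, which moves one generator past all the others; their number is odd, so the rotation
costs one z. -/
theorem exists_map_eq_z_mul_of_even_period [Finite ι] (s : Equiv.Perm ι) (i : ι)
    (h : Even (Function.minimalPeriod s i)) :
    ∃ p : PiGroup ι, PiGroup.map s.toEmbedding p = PiGroup.z * p := by
  obtain ⟨m, hm⟩ := Nat.exists_eq_succ_of_ne_zero (minimalPeriod_perm_pos s i).ne'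
  -- The cycle without its starting point i; it has m = period - 1 entries.
  let l : List ι := (List.range m).map fun k => s^[k + 1] i
  have hi : i ∉ l := by
    simp only [l, List.mem_map, List.mem_range, not_exists, not_and]
    intro k hk h
    have := Function.IsPeriodicPt.minimalPeriod_le (f := s) (x := i) (Nat.succ_pos k) h
    omega
  have hl : (i :: l).map s = l ++ [i] := by
    have h1 : i :: l = (List.range (m + 1)).map fun k => s^[k] i := by
      rw [List.range_succ_eq_map, List.map_cons, List.map_map]
      rfl
    have h2 : s^[m + 1] i = i := by
      rw [← Nat.succ_eq_add_one, ← hm]; exact Function.iterate_minimalPeriod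
    rw [h1, List.map_map, List.range_succ, List.map_append]
    simp only [l, List.map_cons, List.map_nil, Function.comp_apply,
      ← Function.iterate_succ_apply' s, h2]
    congr 1
    refine List.map_congr_left fun k _ => ?_
    simp only [Function.comp_apply, ← Function.iterate_succ_apply' s]
  refine ⟨PiGroup.listProd (i :: l), ?_⟩
  have hodd : Odd m := by
    rw [hm, Nat.succ_eq_add_one, Nat.even_add_one, Nat.not_even_iff_odd] at h
    exact h
  have hz : (PiGroup.z : PiGroup ι) ^ m = PiGroup.z := by
    obtain ⟨r, rfl⟩ := hodd
    rw [pow_succ, pow_mul, PiGroup.z_sq, one_pow, one_mul]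
  rw [PiGroup.map_listProd]
  change PiGroup.listProd ((i :: l).map s) = _
  rw [hl, PiGroup.listProd_append, PiGroup.listProd_cons i l, PiGroup.a_mul_listProd i l hi]
  simp only [l, List.length_map, List.length_range, hz]
  rw [PiGroup.z_mul_z_mul]
  simp

theorem exists_odd_pow_eq_one [Finite ι] (s : Equiv.Perm ι)
    (h : ∀ i, Odd (Function.minimalPeriod s i)) : ∃ N, Odd N ∧ s ^ N = 1 := by
  have := Fintype.ofFinite ι
  refine ⟨∏ i, Function.minimalPeriod s i, Finset.prod_induction _ Odd (fun _ _ => Odd.mul)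
    odd_one fun i _ => h i, ?_⟩
  ext i
  rw [Equiv.Perm.coe_one, id, ← Equiv.Perm.iterate_eq_pow]
  exact (Function.isPeriodicPt_minimalPeriod s i).trans_dvd
    (Finset.dvd_prod_of_mem _ (Finset.mem_univ i))

variable [Fintype ι]

theorem cliffChar_conj (x y : BG Γ ι) : cliffChar (y⁻¹ * x * y) = cliffChar x := by
  rw [cliffChar, map_mul, LinearMap.trace_mul_comm, ← map_mul, mul_inv_cancel_left]
  rfl

theorem cliffChar_z_mul (x : BG Γ ι) : cliffChar (BG.z * x) = -cliffChar x := by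
  have h : cliffRep Γ ι BG.z = (-1 : ℂ) • 1 := by
    apply LinearMap.ext
    intro u
    change ((Cliff.unit PiGroup.z : (Cliff ι)ˣ) : Cliff ι) * Cliff.perm 1 u = (-1 : ℂ) • u
    have : Cliff.perm (1 : Equiv.Perm ι) = AlgHom.id ℂ (Cliff ι) :=
      Cliff.algHom_ext fun i => by simp [Cliff.perm_e]
    simp [this]
  rw [cliffChar, map_mul, h, smul_mul_assoc, one_mul, map_smul, neg_one_smul]
  rfl

theorem cliffChar_z_pow_mul (k : ℕ) (x : BG Γ ι) :
    cliffChar (BG.z ^ k * x) = (-1) ^ k * cliffChar x := by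
  induction k with
  | zero => simp
  | succ k ih => rw [pow_succ', mul_assoc, cliffChar_z_mul, ih, pow_succ]; ring

/-- With s(p) = z p, conjugation by p takes (g, s) to z(g, s), where the trace has the opposite
sign. -/
theorem cliffChar_wreath_of_even (g : ι → Γ) (s : Equiv.Perm ι) (i : ι)
    (h : Even (Function.minimalPeriod s i)) : cliffChar (BG.wreath g s) = 0 := by
  obtain ⟨p, hp⟩ := exists_map_eq_z_mul_of_even_period s i h
  have h1 := BG.conj_pi (BG.wreath g s) p
  have h2 : (⟨((BG.wreath g s).left.1, p⁻¹ * ((BG.wreath g s).left.2 *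
      PiGroup.map (BG.wreath g s).right.toEmbedding p)), (BG.wreath g s).right⟩ : BG Γ ι) =
      BG.z * BG.wreath g s := by
    rw [← pow_one BG.z, BG.z_pow_mul_wreath, pow_one]
    change (⟨(g, p⁻¹ * (1 * PiGroup.map s.toEmbedding p)), s⟩ : BG Γ ι) = _
    rw [one_mul, hp, PiGroup.z_mul_comm, inv_mul_cancel_left]
  have h3 := cliffChar_conj (BG.wreath g s) (⟨(1, p), 1⟩ : BG Γ ι)
  rw [h1, h2, cliffChar_z_mul] at h3
  exact self_eq_neg.1 h3.symm

/-- A nonzero trace has a nonzero diagonal coefficient, at some monomial p; then p⁻¹ a s(p) is 1 or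
z, and conjugation by p removes a up to a power of z. -/
theorem exists_conj_wreath_of_cliffChar_ne_zero (x : BG Γ ι) (h : cliffChar x ≠ 0) :
    ∃ (k : ℕ) (y : BG Γ ι), y⁻¹ * x * y = BG.z ^ k * BG.wreath x.left.1 x.right := by
  classical
  rw [cliffChar_eq_sum] at h
  obtain ⟨v, -, hv⟩ := Finset.exists_ne_zero_of_sum_ne_zero h
  have h1 : PiGroup.eta ((PiGroup.sec v)⁻¹ * (x.left.2 *
      PiGroup.map x.right.toEmbedding (PiGroup.sec v))) = 1 := by
    by_contra h2
    exact hv (PiGroup.delta_of_eta_ne h2)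
  rcases PiGroup.eta_eq_one.1 h1 with h2 | h2
  · exact ⟨0, _, by rw [BG.conj_pi, h2, BG.z_pow_mul_wreath, pow_zero]⟩
  · exact ⟨1, _, by rw [BG.conj_pi, h2, BG.z_pow_mul_wreath, pow_one]⟩

theorem odd_minimalPeriod_of_cliffChar_ne_zero (x : BG Γ ι) (h : cliffChar x ≠ 0) (i : ι) :
    Odd (Function.minimalPeriod x.right i) := by
  obtain ⟨k, y, hy⟩ := exists_conj_wreath_of_cliffChar_ne_zero x h
  rw [← cliffChar_conj x y, hy, cliffChar_z_pow_mul] at h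
  by_contra hi
  exact h (by rw [cliffChar_wreath_of_even _ _ i (Nat.not_odd_iff_even.1 hi), mul_zero])

theorem card_invariant_functions {κ : Type*} [Finite κ] (s : Equiv.Perm ι) :
    Nat.card {v : ι → κ // ∀ i, v (s⁻¹ i) = v i} =
      Nat.card κ ^ Nat.card (Quotient (Equiv.Perm.SameCycle.setoid s)) := by
  rw [← Nat.card_fun]
  refine Nat.card_congr
    { toFun := fun v q => Quotient.lift v.1 (fun i j (h : s.SameCycle i j) => ?_) q
      invFun := fun w => ⟨fun i => w (Quotient.mk _ i), fun i => congrArg w (Quotient.sound ?_)⟩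
      left_inv := fun v => rfl
      right_inv := fun w => funext fun q => by
        induction q using Quotient.inductionOn with
        | _ i => rfl }
  · obtain ⟨k, rfl⟩ := h
    have h1 : ∀ i, v.1 (s i) = v.1 i := fun i => by simpa using (v.2 (s i)).symm
    have h2 : ∀ i, v.1 (s⁻¹ i) = v.1 i := v.2
    induction k using Int.induction_on with
    | zero => simp
    | succ k ih => rw [add_comm, zpow_add, zpow_one, Equiv.Perm.mul_apply, h1, ← ih]
    | pred k ih => rw [sub_eq_neg_add, zpow_add, zpow_neg_one, Equiv.Perm.mul_apply, h2, ← ih]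
  · exact ⟨1, by simp⟩

/-- Only monomials of s-invariant multidegree contribute, and s multiplies such a monomial by ±1.
The sign is + because some odd power of s is the identity. The trace therefore counts the sign
functions constant on cycles. -/
theorem cliffChar_wreath_of_odd (g : ι → Γ) (s : Equiv.Perm ι)
    (h : ∀ i, Odd (Function.minimalPeriod s i)) : cliffChar (BG.wreath g s) =
      2 ^ Nat.card (Quotient (Equiv.Perm.SameCycle.setoid s)) := by
  classical
  obtain ⟨N, hN, hs⟩ := exists_odd_pow_eq_one s h
  have hD : ∀ v : ι → ℤˣ, PiGroup.delta ((PiGroup.sec v)⁻¹ * ((BG.wreath g s).left.2 *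
      PiGroup.map (BG.wreath g s).right.toEmbedding (PiGroup.sec v))) =
        if ∀ i, v (s⁻¹ i) = v i then 1 else 0 := by
    intro v
    change PiGroup.delta ((PiGroup.sec v)⁻¹ * (1 * PiGroup.map s.toEmbedding (PiGroup.sec v))) = _
    rw [one_mul]
    split_ifs with hv
    · have h1 : PiGroup.eta (PiGroup.map s.toEmbedding (PiGroup.sec v)) =
          PiGroup.eta (PiGroup.sec v) := by
        ext i
        rw [PiGroup.eta_map_perm, PiGroup.eta_sec, hv]
      rcases PiGroup.eta_eq_iff.1 h1 with h2 | h2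
      · rw [h2, inv_mul_cancel, PiGroup.delta_one]
      · exfalso
        have h3 : ∀ k : ℕ, PiGroup.map (s ^ k).toEmbedding (PiGroup.sec v) =
            PiGroup.z ^ k * PiGroup.sec v := by
          intro k
          induction k with
          | zero => rw [pow_zero, pow_zero, one_mul]; exact PiGroup.map_refl _
          | succ k ih =>
            have : (s ^ (k + 1)).toEmbedding = (s ^ k).toEmbedding.trans s.toEmbedding := by
              rw [pow_succ']; rfl
            rw [this, ← PiGroup.map_map, ih, map_mul, map_pow, PiGroup.map_z, h2, pow_succ,
              mul_assoc]
        have h4 := h3 N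
        rw [hs] at h4
        have h5 : PiGroup.map (1 : Equiv.Perm ι).toEmbedding (PiGroup.sec v) = PiGroup.sec v :=
          PiGroup.map_refl _
        obtain ⟨r, rfl⟩ := hN
        rw [h5, pow_succ, pow_mul, PiGroup.z_sq, one_pow, one_mul, right_eq_mul] at h4
        exact PiGroup.z_ne_one h4
    · refine PiGroup.delta_of_eta_ne fun h1 => hv fun i => ?_
      rw [map_mul, map_inv, inv_mul_eq_one] at h1
      have := congrFun h1 i
      rw [PiGroup.eta_map_perm, PiGroup.eta_sec] at this
      exact this.symm
  rw [cliffChar_eq_sum, Finset.sum_congr rfl fun v _ => hD v, Finset.sum_boole,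
    ← Fintype.card_subtype, ← Nat.card_eq_fintype_card, card_invariant_functions]
  simp

end CliffCharValues

/-! ### Multiplicativity of the Clifford character on spin products -/

section CliffCharProduct

variable {α β ι : Type} {Γ : Type u} [Group Γ]

theorem PiGroup.map_viaEmbedding_self (f : α ↪ ι) (s : Equiv.Perm α) (p : PiGroup α) :
    PiGroup.map (s.viaEmbedding f).toEmbedding (PiGroup.map f p) =
      PiGroup.map f (PiGroup.map s.toEmbedding p) := by
  rw [PiGroup.map_map, PiGroup.map_map]
  congr 2
  ext j
  exact Equiv.Perm.viaEmbedding_apply s f j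

theorem PiGroup.map_viaEmbedding_of_disjoint (f : α ↪ ι) (f' : β ↪ ι)
    (h : ∀ j, f' j ∉ Set.range f) (s : Equiv.Perm α) (p : PiGroup β) :
    PiGroup.map (s.viaEmbedding f).toEmbedding (PiGroup.map f' p) = PiGroup.map f' p := by
  rw [PiGroup.map_map]
  congr 2
  ext j
  exact Equiv.Perm.viaEmbedding_apply_of_notMem s f _ (h j)

/-- The sign character with all ε_j = -1 is the parity: each generator in the image of p contributes
one z when it crosses a_i. -/
theorem PiGroup.map_mul_a_of_notMem (f : β ↪ ι) (i : ι) (hi : i ∉ Set.range f) (p : PiGroup β) :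
    (PiGroup.sgn (fun _ => -1) p = 1 ∧ PiGroup.map f p * PiGroup.a i = PiGroup.a i * PiGroup.map f p) ∨
      (PiGroup.sgn (fun _ => -1) p = -1 ∧
        PiGroup.map f p * PiGroup.a i = PiGroup.z * (PiGroup.a i * PiGroup.map f p)) := by
  induction p using PiGroup.induction_left with
  | one => simp
  | z_mul p h =>
    rcases h with ⟨h1, h2⟩ | ⟨h1, h2⟩
    · left
      refine ⟨by simp [h1], ?_⟩
      rw [map_mul, PiGroup.map_z, mul_assoc, h2, ← mul_assoc, PiGroup.z_mul_a, mul_assoc]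
    · right
      refine ⟨by simp [h1], ?_⟩
      rw [map_mul, PiGroup.map_z, mul_assoc, h2, ← mul_assoc (PiGroup.a i), ← PiGroup.z_mul_a,
        mul_assoc]
  | a_mul j p h =>
    have hij : f j ≠ i := fun h => hi ⟨j, h⟩
    rcases h with ⟨h1, h2⟩ | ⟨h1, h2⟩
    · right
      refine ⟨by simp [h1], ?_⟩
      rw [map_mul, PiGroup.map_a, mul_assoc, h2, ← mul_assoc, PiGroup.a_mul_a _ _ hij, mul_assoc,
        mul_assoc]
    · left
      refine ⟨by simp [h1], ?_⟩
      rw [map_mul, PiGroup.map_a, mul_assoc, h2, ← mul_assoc, ← PiGroup.z_mul_comm, mul_assoc,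
        ← mul_assoc (PiGroup.a (f j)), PiGroup.a_mul_a _ _ hij, mul_assoc, mul_assoc,
        PiGroup.z_mul_z_mul]

theorem PiGroup.map_mul_map_comm (f : α ↪ ι) (f' : β ↪ ι) (h : ∀ j, f j ∉ Set.range f')
    (p : PiGroup β) (hp : PiGroup.sgn (fun _ => -1) p = 1) (q : PiGroup α) :
    PiGroup.map f' p * PiGroup.map f q = PiGroup.map f q * PiGroup.map f' p := by
  induction q using PiGroup.induction_left with
  | one => simp
  | z_mul q hq =>
    rw [map_mul, PiGroup.map_z, ← mul_assoc, ← PiGroup.z_mul_comm, mul_assoc, hq, mul_assoc]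
  | a_mul j q hq =>
    rcases PiGroup.map_mul_a_of_notMem f' (f j) (h j) p with ⟨_, h2⟩ | ⟨h1, _⟩
    · rw [map_mul, PiGroup.map_a, ← mul_assoc, h2, mul_assoc, hq, mul_assoc]
    · rw [h1] at hp
      exact absurd hp (by decide)

theorem PiGroup.sgn_neg_one_map (f : α ↪ β) (p : PiGroup α) :
    PiGroup.sgn (fun _ => -1) (PiGroup.map f p) = PiGroup.sgn (fun _ => -1) p := by
  have : (PiGroup.sgn (fun _ : β => -1)).comp (PiGroup.map f) = PiGroup.sgn (fun _ : α => -1) :=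
    PiGroup.hom_ext (by simp) (by simp)
  exact DFunLike.congr_fun this p

/-- The multidegree splits over the two blocks, so both sides vanish unless each factor on the right
has argument 1 or z. In that case a2 is even and passes the first block without a sign, and the
remaining rearrangement only moves central elements. -/
theorem delta_diag_mul [Finite α] [Finite β] [Finite ι] (f : α ↪ ι) (f' : β ↪ ι)
    (h : ∀ j, f j ∉ Set.range f') (a1 p1 : PiGroup α) (s1 : Equiv.Perm α)
    (a2 p2 : PiGroup β) (s2 : Equiv.Perm β) :
    PiGroup.delta ((PiGroup.map f p1 * PiGroup.map f' p2)⁻¹ *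
      ((PiGroup.map f a1 * PiGroup.map f' a2) *
        (PiGroup.map f (PiGroup.map s1.toEmbedding p1) *
          PiGroup.map f' (PiGroup.map s2.toEmbedding p2)))) =
    PiGroup.delta (p1⁻¹ * (a1 * PiGroup.map s1.toEmbedding p1)) *
      PiGroup.delta (p2⁻¹ * (a2 * PiGroup.map s2.toEmbedding p2)) := by
  set q1 := PiGroup.map s1.toEmbedding p1 with hq1
  set q2 := PiGroup.map s2.toEmbedding p2 with hq2
  have heta : PiGroup.eta ((PiGroup.map f p1 * PiGroup.map f' p2)⁻¹ *
      ((PiGroup.map f a1 * PiGroup.map f' a2) * (PiGroup.map f q1 * PiGroup.map f' q2))) =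
      PiGroup.eta (PiGroup.map f (p1⁻¹ * (a1 * q1))) *
        PiGroup.eta (PiGroup.map f' (p2⁻¹ * (a2 * q2))) := by
    simp only [map_mul, map_inv, mul_inv]
    ac_rfl
  by_cases h1 : PiGroup.eta (p1⁻¹ * (a1 * q1)) = 1
  · by_cases h2 : PiGroup.eta (p2⁻¹ * (a2 * q2)) = 1
    -- The elements p2 and s2(p2) have the same parity, so p2⁻¹ a2 s2(p2) ∈ {1, z} forces a2 to be
    -- even.
    · have hs : PiGroup.sgn (fun _ => -1) a2 = 1 := by
        have h3 : PiGroup.sgn (fun _ => -1) (p2⁻¹ * (a2 * q2)) = 1 := by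
          rcases PiGroup.eta_eq_one.1 h2 with h | h <;> rw [h] <;> simp
        rw [map_mul, map_mul, hq2, PiGroup.sgn_neg_one_map, map_inv, mul_left_comm,
          inv_mul_cancel, mul_one] at h3
        exact h3
      have hc : PiGroup.map f (p1⁻¹ * (a1 * q1)) * PiGroup.map f' p2 =
          PiGroup.map f' p2 * PiGroup.map f (p1⁻¹ * (a1 * q1)) := by
        rcases PiGroup.eta_eq_one.1 h1 with h | h <;> rw [h]
        · simp
        · rw [PiGroup.map_z, PiGroup.z_mul_comm]
      have h3 : PiGroup.map f p1 * PiGroup.map f (p1⁻¹ * (a1 * q1)) =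
          PiGroup.map f a1 * PiGroup.map f q1 := by
        rw [← map_mul, ← map_mul, mul_inv_cancel_left]
      have h4 : PiGroup.map f' p2 * PiGroup.map f' (p2⁻¹ * (a2 * q2)) =
          PiGroup.map f' a2 * PiGroup.map f' q2 := by
        rw [← map_mul, ← map_mul, mul_inv_cancel_left]
      have h5 : (PiGroup.map f p1 * PiGroup.map f' p2)⁻¹ *
          ((PiGroup.map f a1 * PiGroup.map f' a2) * (PiGroup.map f q1 * PiGroup.map f' q2)) =
          PiGroup.map f (p1⁻¹ * (a1 * q1)) * PiGroup.map f' (p2⁻¹ * (a2 * q2)) := by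
        rw [inv_mul_eq_iff_eq_mul, mul_assoc, ← mul_assoc (PiGroup.map f' a2),
          PiGroup.map_mul_map_comm f f' h a2 hs, mul_assoc, ← h4, ← mul_assoc, ← h3, mul_assoc,
          ← mul_assoc (PiGroup.map f (p1⁻¹ * (a1 * q1))), hc]
        simp only [mul_assoc]
      rw [h5, PiGroup.delta_mul_of_eta_eq_one, PiGroup.delta_map, PiGroup.delta_map]
      rcases PiGroup.eta_eq_one.1 h1 with h | h <;> rw [h] <;> simp
    · rw [PiGroup.delta_of_eta_ne h2, mul_zero, PiGroup.delta_of_eta_ne]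
      rw [heta]
      contrapose! h2
      ext i
      have h3 := congrFun h2 (f' i)
      rw [Pi.mul_apply, PiGroup.eta_map_apply, PiGroup.eta_map_of_notMem, one_mul] at h3
      · rw [h3]; rfl
      · rintro ⟨j, hj⟩
        exact h j ⟨i, hj.symm⟩
  · rw [PiGroup.delta_of_eta_ne h1, zero_mul, PiGroup.delta_of_eta_ne]
    rw [heta]
    contrapose! h1
    ext i
    have h3 := congrFun h1 (f i)
    rw [Pi.mul_apply, PiGroup.eta_map_apply, PiGroup.eta_map_of_notMem _ _ _ (h i), mul_one] at h3
    rw [h3]; rfl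

/-- A multidegree on ι is a pair of multidegrees on the two blocks, and each diagonal coefficient is
the product of the two block coefficients. No super sign appears, since both sides vanish when a
factor is odd. -/
theorem cliffChar_map_mul_map [Fintype α] [Fintype β] [Fintype ι] (e : α ⊕ β ≃ ι)
    (x : BG Γ α) (y : BG Γ β) :
    cliffChar (BG.map (Function.Embedding.inl.trans e.toEmbedding) x *
      BG.map (Function.Embedding.inr.trans e.toEmbedding) y) = cliffChar x * cliffChar y := by
  classical
  set f : α ↪ ι := Function.Embedding.inl.trans e.toEmbedding with hf
  set f' : β ↪ ι := Function.Embedding.inr.trans e.toEmbedding with hf'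
  have hd : ∀ j, f j ∉ Set.range f' := by
    rintro j ⟨i, hi⟩
    have : (Sum.inr i : α ⊕ β) = Sum.inl j := e.injective hi
    cases this
  have hd' : ∀ j, f' j ∉ Set.range f := fun j ⟨i, hi⟩ => hd i ⟨j, hi.symm⟩
  rw [cliffChar_eq_sum, cliffChar_eq_sum, cliffChar_eq_sum, Finset.sum_mul_sum,
    ← Finset.sum_product']
  let E : (α → ℤˣ) × (β → ℤˣ) ≃ (ι → ℤˣ) :=
    (Equiv.sumArrowEquivProdArrow α β ℤˣ).symm.trans (Equiv.arrowCongr e (Equiv.refl _))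
  rw [Finset.univ_product_univ, ← Equiv.sum_comp E]
  refine Finset.sum_congr rfl fun v _ => ?_
  rw [← delta_diag_mul f f' hd]
  have h1 : PiGroup.eta (PiGroup.sec (E v)) =
      PiGroup.eta (PiGroup.map f (PiGroup.sec v.1) * PiGroup.map f' (PiGroup.sec v.2)) := by
    rw [PiGroup.eta_sec]
    ext i
    obtain ⟨i | i, rfl⟩ := e.surjective i
    · have h2 : E v (e (Sum.inl i)) = v.1 i := by simp [E, Equiv.arrowCongr]; rfl
      have h3 := PiGroup.eta_map_apply f (PiGroup.sec v.1) i
      have h4 := PiGroup.eta_map_of_notMem f' (PiGroup.sec v.2) (f i) (hd i)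
      rw [PiGroup.eta_sec] at h3
      change ((E v (e (Sum.inl i)) : ℤˣ) : ℤ) = ((PiGroup.eta _ (f i) : ℤˣ) : ℤ)
      rw [map_mul, Pi.mul_apply, h3, h4, mul_one, h2]
    · have h2 : E v (e (Sum.inr i)) = v.2 i := by simp [E, Equiv.arrowCongr]; rfl
      have h3 := PiGroup.eta_map_apply f' (PiGroup.sec v.2) i
      have h4 := PiGroup.eta_map_of_notMem f (PiGroup.sec v.1) (f' i) (hd' i)
      rw [PiGroup.eta_sec] at h3
      change ((E v (e (Sum.inr i)) : ℤˣ) : ℤ) = ((PiGroup.eta _ (f' i) : ℤˣ) : ℤ)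
      rw [map_mul, Pi.mul_apply, h3, h4, one_mul, h2]
  -- The chosen lift of the joint multidegree may differ by z from the product of the two block
  -- lifts; the diagonal coefficient does not see this.
  rw [delta_diag_congr _ h1]
  congr 1
  have h5 : (BG.map f x * BG.map f' y).left.2 =
      PiGroup.map f x.left.2 * PiGroup.map f' y.left.2 := by
    change PiGroup.map f x.left.2 * PiGroup.map (x.right.viaEmbedding f).toEmbedding
      (PiGroup.map f' y.left.2) = _
    rw [PiGroup.map_viaEmbedding_of_disjoint f f' hd']
  have h6 : PiGroup.map (BG.map f x * BG.map f' y).right.toEmbedding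
      (PiGroup.map f (PiGroup.sec v.1) * PiGroup.map f' (PiGroup.sec v.2)) =
      PiGroup.map f (PiGroup.map x.right.toEmbedding (PiGroup.sec v.1)) *
        PiGroup.map f' (PiGroup.map y.right.toEmbedding (PiGroup.sec v.2)) := by
    have h7 : (BG.map f x * BG.map f' y).right.toEmbedding =
        (y.right.viaEmbedding f').toEmbedding.trans (x.right.viaEmbedding f).toEmbedding := rfl
    rw [h7, ← PiGroup.map_map, map_mul, PiGroup.map_viaEmbedding_of_disjoint f' f hd,
      PiGroup.map_viaEmbedding_self, map_mul, PiGroup.map_viaEmbedding_self,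
      PiGroup.map_viaEmbedding_of_disjoint f f' hd']
  rw [h5, h6]

end CliffCharProduct

/-! ### Products over the cycles of a permutation -/

section Cycles

variable {ι : Type}

/-- The set of cycles of a permutation, fixed points included. -/
abbrev CycleSet (s : Equiv.Perm ι) : Type := Quotient (Equiv.Perm.SameCycle.setoid s)

/-- The point number `k` of the cycle `q`, counted backwards from a chosen point. -/
def cyclePoint (s : Equiv.Perm ι) (x : Σ q : CycleSet s, Fin (Function.minimalPeriod s q.out)) : ι :=
  (s ^ (x.2 : ℕ))⁻¹ x.1.out

theorem perm_pow_minimalPeriod (s : Equiv.Perm ι) (i : ι) :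
    (s ^ Function.minimalPeriod s i) i = i := by
  rw [← Equiv.Perm.iterate_eq_pow]
  exact Function.iterate_minimalPeriod

theorem perm_pow_minimalPeriod_inv (s : Equiv.Perm ι) (i : ι) :
    (s ^ Function.minimalPeriod s i)⁻¹ i = i := by
  rw [Equiv.Perm.inv_eq_iff_eq, perm_pow_minimalPeriod]

theorem cyclePoint_bijective [Finite ι] (s : Equiv.Perm ι) :
    Function.Bijective (cyclePoint s) := by
  constructor
  · rintro ⟨q, k⟩ ⟨q', k'⟩ h
    change (s ^ (k : ℕ))⁻¹ q.out = (s ^ (k' : ℕ))⁻¹ q'.out at h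
    have hq : q = q' := by
      rw [← q.out_eq, ← q'.out_eq]
      refine Quotient.sound (?_ : s.SameCycle _ _)
      refine ⟨(k' : ℤ) - k, ?_⟩
      rw [sub_eq_add_neg, zpow_add, zpow_neg, zpow_natCast, zpow_natCast, Equiv.Perm.mul_apply, h]
      simp
    subst hq
    congr 1
    apply Fin.ext
    apply Function.iterate_injOn_Iio_minimalPeriod (f := s) (x := q.out) k.2 k'.2
    change s^[k] q.out = s^[k'] q.out
    rw [Equiv.Perm.iterate_eq_pow, Equiv.Perm.iterate_eq_pow]
    rw [Equiv.Perm.inv_eq_iff_eq] at h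
    have h2 := congrArg (s ^ (k' : ℕ)) h
    rw [← Equiv.Perm.mul_apply, ← Equiv.Perm.mul_apply, ← pow_add, add_comm, pow_add,
      Equiv.Perm.mul_apply, Equiv.Perm.mul_apply] at h2
    simpa using h2.symm
  · intro i
    let q : CycleSet s := Quotient.mk _ i
    have h1 : s.SameCycle i q.out := (Quotient.mk_out (s := Equiv.Perm.SameCycle.setoid s) i).symm
    obtain ⟨n, hn⟩ := h1.exists_nat_pow_eq
    refine ⟨⟨q, ⟨n % Function.minimalPeriod s q.out,
      Nat.mod_lt _ (minimalPeriod_perm_pos s _)⟩⟩, ?_⟩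
    change (s ^ (n % Function.minimalPeriod s q.out))⁻¹ q.out = i
    rw [Equiv.Perm.inv_eq_iff_eq]
    have h2 : (s ^ n) q.out = (s ^ (n % Function.minimalPeriod s q.out)) q.out := by
      rw [← Equiv.Perm.iterate_eq_pow, ← Equiv.Perm.iterate_eq_pow,
        Function.iterate_mod_minimalPeriod_eq]
    apply (s ^ n).injective
    rw [h2, ← Equiv.Perm.mul_apply, ← pow_add, add_comm, pow_add, Equiv.Perm.mul_apply, hn]

/-- The parametrization of the points of `ι` by pairs of a cycle of `s` and a position in it. -/
def cycleEquiv [Finite ι] (s : Equiv.Perm ι) :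
    (Σ q : CycleSet s, Fin (Function.minimalPeriod s q.out)) ≃ ι :=
  Equiv.ofBijective _ (cyclePoint_bijective s)

end Cycles

/-! ### The trace on a tensor power -/

section TensorTrace

variable {κ : Type*} [Fintype κ] [DecidableEq κ]

/-- Matrix multiplication as a sum over paths. The weight φ of the two endpoints is kept arbitrary
so that the induction can absorb the last edge into it. -/
theorem sum_prod_path (N : ℕ → Matrix κ κ ℂ) (m : ℕ) (φ : κ → κ → ℂ) :
    ∑ F : Fin (m + 1) → κ, (∏ k : Fin m, N k (F k.castSucc) (F k.succ)) * φ (F 0) (F (Fin.last m)) =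
      ∑ a, ∑ c, ((List.range m).map N).prod a c * φ a c := by
  induction m generalizing φ with
  | zero =>
    simp only [List.range_zero, List.map_nil, List.prod_nil, Matrix.one_apply, ite_mul, one_mul,
      zero_mul, Finset.sum_ite_eq, Finset.mem_univ, if_true, Finset.univ_eq_empty,
      Finset.prod_empty]
    rw [← Equiv.sum_comp (Equiv.funUnique (Fin 1) κ).symm]
    rfl
  | succ m ih =>
    rw [← Equiv.sum_comp (Fin.snocEquiv fun _ => κ), Fintype.sum_prod_type_right]
    have h : ∀ (F : Fin (m + 1) → κ),
        ∑ b, (∏ k : Fin (m + 1), N k ((Fin.snocEquiv fun _ => κ) (b, F) k.castSucc)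
          ((Fin.snocEquiv fun _ => κ) (b, F) k.succ)) * φ ((Fin.snocEquiv fun _ => κ) (b, F) 0)
            ((Fin.snocEquiv fun _ => κ) (b, F) (Fin.last (m + 1))) =
        (∏ k : Fin m, N k (F k.castSucc) (F k.succ)) *
          ∑ b, N m (F (Fin.last m)) b * φ (F 0) b := by
      intro F
      rw [Finset.mul_sum]
      refine Finset.sum_congr rfl fun b _ => ?_
      rw [Fin.prod_univ_castSucc]
      have h0 : (Fin.snocEquiv fun _ : Fin (m + 2) => κ) (b, F) 0 = F 0 := by
        change Fin.snoc (α := fun _ => κ) F b (Fin.castSucc 0) = _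
        rw [Fin.snoc_castSucc]
      have h1 : ∀ k : Fin (m + 1), (Fin.snocEquiv fun _ : Fin (m + 2) => κ) (b, F) k.castSucc = F k :=
        fun k => Fin.snoc_castSucc (α := fun _ => κ) b F k
      have h2 : (Fin.snocEquiv fun _ : Fin (m + 2) => κ) (b, F) (Fin.last (m + 1)) = b :=
        Fin.snoc_last (α := fun _ => κ) b F
      simp only [h0, h1, Fin.succ_last, h2, Fin.val_castSucc, Fin.val_last, Fin.succ_castSucc]
      ring
    rw [Finset.sum_congr rfl fun F _ => h F, ih (fun a c => ∑ b, N m c b * φ a b)]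
    refine Finset.sum_congr rfl fun a _ => ?_
    rw [List.range_succ, List.map_append, List.prod_append, List.map_singleton,
      List.prod_singleton]
    simp only [Matrix.mul_apply, Finset.sum_mul, Finset.mul_sum]
    rw [Finset.sum_comm]
    exact Finset.sum_congr rfl fun b _ => Finset.sum_congr rfl fun c _ => by ring

/-- The first m - 1 edges form a path, and the last edge, back to 0, serves as its endpoint weight.
The successor map is a parameter so that m need not have the form of a successor. -/
theorem sum_prod_closed_path (N : ℕ → Matrix κ κ ℂ) (m : ℕ) (σ : Fin m → Fin m)
    (hσ : ∀ k : Fin m, (σ k : ℕ) = if (k : ℕ) + 1 = m then 0 else (k : ℕ) + 1) (hm : 0 < m) :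
    ∑ F : Fin m → κ, ∏ k : Fin m, N k (F k) (F (σ k)) =
      Matrix.trace ((List.range m).map N).prod := by
  obtain ⟨m, rfl⟩ := Nat.exists_eq_succ_of_ne_zero hm.ne'
  have h : ∀ F : Fin (m + 1) → κ, ∏ k : Fin (m + 1), N k (F k) (F (σ k)) =
      (∏ k : Fin m, N k (F k.castSucc) (F k.succ)) * N m (F (Fin.last m)) (F 0) := by
    intro F
    rw [Fin.prod_univ_castSucc]
    congr 1
    · refine Finset.prod_congr rfl fun k _ => ?_
      have : σ k.castSucc = k.succ := by
        apply Fin.ext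
        rw [hσ, if_neg (by have := k.2; simp; omega)]
        simp
      rw [this]; rfl
    · have : σ (Fin.last m) = 0 := by
        apply Fin.ext
        rw [hσ, if_pos (by simp)]
        simp
      rw [this]; rfl
  rw [Finset.sum_congr rfl fun F _ => h F, sum_prod_path N m (fun a c => N m c a),
    Nat.succ_eq_add_one, List.range_succ, List.map_append, List.prod_append, List.map_singleton,
    List.prod_singleton]
  simp [Matrix.trace, Matrix.mul_apply]

variable {ι : Type} [Fintype ι]

open scoped Classical in
-- A function on ι is an independent choice of a closed path on each cycle, so the sum factors.
-- Positions in a cycle are counted backwards, hence s⁻¹ moves one position forward and the matrices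
-- multiply in the order of `cycleProd`.
theorem sum_prod_perm (M : ι → Matrix κ κ ℂ) (s : Equiv.Perm ι) :
    ∑ f : ι → κ, ∏ i, M i (f i) (f (s⁻¹ i)) =
      ∏ q : CycleSet s, Matrix.trace ((List.range (Function.minimalPeriod s q.out)).map
        fun k => M ((s ^ k)⁻¹ q.out)).prod := by
  let σ : ∀ q : CycleSet s, Fin (Function.minimalPeriod s q.out) → Fin (Function.minimalPeriod s q.out) :=
    fun q k => if h : (k : ℕ) + 1 = Function.minimalPeriod s q.out then
      ⟨0, minimalPeriod_perm_pos s _⟩ else ⟨(k : ℕ) + 1, by have := k.2; omega⟩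
  have hσ : ∀ q k, (σ q k : ℕ) =
      if (k : ℕ) + 1 = Function.minimalPeriod s q.out then 0 else (k : ℕ) + 1 := by
    intro q k
    simp only [σ]
    split_ifs <;> rfl
  have hs : ∀ q k, s⁻¹ (cycleEquiv s ⟨q, k⟩) = cycleEquiv s ⟨q, σ q k⟩ := by
    intro q k
    change s⁻¹ ((s ^ (k : ℕ))⁻¹ q.out) = (s ^ (σ q k : ℕ))⁻¹ q.out
    rw [← Equiv.Perm.mul_apply, ← mul_inv_rev, ← pow_succ, hσ]
    split_ifs with h
    · rw [h, perm_pow_minimalPeriod_inv, pow_zero]; simp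
    · rfl
  rw [← Equiv.sum_comp ((Equiv.piCurry fun _ _ => κ).symm.trans
    (Equiv.arrowCongr (cycleEquiv s) (Equiv.refl κ)))]
  have hq : ∀ q : CycleSet s, Matrix.trace ((List.range (Function.minimalPeriod s q.out)).map
        fun k => M ((s ^ k)⁻¹ q.out)).prod =
      ∑ F : Fin (Function.minimalPeriod s q.out) → κ, ∏ k, M (cycleEquiv s ⟨q, k⟩) (F k) (F (σ q k)) :=
    fun q => (sum_prod_closed_path (fun k => M ((s ^ k)⁻¹ q.out)) _ (σ q) (hσ q)
      (minimalPeriod_perm_pos s _)).symm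
  rw [Finset.prod_congr rfl fun q _ => hq q, Fintype.prod_sum]
  refine Finset.sum_congr rfl fun F _ => ?_
  rw [← Equiv.prod_comp (cycleEquiv s), Fintype.prod_sigma]
  refine Finset.prod_congr rfl fun q _ => Finset.prod_congr rfl fun k _ => ?_
  have hF : ∀ k, ((Equiv.piCurry fun _ _ => κ).symm.trans
      (Equiv.arrowCongr (cycleEquiv s) (Equiv.refl κ))) F (cycleEquiv s ⟨q, k⟩) = F q k := by
    intro k
    change Sigma.uncurry F ((cycleEquiv s).symm (cycleEquiv s ⟨q, k⟩)) = F q k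
    rw [Equiv.symm_apply_apply]
    rfl
  rw [hs, hF, hF]

variable {Γ : Type u} [Group Γ]

open scoped Classical in
-- In the product basis the diagonal entry at f is ∏ A(g_i)_{f(i), f(s⁻¹ i)}; the sum over f is a
-- product of traces over cycles, and multiplicativity of ρ turns each matrix product into ρ of a
-- cycle product.
theorem trace_tensorRep {V : Type*} [AddCommGroup V] [Module ℂ V] [FiniteDimensional ℂ V]
    (ρ : Representation ℂ Γ V) (x : BG Γ ι) :
    LinearMap.trace ℂ _ (tensorRep ρ x) = ∏ q : CycleSet x.right,
      LinearMap.trace ℂ V (ρ (cycleProd x.left.1 x.right q.out)) := by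
  let b := Module.finBasis ℂ V
  let B := Basis.piTensorProduct (R := ℂ) (fun _ : ι => b)
  let A := LinearMap.toMatrixAlgEquiv b
  have h1 : LinearMap.trace ℂ _ (tensorRep ρ x) =
      ∑ f : ι → Fin (Module.finrank ℂ V), ∏ i, A (ρ (x.left.1 i)) (f i) (f (x.right⁻¹ i)) := by
    rw [LinearMap.trace_eq_matrix_trace ℂ B, Matrix.trace]
    refine Finset.sum_congr rfl fun f _ => ?_
    rw [Matrix.diag_apply, LinearMap.toMatrix_apply]
    have h2 : tensorRep ρ x (B f) =
        PiTensorProduct.tprod ℂ (fun i => ρ (x.left.1 i) (b (f (x.right⁻¹ i)))) := by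
      rw [Basis.piTensorProduct_apply]
      change PiTensorProduct.map (fun i => ρ (x.left.1 i))
        (PiTensorProduct.reindex ℂ (fun _ : ι => V) x.right
          (PiTensorProduct.tprod ℂ fun i => b (f i))) = _
      rw [PiTensorProduct.reindex_tprod, PiTensorProduct.map_tprod]
      rfl
    rw [h2, Basis.piTensorProduct_repr_tprod_apply]
    refine Finset.prod_congr rfl fun i _ => ?_
    rw [LinearMap.toMatrixAlgEquiv_apply]
  rw [h1, sum_prod_perm (fun i => A (ρ (x.left.1 i)))]
  refine Finset.prod_congr rfl fun q _ => ?_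
  have h3 : ((List.range (Function.minimalPeriod x.right q.out)).map
      fun k => A (ρ (x.left.1 ((x.right ^ k)⁻¹ q.out)))).prod =
      A (ρ (cycleProd x.left.1 x.right q.out)) := by
    rw [cycleProd, map_list_prod, map_list_prod, List.map_map, List.map_map]
    rfl
  rw [h3, LinearMap.trace_eq_matrix_trace ℂ b]
  rfl

end TensorTrace

/-! ### Cycle products -/

section Semiconj

variable {α ι : Type*}

/-- This and the next lemmas transport orbit data along an intertwining map f. They are applied to s
itself, to conjugating permutations, to block inclusions and to the model permutation `rotation`. -/
theorem perm_pow_inv_semiconj {s : Equiv.Perm α} {s' : Equiv.Perm ι} {f : α → ι}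
    (h : ∀ i, s' (f i) = f (s i)) (k : ℕ) (i : α) : (s' ^ k)⁻¹ (f i) = f ((s ^ k)⁻¹ i) := by
  have h1 : ∀ j, (s' ^ k) (f j) = f ((s ^ k) j) := by
    intro j
    rw [← Equiv.Perm.iterate_eq_pow, ← Equiv.Perm.iterate_eq_pow]
    exact ((Function.Semiconj.iterate_right (f := f) (ga := s) (gb := s') (fun j => (h j).symm) k) j).symm
  rw [Equiv.Perm.inv_eq_iff_eq, h1, ← Equiv.Perm.mul_apply, mul_inv_cancel, Equiv.Perm.one_apply]

theorem minimalPeriod_semiconj {s : Equiv.Perm α} {s' : Equiv.Perm ι} {f : α → ι}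
    (hf : Function.Injective f) (h : ∀ i, s' (f i) = f (s i)) (i : α) :
    Function.minimalPeriod s' (f i) = Function.minimalPeriod s i := by
  rw [Function.minimalPeriod_eq_minimalPeriod_iff]
  intro n
  have := (Function.Semiconj.iterate_right (f := f) (ga := s) (gb := s') (fun j => (h j).symm) n) i
  rw [Function.IsPeriodicPt, Function.IsFixedPt, Function.IsPeriodicPt, Function.IsFixedPt, ← this,
    hf.eq_iff]

theorem sameCycle_semiconj {s : Equiv.Perm α} {s' : Equiv.Perm ι} {f : α → ι}
    (hf : Function.Injective f) (h : ∀ i, s' (f i) = f (s i)) (i j : α) :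
    s'.SameCycle (f i) (f j) ↔ s.SameCycle i j := by
  have h1 : ∀ k : ℤ, (s' ^ k) (f i) = f ((s ^ k) i) := by
    intro k
    cases k with
    | ofNat k =>
      have := perm_pow_inv_semiconj h k ((s ^ k) i)
      rw [Equiv.Perm.inv_eq_iff_eq] at this
      simp only [Int.ofNat_eq_natCast, zpow_natCast]
      rw [← this.symm]
      simp
    | negSucc k =>
      simp only [zpow_negSucc]
      exact perm_pow_inv_semiconj h _ i
  constructor
  · rintro ⟨k, hk⟩
    exact ⟨k, hf (by rw [← h1, hk])⟩
  · rintro ⟨k, hk⟩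
    exact ⟨k, by rw [h1, hk]⟩

theorem apply_eq_of_sameCycle {M : Type*} {s : Equiv.Perm ι} {h : ι → M} (hs : ∀ i, h (s i) = h i)
    {i j : ι} (hij : s.SameCycle i j) : h i = h j := by
  obtain ⟨k, rfl⟩ := hij
  have h2 : ∀ i, h (s⁻¹ i) = h i := fun i => by rw [← hs]; simp
  induction k using Int.induction_on with
  | zero => simp
  | succ k ih => rw [add_comm, zpow_add, zpow_one, Equiv.Perm.mul_apply, hs, ← ih]
  | pred k ih => rw [sub_eq_neg_add, zpow_add, zpow_neg_one, Equiv.Perm.mul_apply, h2, ← ih]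

end Semiconj

/-! ### Products over cycles: relabelling, disjoint unions, expansion of sums -/

section CyclesProd

variable {α β ι : Type}

/-- `Quotient.out` selects an unspecified point of the cycle; for an s-invariant function the
selection is immaterial. -/
theorem apply_out_eq {M : Type*} {s : Equiv.Perm ι} {h : ι → M} (hs : ∀ i, h (s i) = h i) (i : ι) :
    h (Quotient.out (Quotient.mk _ i : CycleSet s)) = h i :=
  apply_eq_of_sameCycle hs (Quotient.mk_out (s := Equiv.Perm.SameCycle.setoid s) i)

open scoped Classical in
/-- The product of a function over the cycles of a permutation. -/
def cyclesProd [Fintype ι] (s : Equiv.Perm ι) (h : ι → ℂ) : ℂ := ∏ q : CycleSet s, h q.out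

theorem cyclesProd_equiv [Fintype α] [Fintype ι] {s : Equiv.Perm α} {s' : Equiv.Perm ι} (r : α ≃ ι)
    (h : ∀ i, s' (r i) = r (s i)) {f : α → ℂ} {f' : ι → ℂ} (hf : ∀ i, f (s i) = f i)
    (hr : ∀ i, f' (r i) = f i) : cyclesProd s' f' = cyclesProd s f := by
  classical
  have hf' : ∀ i, f' (s' i) = f' i := fun i => by
    obtain ⟨j, rfl⟩ := r.surjective i
    rw [h, hr, hr, hf]
  let E : CycleSet s ≃ CycleSet s' :=
    Quotient.congr r fun i j => (sameCycle_semiconj r.injective h i j).symm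
  unfold cyclesProd
  rw [← Equiv.prod_comp E]
  refine Finset.prod_congr rfl fun q _ => ?_
  induction q using Quotient.inductionOn with
  | _ i =>
    change f' (Quotient.out (Quotient.mk _ (r i) : CycleSet s')) = _
    rw [apply_out_eq hf', hr, apply_out_eq hf]

theorem cyclesProd_sum [Fintype α] [Fintype β] [Fintype ι] (e : α ⊕ β ≃ ι) {s1 : Equiv.Perm α}
    {s2 : Equiv.Perm β} {s : Equiv.Perm ι} (h1 : ∀ i, s (e (Sum.inl i)) = e (Sum.inl (s1 i)))
    (h2 : ∀ i, s (e (Sum.inr i)) = e (Sum.inr (s2 i))) {f : ι → ℂ} (hf : ∀ i, f (s i) = f i) :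
    cyclesProd s f = cyclesProd s1 (fun i => f (e (Sum.inl i))) *
      cyclesProd s2 (fun i => f (e (Sum.inr i))) := by
  classical
  let A : CycleSet s1 ⊕ CycleSet s2 → CycleSet s := Sum.elim
    (Quotient.map' (fun i => e (Sum.inl i)) fun i j hij =>
      (sameCycle_semiconj (e.injective.comp Sum.inl_injective) h1 i j).2 hij)
    (Quotient.map' (fun i => e (Sum.inr i)) fun i j hij =>
      (sameCycle_semiconj (e.injective.comp Sum.inr_injective) h2 i j).2 hij)
  have hside : ∀ i, (e.symm (s i)).isLeft = (e.symm i).isLeft := by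
    intro i
    obtain ⟨i | i, rfl⟩ := e.surjective i
    · rw [h1]; simp
    · rw [h2]; simp
  have hA : Function.Bijective A := by
    constructor
    · rintro (q | q) (q' | q') h
      · induction q, q' using Quotient.inductionOn₂ with
        | _ i j =>
          have h3 : s.SameCycle (e (Sum.inl i)) (e (Sum.inl j)) := Quotient.exact h
          congr 1
          exact Quotient.sound
            ((sameCycle_semiconj (e.injective.comp Sum.inl_injective) h1 i j).1 h3)
      · induction q, q' using Quotient.inductionOn₂ with
        | _ i j =>
          have h3 : s.SameCycle (e (Sum.inl i)) (e (Sum.inr j)) := Quotient.exact h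
          have := apply_eq_of_sameCycle (h := fun i => (e.symm i).isLeft) hside h3
          simp at this
      · induction q, q' using Quotient.inductionOn₂ with
        | _ i j =>
          have h3 : s.SameCycle (e (Sum.inr i)) (e (Sum.inl j)) := Quotient.exact h
          have := apply_eq_of_sameCycle (h := fun i => (e.symm i).isLeft) hside h3
          simp at this
      · induction q, q' using Quotient.inductionOn₂ with
        | _ i j =>
          have h3 : s.SameCycle (e (Sum.inr i)) (e (Sum.inr j)) := Quotient.exact h
          congr 1
          exact Quotient.sound
            ((sameCycle_semiconj (e.injective.comp Sum.inr_injective) h2 i j).1 h3)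
    · intro q
      induction q using Quotient.inductionOn with
      | _ i =>
        obtain ⟨i | i, rfl⟩ := e.surjective i
        · exact ⟨Sum.inl (Quotient.mk _ i), rfl⟩
        · exact ⟨Sum.inr (Quotient.mk _ i), rfl⟩
  unfold cyclesProd
  rw [← (Equiv.ofBijective A hA).prod_comp, Fintype.prod_sum_type]
  congr 1
  · refine Finset.prod_congr rfl fun q _ => ?_
    induction q using Quotient.inductionOn with
    | _ i =>
      change f (Quotient.out (Quotient.mk _ (e (Sum.inl i)) : CycleSet s)) = _
      rw [apply_out_eq hf]
      exact (apply_out_eq (s := s1) (h := fun i => f (e (Sum.inl i)))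
        (fun i => by rw [← h1, hf]) i).symm
  · refine Finset.prod_congr rfl fun q _ => ?_
    induction q using Quotient.inductionOn with
    | _ i =>
      change f (Quotient.out (Quotient.mk _ (e (Sum.inr i)) : CycleSet s)) = _
      rw [apply_out_eq hf]
      exact (apply_out_eq (s := s2) (h := fun i => f (e (Sum.inr i)))
        (fun i => by rw [← h2, hf]) i).symm

open scoped Classical in
-- Expanding the product chooses f or g on each cycle, and sets of cycles are the same as s-stable
-- subsets of ι. Invariance of f and g is not involved, as both sides evaluate at the same
-- representatives.
theorem cyclesProd_add [Fintype ι] (s : Equiv.Perm ι) (f g : ι → ℂ) :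
    cyclesProd s (fun i => f i + g i) =
      ∑ A : Finset ι with ∀ i, s i ∈ A ↔ i ∈ A,
        cyclesProd s (fun i => if i ∈ A then f i else g i) := by
  unfold cyclesProd
  rw [Fintype.prod_add]
  refine Finset.sum_bij' (fun t _ => Finset.univ.filter fun i => (Quotient.mk _ i : CycleSet s) ∈ t)
    (fun A _ => Finset.univ.filter fun q : CycleSet s => q.out ∈ A) ?_ ?_ ?_ ?_ ?_
  · intro t _
    simp only [Finset.mem_filter, Finset.mem_univ, true_and]
    intro i
    have : (Quotient.mk _ (s i) : CycleSet s) = Quotient.mk _ i :=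
      Quotient.sound (⟨-1, by simp⟩ : s.SameCycle (s i) i)
    rw [this]
  · intro A _; simp
  · intro t _
    ext q
    simp
  · intro A hA
    simp only [Finset.mem_filter, Finset.mem_univ, true_and] at hA
    ext i
    simp only [Finset.mem_filter, Finset.mem_univ, true_and]
    rw [apply_out_eq (h := fun i => i ∈ A) (fun i => propext (hA i))]
  · intro t _
    rw [← Finset.prod_mul_prod_compl t]
    congr 1
    · refine Finset.prod_congr rfl fun q hq => ?_
      simp [hq]
    · refine Finset.prod_congr rfl fun q hq => ?_
      rw [Finset.mem_compl] at hq
      simp [hq]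

end CyclesProd

/-! ### Cycle products under conjugation -/

section CycleProd

variable {α β ι : Type} {Γ : Type u} [Group Γ]

theorem BG.mul_left_apply (x y : BG Γ ι) (i : ι) :
    (x * y).left.1 i = x.left.1 i * y.left.1 (x.right⁻¹ i) := rfl

theorem BG.inv_left_apply (x : BG Γ ι) (i : ι) : x⁻¹.left.1 i = (x.left.1 (x.right i))⁻¹ := rfl

theorem BG.pow_right (x : BG Γ ι) (m : ℕ) : (x ^ m).right = x.right ^ m :=
  map_pow SemidirectProduct.rightHom x m

theorem BG.pow_left_apply (x : BG Γ ι) (m : ℕ) (i : ι) :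
    (x ^ m).left.1 i = ((List.range m).map fun k => x.left.1 ((x.right ^ k)⁻¹ i)).prod := by
  induction m with
  | zero => rfl
  | succ m ih =>
    rw [pow_succ, BG.mul_left_apply, ih, List.range_succ, List.map_append, List.prod_append,
      BG.pow_right]
    simp

/-- The cycle product through i is the i-th coordinate of the power of x by the length of the cycle,
so its behaviour under conjugation reduces to that of powers. -/
theorem cycleProd_eq_pow_left (x : BG Γ ι) (i : ι) :
    cycleProd x.left.1 x.right i = (x ^ Function.minimalPeriod x.right i).left.1 i :=
  (BG.pow_left_apply x _ i).symm

/-- Read (y x y⁻¹)^m = y x^m y⁻¹ at the coordinate y(i), with m the cycle length; since x^m fixes i,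
the outer factors are mutually inverse. -/
theorem cycleProd_conj (x y : BG Γ ι) (i : ι) :
    cycleProd (y * x * y⁻¹).left.1 (y * x * y⁻¹).right (y.right i) =
      y.left.1 (y.right i) * cycleProd x.left.1 x.right i * (y.left.1 (y.right i))⁻¹ := by
  have h1 : ∀ j, (y * x * y⁻¹).right (y.right j) = y.right (x.right j) := by
    intro j
    change y.right (x.right (y.right⁻¹ (y.right j))) = _
    simp
  rw [cycleProd_eq_pow_left, cycleProd_eq_pow_left, minimalPeriod_semiconj y.right.injective h1,
    conj_pow, BG.mul_left_apply, BG.mul_left_apply, BG.inv_left_apply]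
  have h2 : (y * x ^ Function.minimalPeriod x.right i).right = y.right * (x.right ^
      Function.minimalPeriod x.right i) := by
    rw [SemidirectProduct.mul_right, BG.pow_right]
  have h3 : (y.right * x.right ^ Function.minimalPeriod x.right i)⁻¹ (y.right i) = i := by
    rw [Equiv.Perm.inv_eq_iff_eq, Equiv.Perm.mul_apply, perm_pow_minimalPeriod]
  rw [h2, h3]
  simp

theorem cycleProd_semiconj {g : α → Γ} {s : Equiv.Perm α} {g' : ι → Γ} {s' : Equiv.Perm ι}
    {f : α → ι} (hf : Function.Injective f) (h1 : ∀ i, g' (f i) = g i)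
    (h2 : ∀ i, s' (f i) = f (s i)) (i : α) : cycleProd g' s' (f i) = cycleProd g s i := by
  rw [cycleProd, cycleProd, minimalPeriod_semiconj hf h2]
  congr 1
  refine List.map_congr_left fun k _ => ?_
  rw [perm_pow_inv_semiconj h2, h1]

/-- The value of a class function at the cycle product of `x` at `i`. -/
def cycleVal (γ : ClassFn Γ) (x : BG Γ ι) (i : ι) : ℂ := γ.1 (cycleProd x.left.1 x.right i)

theorem cycleVal_conj (γ : ClassFn Γ) (x y : BG Γ ι) (i : ι) :
    cycleVal γ (y * x * y⁻¹) (y.right i) = cycleVal γ x i := by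
  rw [cycleVal, cycleProd_conj, γ.2]
  rfl

theorem cycleVal_apply (γ : ClassFn Γ) (x : BG Γ ι) (i : ι) :
    cycleVal γ x (x.right i) = cycleVal γ x i := by
  -- Conjugating x by itself moves the base point one step along its cycle.
  have := cycleVal_conj γ x x i
  rwa [mul_inv_cancel_right] at this

theorem cyclesProd_cycleVal_conj [Fintype ι] (γ : ClassFn Γ) (x y : BG Γ ι) :
    cyclesProd (y * x * y⁻¹).right (cycleVal γ (y * x * y⁻¹)) =
      cyclesProd x.right (cycleVal γ x) := by
  refine cyclesProd_equiv y.right (fun i => ?_) (cycleVal_apply γ x) (cycleVal_conj γ x y)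
  change y.right (x.right (y.right⁻¹ (y.right i))) = _
  simp

end CycleProd

/-! ### The extension of the basic spin characters -/

section SpinExt

variable {ι : Type} {Γ : Type u} [Group Γ]

theorem PiGroup.parity_map {α β : Type} (f : α ↪ β) (p : PiGroup α) :
    PiGroup.parity (PiGroup.map f p) = PiGroup.parity p := by
  have : (PiGroup.parity (ι := β)).comp (PiGroup.map f) = PiGroup.parity :=
    PiGroup.hom_ext (by simp [PiGroup.parity]) (by simp [PiGroup.parity])
  exact DFunLike.congr_fun this p

variable [Fintype ι]

theorem cliffChar_of_parity_ne_one (x : BG Γ ι) (h : BG.parity x ≠ 1) : cliffChar x = 0 := by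
  classical
  rw [cliffChar_eq_sum]
  refine Finset.sum_eq_zero fun v _ => PiGroup.delta_of_eta_ne fun h1 => h ?_
  have h2 : PiGroup.parity ((PiGroup.sec v)⁻¹ * (x.left.2 *
      PiGroup.map x.right.toEmbedding (PiGroup.sec v))) = 1 := by
    rcases PiGroup.eta_eq_one.1 h1 with h | h <;> rw [h] <;> simp [PiGroup.parity]
  rw [map_mul, map_mul, PiGroup.parity_map, map_inv, mul_left_comm, inv_mul_cancel, mul_one] at h2
  exact h2

variable (ι) in
/-- The spin super class function `χ(γ)` of a class function `γ` of `Γ`. -/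
def spinExt (γ : ClassFn Γ) : SpinClassFn Γ ι :=
  ⟨fun x => cliffChar x * cyclesProd x.right (cycleVal γ x), by
    refine ⟨fun x y => ?_, fun x => ?_, fun x hx => ?_⟩
    · have := cliffChar_conj x y⁻¹
      rw [inv_inv] at this
      beta_reduce
      rw [this, cyclesProd_cycleVal_conj]
    · have h1 : (BG.z * x).right = x.right := one_mul _
      have h2 : cycleVal γ (BG.z * x) = cycleVal γ x := by
        funext i
        have h3 : (BG.z * x).left.1 = x.left.1 := by
          funext i
          change 1 * x.left.1 i = _
          rw [one_mul]
        rw [cycleVal, h1, h3]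
        rfl
      beta_reduce
      rw [cliffChar_z_mul, h1, h2, neg_mul]
    · beta_reduce
      rw [cliffChar_of_parity_ne_one x hx, zero_mul]⟩

theorem spinExt_apply (γ : ClassFn Γ) (x : BG Γ ι) :
    (spinExt ι γ).1 x = cliffChar x * cyclesProd x.right (cycleVal γ x) := rfl

theorem basicChar_eq_spinExt (V : FDRep ℂ Γ) : basicChar ι V = spinExt ι (charFn V) := by
  ext x
  have : Module.Finite ℂ (⨂[ℂ] _ : ι, V) :=
    Module.Finite.of_basis (Basis.piTensorProduct (R := ℂ) fun _ : ι => Module.finBasis ℂ V)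
  change LinearMap.trace ℂ _ (TensorProduct.map (tensorRep V.ρ x) (cliffRep Γ ι x)) = _
  rw [LinearMap.trace_tensorProduct', trace_tensorRep, mul_comm]
  rfl

end SpinExt

/-! ### Induction from spin products -/

section Induction

variable {α β ι : Type} {Γ : Type u} [Group Γ]

theorem Finset.map_perm_eq_iff (s : Equiv.Perm ι) (A : Finset ι) :
    A.map s.toEmbedding = A ↔ ∀ i, s i ∈ A ↔ i ∈ A := by
  constructor
  · intro h i
    nth_rewrite 1 [← h]
    exact Finset.mem_map' s.toEmbedding
  · intro h
    ext i
    obtain ⟨j, rfl⟩ := s.surjective i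
    rw [h]
    exact Finset.mem_map' s.toEmbedding

/-- The image of the first summand. -/
def firstBlock [Fintype α] (e : α ⊕ β ≃ ι) : Finset ι :=
  Finset.univ.map (Function.Embedding.inl.trans e.toEmbedding)

@[simp] theorem inl_mem_firstBlock [Fintype α] (e : α ⊕ β ≃ ι) (i : α) :
    e (Sum.inl i) ∈ firstBlock e := by simp [firstBlock]

@[simp] theorem inr_notMem_firstBlock [Fintype α] (e : α ⊕ β ≃ ι) (i : β) :
    e (Sum.inr i) ∉ firstBlock e := by simp [firstBlock]

variable (e : α ⊕ β ≃ ι) (t : BG Γ α) (t' : BG Γ β)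

/-- The product of elements of the two factors of a spin product. -/
def spinMul : BG Γ ι :=
  BG.map (Function.Embedding.inl.trans e.toEmbedding) t *
    BG.map (Function.Embedding.inr.trans e.toEmbedding) t'

theorem inl_notMem_range (i : α) :
    e (Sum.inl i) ∉ Set.range (Function.Embedding.inr.trans e.toEmbedding : β ↪ ι) := by
  rintro ⟨j, hj⟩
  have : (Sum.inr j : α ⊕ β) = Sum.inl i := e.injective hj
  cases this

theorem inr_notMem_range (i : β) :
    e (Sum.inr i) ∉ Set.range (Function.Embedding.inl.trans e.toEmbedding : α ↪ ι) := by
  rintro ⟨j, hj⟩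
  have : (Sum.inl j : α ⊕ β) = Sum.inr i := e.injective hj
  cases this

theorem spinMul_right_inl (i : α) :
    (spinMul e t t').right (e (Sum.inl i)) = e (Sum.inl (t.right i)) := by
  change (t.right.viaEmbedding (Function.Embedding.inl.trans e.toEmbedding))
    ((t'.right.viaEmbedding (Function.Embedding.inr.trans e.toEmbedding)) (e (Sum.inl i))) = _
  rw [Equiv.Perm.viaEmbedding_apply_of_notMem _ _ _ (inl_notMem_range e i)]
  exact Equiv.Perm.viaEmbedding_apply t.right (Function.Embedding.inl.trans e.toEmbedding) i

theorem spinMul_right_inr (i : β) :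
    (spinMul e t t').right (e (Sum.inr i)) = e (Sum.inr (t'.right i)) := by
  change (t.right.viaEmbedding (Function.Embedding.inl.trans e.toEmbedding))
    ((t'.right.viaEmbedding (Function.Embedding.inr.trans e.toEmbedding))
      ((Function.Embedding.inr.trans e.toEmbedding) i)) = _
  rw [Equiv.Perm.viaEmbedding_apply]
  exact Equiv.Perm.viaEmbedding_apply_of_notMem _ _ _ (inr_notMem_range e _)

theorem spinMul_left_fst (i : ι) : (spinMul e t t').left.1 i =
    Function.extend (Function.Embedding.inl.trans e.toEmbedding) t.left.1 1 i *
      Function.extend (Function.Embedding.inr.trans e.toEmbedding) t'.left.1 1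
        ((t.right.viaEmbedding (Function.Embedding.inl.trans e.toEmbedding))⁻¹ i) := by
  rw [spinMul, BG.mul_left_apply]
  rfl

theorem spinMul_left_inl (i : α) : (spinMul e t t').left.1 (e (Sum.inl i)) = t.left.1 i := by
  rw [spinMul_left_fst]
  have h1 : (t.right.viaEmbedding (Function.Embedding.inl.trans e.toEmbedding))⁻¹ (e (Sum.inl i)) =
      e (Sum.inl (t.right⁻¹ i)) := by
    rw [Equiv.Perm.inv_eq_iff_eq]
    have := Equiv.Perm.viaEmbedding_apply t.right
      (Function.Embedding.inl.trans e.toEmbedding) (t.right⁻¹ i)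
    simpa using this.symm
  rw [h1, Function.extend_apply' _ _ _ (inl_notMem_range e _)]
  have := (Function.Embedding.inl.trans e.toEmbedding : α ↪ ι).injective.extend_apply t.left.1 1 i
  rw [Pi.one_apply, mul_one]
  exact this

theorem spinMul_left_inr (i : β) : (spinMul e t t').left.1 (e (Sum.inr i)) = t'.left.1 i := by
  rw [spinMul_left_fst]
  have h1 : (t.right.viaEmbedding (Function.Embedding.inl.trans e.toEmbedding))⁻¹ (e (Sum.inr i)) =
      e (Sum.inr i) := by
    rw [Equiv.Perm.inv_eq_iff_eq,
      Equiv.Perm.viaEmbedding_apply_of_notMem _ _ _ (inr_notMem_range e _)]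
  rw [h1, Function.extend_apply' _ _ _ (inr_notMem_range e _)]
  have := (Function.Embedding.inr.trans e.toEmbedding : β ↪ ι).injective.extend_apply t'.left.1 1 i
  rw [Pi.one_apply, one_mul]
  exact this

theorem spinMul_left_snd : (spinMul e t t').left.2 =
    PiGroup.map (Function.Embedding.inl.trans e.toEmbedding) t.left.2 *
      PiGroup.map (Function.Embedding.inr.trans e.toEmbedding) t'.left.2 := by
  change PiGroup.map _ t.left.2 * PiGroup.map (t.right.viaEmbedding _).toEmbedding
    (PiGroup.map _ t'.left.2) = _
  rw [PiGroup.map_viaEmbedding_of_disjoint _ _ (inr_notMem_range e)]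

/-- Choose the two factors by multidegree; the product then agrees with p up to z, which is absorbed
into the first factor. -/
theorem PiGroup.exists_map_mul_map [Finite α] [Finite β] (p : PiGroup ι) :
    ∃ (p1 : PiGroup α) (p2 : PiGroup β),
      PiGroup.map (Function.Embedding.inl.trans e.toEmbedding) p1 *
        PiGroup.map (Function.Embedding.inr.trans e.toEmbedding) p2 = p := by
  obtain ⟨p1, h1⟩ := PiGroup.eta_surjective fun i => PiGroup.eta p (e (Sum.inl i))
  obtain ⟨p2, h2⟩ := PiGroup.eta_surjective fun i => PiGroup.eta p (e (Sum.inr i))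
  have h3 : PiGroup.eta p = PiGroup.eta (PiGroup.map (Function.Embedding.inl.trans e.toEmbedding) p1 *
      PiGroup.map (Function.Embedding.inr.trans e.toEmbedding) p2) := by
    funext i
    rw [map_mul, Pi.mul_apply]
    obtain ⟨i | i, rfl⟩ := e.surjective i
    · rw [PiGroup.eta_map_of_notMem _ p2 _ (inl_notMem_range e i), mul_one]
      exact (congrFun h1 i).symm.trans
        (PiGroup.eta_map_apply (Function.Embedding.inl.trans e.toEmbedding) p1 i).symm
    · rw [PiGroup.eta_map_of_notMem _ p1 _ (inr_notMem_range e i), one_mul]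
      exact (congrFun h2 i).symm.trans
        (PiGroup.eta_map_apply (Function.Embedding.inr.trans e.toEmbedding) p2 i).symm
  rcases PiGroup.eta_eq_iff.1 h3 with h | h
  · exact ⟨p1, p2, h.symm⟩
  · exact ⟨PiGroup.z * p1, p2, by rw [h, map_mul, PiGroup.map_z, mul_assoc]⟩

/-- A permutation preserving the first block splits into permutations of the two blocks, while
tuples and elements of Π_ι always split. The spin product is thus a stabilizer. -/
theorem exists_spinMul_iff [Fintype α] [Finite β] (x : BG Γ ι) :
    (∃ ts : BG Γ α × BG Γ β, spinMul e ts.1 ts.2 = x) ↔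
      (firstBlock e).map x.right.toEmbedding = firstBlock e := by
  rw [Finset.map_perm_eq_iff]
  constructor
  · rintro ⟨⟨t, t'⟩, rfl⟩ i
    obtain ⟨i | i, rfl⟩ := e.surjective i
    · simp [spinMul_right_inl]
    · simp [spinMul_right_inr]
  · intro h
    have h1 : Set.MapsTo ((e.symm.permCongr) x.right) (Set.range (Sum.inl : α → α ⊕ β))
        (Set.range Sum.inl) := by
      rintro _ ⟨i, rfl⟩
      have h2 := (h (e (Sum.inl i))).2 (by simp)
      obtain ⟨j, hj⟩ := e.surjective (x.right (e (Sum.inl i)))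
      rcases j with j | j
      · exact ⟨j, by simp [Equiv.permCongr_apply, ← hj]⟩
      · rw [← hj] at h2
        exact absurd h2 (by simp)
    have := Fintype.ofFinite β
    obtain ⟨⟨s1, s2⟩, hs⟩ := Equiv.Perm.mem_sumCongrHom_range_of_perm_mapsTo_inl h1
    have hs1 : ∀ i, x.right (e (Sum.inl i)) = e (Sum.inl (s1 i)) := by
      intro i
      have := Equiv.congr_fun hs (Sum.inl i)
      simp only [Equiv.Perm.sumCongrHom_apply, Equiv.permCongr_apply, Equiv.symm_symm] at this
      rw [← Equiv.symm_apply_eq, ← this]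
      rfl
    have hs2 : ∀ i, x.right (e (Sum.inr i)) = e (Sum.inr (s2 i)) := by
      intro i
      have := Equiv.congr_fun hs (Sum.inr i)
      simp only [Equiv.Perm.sumCongrHom_apply, Equiv.permCongr_apply, Equiv.symm_symm] at this
      rw [← Equiv.symm_apply_eq, ← this]
      rfl
    obtain ⟨p1, p2, hp⟩ := PiGroup.exists_map_mul_map e x.left.2
    refine ⟨(⟨(fun i => x.left.1 (e (Sum.inl i)), p1), s1⟩,
      ⟨(fun i => x.left.1 (e (Sum.inr i)), p2), s2⟩), ?_⟩
    refine SemidirectProduct.ext (Prod.ext ?_ ?_) ?_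
    · funext i
      obtain ⟨i | i, rfl⟩ := e.surjective i
      · rw [spinMul_left_inl]
      · rw [spinMul_left_inr]
    · rw [spinMul_left_snd]
      exact hp
    · ext i
      obtain ⟨i | i, rfl⟩ := e.surjective i
      · rw [spinMul_right_inl, hs1]
      · rw [spinMul_right_inr, hs2]

/-- The stabilizer is a subgroup containing both images, and all its elements are products of one
element from each; hence it is the subgroup they generate. -/
theorem mem_spinProd_iff [Fintype α] [Finite β] (x : BG Γ ι) :
    x ∈ spinProd Γ e ↔ (firstBlock e).map x.right.toEmbedding = firstBlock e := by
  constructor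
  · intro hx
    let S : Subgroup (BG Γ ι) :=
      { carrier := {x | (firstBlock e).map x.right.toEmbedding = firstBlock e}
        one_mem' := by
          change (firstBlock e).map (Function.Embedding.refl ι) = _
          exact Finset.map_refl
        mul_mem' := by
          intro x y hx hy
          change (firstBlock e).map (y.right.toEmbedding.trans x.right.toEmbedding) = _
          rw [← Finset.map_map, hy, hx]
        inv_mem' := by
          intro x hx
          rw [Set.mem_ofPred_eq, Finset.map_perm_eq_iff] at hx ⊢
          intro i
          rw [← hx]
          change x.right (x.right⁻¹ i) ∈ _ ↔ _
          simp }
    have hS : spinProd Γ e ≤ S := by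
      refine sup_le ?_ ?_
      · rintro _ ⟨t, rfl⟩
        exact (exists_spinMul_iff e _).1 ⟨(t, 1), by simp [spinMul]⟩
      · rintro _ ⟨t, rfl⟩
        exact (exists_spinMul_iff e _).1 ⟨(1, t), by simp [spinMul]⟩
    exact hS hx
  · intro hx
    obtain ⟨⟨t, t'⟩, rfl⟩ := (exists_spinMul_iff e x).2 hx
    exact mul_mem (Subgroup.mem_sup_left ⟨t, rfl⟩) (Subgroup.mem_sup_right ⟨t', rfl⟩)

open scoped Classical in
/-- The value at `x`, along the cycles of `x` inside `A` of `β` and outside `A` of `γ`. -/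
def mixedProd [Fintype ι] (β γ : ClassFn Γ) (A : Finset ι) (x : BG Γ ι) : ℂ :=
  if A.map x.right.toEmbedding = A then
    cliffChar x * cyclesProd x.right (fun i => if i ∈ A then cycleVal β x i else cycleVal γ x i)
  else 0

/-- The right side depends on x alone, so the choice of a factorization of x, which is ambiguous by
z, is harmless. -/
theorem outerTensor_spinExt [Fintype α] [Fintype β] [Fintype ι] (φ ψ : ClassFn Γ) (x : BG Γ ι) :
    outerTensor e (spinExt α φ).1 (spinExt β ψ).1 x = mixedProd φ ψ (firstBlock e) x := by
  classical
  rw [outerTensor, mixedProd]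
  refine dite_congr (propext (exists_spinMul_iff e x)) (fun h => ?_) (fun h => rfl)
  set H : ∃ ts : BG Γ α × BG Γ β, spinMul e ts.1 ts.2 = x := (exists_spinMul_iff e x).2 h with hH
  change (spinExt α φ).1 H.choose.1 * (spinExt β ψ).1 H.choose.2 = _
  have hx : spinMul e H.choose.1 H.choose.2 = x := H.choose_spec
  -- From here on the factorization of x is arbitrary.
  generalize H.choose = ts at hx
  obtain ⟨t, t'⟩ := ts
  subst hx
  have hl : ∀ i, cycleVal φ (spinMul e t t') (e (Sum.inl i)) = cycleVal φ t i := fun i => by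
    rw [cycleVal, cycleProd_semiconj (f := fun i => e (Sum.inl i))
      (e.injective.comp Sum.inl_injective) (spinMul_left_inl e t t') (spinMul_right_inl e t t')]
    rfl
  have hr : ∀ i, cycleVal ψ (spinMul e t t') (e (Sum.inr i)) = cycleVal ψ t' i := fun i => by
    rw [cycleVal, cycleProd_semiconj (f := fun i => e (Sum.inr i))
      (e.injective.comp Sum.inr_injective) (spinMul_left_inr e t t') (spinMul_right_inr e t t')]
    rfl
  rw [Finset.map_perm_eq_iff] at h
  rw [cyclesProd_sum e (spinMul_right_inl e t t') (spinMul_right_inr e t t')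
    (fun i => by simp only [h, cycleVal_apply])]
  simp only [inl_mem_firstBlock, inr_notMem_firstBlock, if_true, if_false, hl, hr]
  rw [spinMul, cliffChar_map_mul_map, spinExt_apply, spinExt_apply]
  change _ * cyclesProd _ (cycleVal φ t) * (_ * cyclesProd _ (cycleVal ψ t')) = _ * (cyclesProd _ (cycleVal φ t) * cyclesProd _ (cycleVal ψ t'))
  ring

/-- Conjugation by y relabels the cycles by y and carries A to y(A). This turns the average over y
in an induced function into a sum over subsets. -/
theorem mixedProd_conj [Fintype ι] (φ ψ : ClassFn Γ) (A : Finset ι) (x y : BG Γ ι) :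
    mixedProd φ ψ A (y⁻¹ * x * y) = mixedProd φ ψ (A.map y.right.toEmbedding) x := by
  classical
  obtain ⟨w, rfl⟩ : ∃ w, x = y * w * y⁻¹ := ⟨y⁻¹ * x * y, by group⟩
  have h0 : y⁻¹ * (y * w * y⁻¹) * y = w := by group
  have h1 : ∀ i, (y * w * y⁻¹).right (y.right i) = y.right (w.right i) := by
    intro i
    change y.right (w.right (y.right⁻¹ (y.right i))) = _
    simp
  have hm : ∀ i, y.right i ∈ A.map y.right.toEmbedding ↔ i ∈ A := fun i =>
    Finset.mem_map' y.right.toEmbedding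
  have h2 : (A.map y.right.toEmbedding).map (y * w * y⁻¹).right.toEmbedding =
      A.map y.right.toEmbedding ↔ A.map w.right.toEmbedding = A := by
    rw [Finset.map_perm_eq_iff, Finset.map_perm_eq_iff, ← y.right.forall_congr_right]
    simp only [h1, hm]
  rw [h0, mixedProd, mixedProd]
  by_cases hA : A.map w.right.toEmbedding = A
  · rw [if_pos hA, if_pos (h2.2 hA)]
    have h3 := cliffChar_conj w y⁻¹
    rw [inv_inv] at h3
    rw [h3]
    congr 1
    rw [Finset.map_perm_eq_iff] at hA
    refine (cyclesProd_equiv y.right h1 (fun i => ?_) fun i => ?_).symm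
    · simp only [hA, cycleVal_apply]
    · simp only [hm, cycleVal_conj]
  · rw [if_neg hA, if_neg (mt h2.1 hA)]

theorem exists_perm_map_eq [Fintype ι] (A B : Finset ι) (h : A.card = B.card) :
    ∃ s : Equiv.Perm ι, A.map s.toEmbedding = B := by
  classical
  let s := (Finset.equivOfCardEq h).extendSubtype
  refine ⟨s, Finset.eq_of_subset_of_card_le ?_ (by rw [Finset.card_map, h])⟩
  intro i hi
  obtain ⟨j, hj, rfl⟩ := Finset.mem_map.1 hi
  exact (Finset.equivOfCardEq h).extendSubtype_mem j hj

/-- The summand at y depends only on the image of the first block under y. These images are all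
subsets of the right size, and each arises from a coset of the spin product, whose order cancels the
normalization. -/
theorem inducedFn_outerTensor_spinExt [Fintype α] [Fintype β] [Fintype ι] [Finite Γ]
    (φ ψ : ClassFn Γ) (x : BG Γ ι) :
    inducedFn (spinProd Γ e) (outerTensor e (spinExt α φ).1 (spinExt β ψ).1) x =
      ∑ A : Finset ι with A.card = Fintype.card α, mixedProd φ ψ A x := by
  classical
  let _ := Fintype.ofFinite (BG Γ ι)
  rw [inducedFn]
  simp only [outerTensor_spinExt, mixedProd_conj]
  have hcard : (firstBlock e).card = Fintype.card α := by simp [firstBlock]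
  have hfib : ∀ A : Finset ι, A.card = Fintype.card α →
      (Finset.univ.filter fun y : BG Γ ι => (firstBlock e).map y.right.toEmbedding = A).card =
        Nat.card (spinProd Γ e) := by
    intro A hA
    obtain ⟨s, hs⟩ := exists_perm_map_eq (firstBlock e) A (hcard.trans hA.symm)
    rw [← Fintype.card_subtype, ← Nat.card_eq_fintype_card]
    have h1 : ∀ y : BG Γ ι, (BG.wreath 1 s * y).right.toEmbedding =
        y.right.toEmbedding.trans s.toEmbedding := fun y => rfl
    refine (Nat.card_congr (Equiv.subtypeEquiv (Equiv.mulLeft (BG.wreath 1 s)) fun y => ?_)).symm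
    rw [mem_spinProd_iff, Equiv.coe_mulLeft, h1, ← Finset.map_map, ← hs, Finset.map_inj]
  have h0 : (Nat.card (spinProd Γ e) : ℂ) ≠ 0 := Nat.cast_ne_zero.2 Nat.card_pos.ne'
  rw [Finset.sum_comp (fun A => mixedProd φ ψ A x)
    (fun y : BG Γ ι => (firstBlock e).map y.right.toEmbedding), inv_mul_eq_iff_eq_mul₀ h0,
    Finset.mul_sum]
  have himg : Finset.univ.image (fun y : BG Γ ι => (firstBlock e).map y.right.toEmbedding) =
      Finset.univ.filter fun A : Finset ι => A.card = Fintype.card α := by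
    ext A
    simp only [Finset.mem_image, Finset.mem_univ, true_and, Finset.mem_filter]
    constructor
    · rintro ⟨y, rfl⟩
      rw [Finset.card_map, hcard]
    · intro hA
      obtain ⟨s, hs⟩ := exists_perm_map_eq (firstBlock e) A (hcard.trans hA.symm)
      exact ⟨BG.wreath 1 s, hs⟩
  rw [himg]
  refine Finset.sum_congr rfl fun A hA => ?_
  rw [hfib A (Finset.mem_filter.1 hA).2, nsmul_eq_mul]

/-- Unstable subsets contribute 0, and the stable ones are the terms in the expansion of the product
of φ + ψ over the cycles. -/
theorem sum_mixedProd [Fintype ι] (φ ψ : ClassFn Γ) (x : BG Γ ι) :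
    ∑ A : Finset ι, mixedProd φ ψ A x = (spinExt ι (φ + ψ)).1 x := by
  classical
  rw [spinExt_apply]
  have h1 : cycleVal (φ + ψ) x = fun i => cycleVal φ x i + cycleVal ψ x i := rfl
  rw [h1, cyclesProd_add, Finset.mul_sum, Finset.sum_filter]
  refine Finset.sum_congr rfl fun A _ => ?_
  rw [mixedProd]
  exact if_congr (Finset.map_perm_eq_iff _ _) (by congr!) rfl

/-- Negation gives (-1)^{number of cycles}. Where the Clifford trace is nonzero all cycles are odd,
so this equals (-1) to the sum of their lengths. -/
theorem spinExt_neg [Fintype ι] (γ : ClassFn Γ) (x : BG Γ ι) :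
    (spinExt ι (-γ)).1 x = (-1) ^ Fintype.card ι * (spinExt ι γ).1 x := by
  classical
  rw [spinExt_apply, spinExt_apply]
  by_cases hx : cliffChar x = 0
  · simp [hx]
  · have h1 : (-1 : ℂ) ^ Fintype.card ι = ∏ q : CycleSet x.right, (-1 : ℂ) := by
      rw [← Fintype.card_congr (cycleEquiv x.right), Fintype.card_sigma,
        ← Finset.prod_pow_eq_pow_sum]
      refine Finset.prod_congr rfl fun q _ => ?_
      rw [Fintype.card_fin, (odd_minimalPeriod_of_cliffChar_ne_zero x hx q.out).neg_one_pow]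
    rw [h1, cyclesProd, cyclesProd, mul_left_comm, ← Finset.prod_mul_distrib]
    congr 1
    refine Finset.prod_congr rfl fun q _ => ?_
    rw [neg_one_mul]
    rfl

theorem outerTensor_smul_right (c : ℂ) (f : BG Γ α → ℂ) (h : BG Γ β → ℂ) (x : BG Γ ι) :
    outerTensor e f (fun y => c * h y) x = c * outerTensor e f h x := by
  rw [outerTensor, outerTensor]
  split_ifs
  · ring
  · ring

/-- Write φ - ψ = φ + (-ψ), absorb (-1)^m into ψ, and sort the subsets A in `sum_mixedProd` by size;
each A belongs to the single index m = n - |A|. -/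
theorem spinExt_sub [Finite Γ] (n : ℕ) (φ ψ : ClassFn Γ) :
    (spinExt (Fin n) (φ - ψ)).1 = ∑ m : Fin (n + 1), (-1 : ℂ) ^ (m : ℕ) •
      spinInd m (spinExt (Fin (n - m)) φ).1 (spinExt (Fin m) ψ).1 := by
  classical
  funext x
  rw [sub_eq_add_neg, ← sum_mixedProd, Finset.sum_apply]
  have h : ∀ m : Fin (n + 1), ((-1 : ℂ) ^ (m : ℕ) •
      spinInd m (spinExt (Fin (n - m)) φ).1 (spinExt (Fin m) ψ).1) x =
      ∑ A : Finset (Fin n) with A.card = n - m, mixedProd φ (-ψ) A x := by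
    intro m
    have h1 := inducedFn_outerTensor_spinExt (splitFin n m) φ (-ψ) x
    rw [Fintype.card_fin] at h1
    rw [← h1, Pi.smul_apply, smul_eq_mul, spinInd, inducedFn, inducedFn, mul_left_comm,
      Finset.mul_sum]
    congr 1
    refine Finset.sum_congr rfl fun y _ => ?_
    rw [← outerTensor_smul_right]
    congr 1
    funext w
    rw [spinExt_neg, Fintype.card_fin]
  rw [Finset.sum_congr rfl fun m _ => h m]
  simp only [Finset.sum_filter]
  rw [Finset.sum_comm]
  refine Finset.sum_congr rfl fun A _ => ?_
  have hA : A.card ≤ n := by simpa using Finset.card_le_univ A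
  rw [Finset.sum_eq_single (⟨n - A.card, by omega⟩ : Fin (n + 1))]
  · rw [if_pos (by simp only; omega)]
  · intro m _ hm
    rw [if_neg]
    intro h2
    exact hm (Fin.ext (by simp only; have := m.2; omega))
  · simp

end Induction

/-! ### Completeness of the irreducible characters -/

section Completeness

open CategoryTheory

variable {Γ : Type u} [Group Γ]

/-- The image of a monomorphism is an invariant subspace: if it is 0 the map is zero, if it is
everything the map is also epi, hence an isomorphism. The argument runs in `Rep` and is reflected
back. -/
theorem simple_of_forall_invariant (V : FDRep ℂ Γ) [Nontrivial V]
    (h : ∀ W : Submodule ℂ V, (∀ g, ∀ v ∈ W, V.ρ g v ∈ W) → W = ⊥ ∨ W = ⊤) : Simple V := by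
  refine ⟨fun {Y} f hf => ⟨fun hiso h0 => ?_, fun h0 => ?_⟩⟩
  · subst h0
    have h1 : 𝟙 V = 0 := by
      rw [← IsIso.inv_hom_id (0 : Y ⟶ V), Limits.comp_zero]
    obtain ⟨v, hv⟩ := exists_ne (0 : V)
    refine hv ?_
    have h2 := congrArg (forget₂ (FDRep ℂ Γ) (Rep ℂ Γ)).map h1
    rw [CategoryTheory.Functor.map_id] at h2
    exact congrArg (fun g => g.hom.toLinearMap v) h2
  · let F := forget₂ (FDRep ℂ Γ) (Rep ℂ Γ)
    have hF : Mono (F.map f) := inferInstance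
    let W : Submodule ℂ V := LinearMap.range (F.map f).hom.toLinearMap
    have hW : ∀ g, ∀ v ∈ W, V.ρ g v ∈ W := by
      rintro g _ ⟨w, rfl⟩
      exact ⟨(F.obj Y).ρ g w, Rep.hom_comm_apply (F.map f) g w⟩
    rcases h W hW with h1 | h1
    · exfalso
      apply h0
      apply F.map_injective
      apply Rep.hom_ext
      ext v
      have : (F.map f).hom.toLinearMap v ∈ W := ⟨v, rfl⟩
      rw [h1] at this
      exact (Submodule.mem_bot ℂ).1 this
    · have hE : Epi (F.map f) := (Rep.epi_iff_surjective _).2 (LinearMap.range_eq_top.1 h1)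
      have : IsIso (F.map f) := isIso_of_mono_of_epi _
      exact isIso_of_reflects_iso f F

theorem span_vectors_of_matrix {d : ℕ} (W : Submodule ℂ (Fin d → ℂ))
    (hW : ∀ M : Matrix (Fin d) (Fin d) ℂ, ∀ v ∈ W, M.mulVec v ∈ W) : W = ⊥ ∨ W = ⊤ := by
  rw [or_iff_not_imp_left]
  intro h
  obtain ⟨v, hv, hv0⟩ := W.ne_bot_iff.1 h
  obtain ⟨i, hi⟩ := Function.ne_iff.1 hv0
  rw [eq_top_iff]
  rintro u -
  -- This rank-one matrix divides the nonzero coordinate v_i by itself and so sends v to u.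
  have := hW (Matrix.vecMulVec u (Pi.single i (v i)⁻¹)) v hv
  rw [Matrix.vecMulVec_mulVec] at this
  simpa [inv_mul_cancel₀ hi] using this

/-- Off the diagonal E_ij = E_ii E_ij while E_ij E_ii = 0, so l vanishes there; on it E_ii = E_i0
E_0i has the same value as E_00. -/
theorem trace_like_functional {d : ℕ} [NeZero d] (l : Matrix (Fin d) (Fin d) ℂ →ₗ[ℂ] ℂ)
    (hl : ∀ A B, l (A * B) = l (B * A)) (A : Matrix (Fin d) (Fin d) ℂ) :
    l A = l (Matrix.single 0 0 1) * A.trace := by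
  have h1 : ∀ i j, l (Matrix.single i j 1) = if i = j then l (Matrix.single 0 0 1) else 0 := by
    intro i j
    split_ifs with h
    · subst h
      have := hl (Matrix.single i 0 1) (Matrix.single 0 i 1)
      simpa using this
    · have := hl (Matrix.single i i 1) (Matrix.single i j 1)
      rw [Matrix.single_mul_single_same, one_mul] at this
      rw [this, Matrix.single_mul_single_of_ne (h := Ne.symm h), map_zero]
  conv_lhs => rw [Matrix.matrix_eq_sum_single A]
  simp only [map_sum]
  have h2 : ∀ i j, l (Matrix.single i j (A i j)) =
      A i j * if i = j then l (Matrix.single 0 0 1) else 0 := by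
    intro i j
    rw [← h1, ← smul_eq_mul, ← map_smul, Matrix.smul_single, smul_eq_mul, mul_one]
  simp only [h2, mul_ite, mul_zero, Finset.sum_ite_eq, Finset.mem_univ, if_true, Matrix.trace,
    Matrix.diag_apply, Finset.mul_sum]
  exact Finset.sum_congr rfl fun i _ => mul_comm _ _

theorem exists_charFn_eq_zero : ∃ V : FDRep ℂ Γ, charFn V = 0 := by
  refine ⟨FDRep.of (V := PUnit) (1 : Representation ℂ Γ PUnit), ?_⟩
  ext x
  change LinearMap.trace ℂ PUnit _ = 0
  rw [Subsingleton.elim ((FDRep.of (V := PUnit) (1 : Representation ℂ Γ PUnit)).ρ x) 0, map_zero]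

theorem exists_charFn_eq_add (V W : FDRep ℂ Γ) :
    ∃ U : FDRep ℂ Γ, charFn U = charFn V + charFn W := by
  refine ⟨FDRep.of (Representation.prod V.ρ W.ρ), ?_⟩
  ext x
  exact LinearMap.trace_prodMap' (V.ρ x) (W.ρ x)

variable [Fintype Γ]

/-- By Wedderburn the group algebra is a product of matrix algebras. The linear extension L of f
satisfies L(ab) = L(ba), so on each block it is a multiple of the trace, which is the character of
the simple module attached to that block. -/
theorem ClassFn.mem_span_irr (f : ClassFn Γ) :
    f ∈ Submodule.span ℂ (Set.range fun i : Irr Γ => i.1) := by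
  classical
  obtain ⟨n, d, hd, ⟨φ⟩⟩ :=
    IsSemisimpleRing.exists_algEquiv_pi_matrix_of_isAlgClosed ℂ (MonoidAlgebra ℂ Γ)
  let L : MonoidAlgebra ℂ Γ →ₗ[ℂ] ℂ := (MonoidAlgebra.basis Γ ℂ).constr ℂ f.1
  have hL : ∀ x : Γ, L (MonoidAlgebra.of ℂ Γ x) = f.1 x := by
    intro x
    have := (MonoidAlgebra.basis Γ ℂ).constr_basis ℂ f.1 x
    rwa [MonoidAlgebra.basis_apply] at this
  have hcomm : ∀ a b, L (a * b) = L (b * a) := by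
    intro a b
    induction a using MonoidAlgebra.induction_on with
    | of x =>
      induction b using MonoidAlgebra.induction_on with
      | of y =>
        rw [← map_mul, ← map_mul, hL, hL, ← f.2 (x * y) y]
        group
      | add b c hb hc => rw [mul_add, add_mul, map_add, map_add, hb, hc]
      | smul r b hb => rw [mul_smul_comm, smul_mul_assoc, map_smul, map_smul, hb]
    | add a c ha hc => rw [mul_add, add_mul, map_add, map_add, ha, hc]
    | smul r a ha => rw [mul_smul_comm, smul_mul_assoc, map_smul, map_smul, ha]
  let l : ∀ i, Matrix (Fin (d i)) (Fin (d i)) ℂ →ₗ[ℂ] ℂ := fun i =>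
    L ∘ₗ φ.symm.toLinearMap ∘ₗ LinearMap.single ℂ (fun i => Matrix (Fin (d i)) (Fin (d i)) ℂ) i
  have hl : ∀ i (A B : Matrix (Fin (d i)) (Fin (d i)) ℂ), l i (A * B) = l i (B * A) := by
    intro i A B
    change L (φ.symm (Pi.single i (A * B))) = L (φ.symm (Pi.single i (B * A)))
    rw [Pi.single_mul, Pi.single_mul, map_mul φ.symm, map_mul φ.symm, hcomm]
  let ρ : ∀ i, Representation ℂ Γ (Fin (d i) → ℂ) := fun i =>
    ((((Matrix.toLinAlgEquiv' (R := ℂ) (n := Fin (d i))).toAlgHom.comp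
      (Pi.evalAlgHom ℂ (fun i => Matrix (Fin (d i)) (Fin (d i)) ℂ) i)).comp φ.toAlgHom :
        MonoidAlgebra ℂ Γ →ₐ[ℂ] _) : MonoidAlgebra ℂ Γ →* _).comp (MonoidAlgebra.of ℂ Γ)
  have hρ : ∀ i x, ρ i x = Matrix.toLin' (φ (MonoidAlgebra.of ℂ Γ x) i) := fun i x => rfl
  have hsimple : ∀ i, Simple (FDRep.of (ρ i)) := by
    intro i
    have : Nontrivial (FDRep.of (ρ i)) := inferInstanceAs (Nontrivial (Fin (d i) → ℂ))
    refine simple_of_forall_invariant _ fun W hW => span_vectors_of_matrix W fun M v hv => ?_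
    have h1 : ∀ a : MonoidAlgebra ℂ Γ, (φ a i).mulVec v ∈ W := by
      intro a
      induction a using MonoidAlgebra.induction_on with
      | of x => exact hW x v hv
      | add a b ha hb =>
        rw [map_add, Pi.add_apply, Matrix.add_mulVec]
        exact W.add_mem ha hb
      | smul r a ha =>
        rw [map_smul, Pi.smul_apply, Matrix.smul_mulVec]
        exact W.smul_mem r ha
    -- Every matrix M is the i-th component of an element of the group algebra, so Γ-invariance
    -- implies invariance under all matrices.
    have h2 := h1 (φ.symm (Pi.single i M))
    rwa [AlgEquiv.apply_symm_apply, Pi.single_eq_same] at h2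
  have hf : f = ∑ i, l i (Matrix.single 0 0 1) • charFn (FDRep.of (ρ i)) := by
    ext x
    rw [Submodule.coe_sum, Finset.sum_apply, ← hL,
      ← φ.symm_apply_apply (MonoidAlgebra.of ℂ Γ x),
      ← Finset.univ_sum_single (φ (MonoidAlgebra.of ℂ Γ x)), map_sum, map_sum]
    refine Finset.sum_congr rfl fun i _ => ?_
    change l i (φ (MonoidAlgebra.of ℂ Γ x) i) =
      l i (Matrix.single 0 0 1) * LinearMap.trace ℂ _ (ρ i x)
    rw [hρ, Matrix.trace_toLin'_eq, trace_like_functional (l i) (hl i)]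
  rw [hf]
  exact Submodule.sum_mem _ fun i _ => Submodule.smul_mem _ _
    (Submodule.subset_span ⟨⟨_, _, hsimple i, rfl⟩, rfl⟩)

theorem ClassFn.exists_eq_sum (f : ClassFn Γ) : ∃ s : Irr Γ → ℂ, f = ∑ i, s i • i.1 := by
  obtain ⟨s, hs⟩ := (Submodule.mem_span_range_iff_exists_fun ℂ).1 (ClassFn.mem_span_irr f)
  exact ⟨s, hs.symm⟩

theorem exists_charFn_eq_sum (m : Irr Γ → ℕ) :
    ∃ V : FDRep ℂ Γ, charFn V = ∑ i, (m i : ℂ) • i.1 := by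
  classical
  have h1 : ∀ (i : Irr Γ) (k : ℕ), ∃ V : FDRep ℂ Γ, charFn V = (k : ℂ) • i.1 := by
    intro i k
    induction k with
    | zero =>
      obtain ⟨V, hV⟩ := exists_charFn_eq_zero (Γ := Γ)
      exact ⟨V, by rw [hV]; simp⟩
    | succ k ih =>
      obtain ⟨V, hV⟩ := ih
      obtain ⟨W, -, hW⟩ := i.2
      obtain ⟨U, hU⟩ := exists_charFn_eq_add V W
      exact ⟨U, by rw [hU, hV, hW, Nat.cast_succ, add_smul, one_smul]⟩
  have h2 : ∀ S : Finset (Irr Γ), ∃ V : FDRep ℂ Γ, charFn V = ∑ i ∈ S, (m i : ℂ) • i.1 := by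
    intro S
    induction S using Finset.induction_on with
    | empty => simpa using exists_charFn_eq_zero
    | insert i S hi ih =>
      obtain ⟨V, hV⟩ := ih
      obtain ⟨W, hW⟩ := h1 i (m i)
      obtain ⟨U, hU⟩ := exists_charFn_eq_add W V
      exact ⟨U, by rw [hU, hV, hW, Finset.sum_insert hi]⟩
  exact h2 Finset.univ

/-- Points with natural-number coordinates are characters of direct sums of irreducible modules,
where both extensions are prescribed. Such points form a product of infinite sets, so they determine
a polynomial. -/
theorem IsBasicSpinExtension.unique {χ χ' : ∀ n : ℕ, ClassFn Γ → SpinClassFn Γ (Fin n)}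
    (h : IsBasicSpinExtension χ) (h' : IsBasicSpinExtension χ') : χ = χ' := by
  funext n γ
  ext x
  obtain ⟨s, rfl⟩ := ClassFn.exists_eq_sum γ
  obtain ⟨P, hP⟩ := h.poly n x
  obtain ⟨P', hP'⟩ := h'.poly n x
  rw [hP, hP']
  congr 1
  refine MvPolynomial.funext_set (fun _ => Set.range fun k : ℕ => (k : ℂ))
    (fun _ => Set.infinite_range_of_injective Nat.cast_injective) fun s hs => ?_
  choose m hm using fun i => hs i (Set.mem_univ i)
  obtain rfl : (fun i => (m i : ℂ)) = s := funext hm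
  obtain ⟨V, hV⟩ := exists_charFn_eq_sum m
  rw [← hP, ← hP', ← hV, h.char, h'.char]

/-- Each cycle contributes a linear form in the coordinates, and the Clifford trace is a constant.
-/
theorem isBasicSpinExtension_spinExt :
    IsBasicSpinExtension (Γ := Γ) fun n γ => spinExt (Fin n) γ where
  char n V := (basicChar_eq_spinExt V).symm
  poly n x := by
    classical
    refine ⟨MvPolynomial.C (cliffChar x) * ∏ q : CycleSet x.right,
      ∑ i : Irr Γ, MvPolynomial.C (cycleVal i.1 x q.out) * MvPolynomial.X i, fun s => ?_⟩
    rw [spinExt_apply, map_mul, MvPolynomial.eval_C, map_prod, cyclesProd]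
    congr 1
    refine Finset.prod_congr rfl fun q _ => ?_
    simp only [map_sum, map_mul, MvPolynomial.eval_C, MvPolynomial.eval_X]
    rw [cycleVal, Submodule.coe_sum, Finset.sum_apply]
    refine Finset.sum_congr rfl fun i _ => ?_
    exact mul_comm _ _

end Completeness

/-! ### Values on split conjugacy classes -/

section ClassValues

variable {Γ : Type u} [Group Γ]

theorem ClassFn.apply_eq_of_isConj (γ : ClassFn Γ) {x y : Γ} (h : IsConj x y) : γ.1 x = γ.1 y := by
  obtain ⟨c, rfl⟩ := isConj_iff.1 h
  exact (γ.2 x c).symm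

theorem ConjClasses.isConj_out_mk (x : Γ) : IsConj (Quotient.out (ConjClasses.mk x)) x :=
  Quotient.mk_out (s := IsConj.setoid Γ) x

theorem ClassFn.evalAt_mk (γ : ClassFn Γ) (x : Γ) : ClassFn.evalAt γ (ConjClasses.mk x) = γ.1 x :=
  ClassFn.apply_eq_of_isConj γ (ConjClasses.isConj_out_mk x)

theorem ClassFn.evalAtInv_mk (γ : ClassFn Γ) (x : Γ) :
    ClassFn.evalAtInv γ (ConjClasses.mk x) = γ.1 x⁻¹ := by
  refine ClassFn.apply_eq_of_isConj γ ?_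
  obtain ⟨c, hc⟩ := isConj_iff.1 (ConjClasses.isConj_out_mk x)
  exact isConj_iff.2 ⟨c, by rw [← conj_inv, hc]⟩

variable {n : ℕ}

/-- The definition fixes classical instances; this form accepts any. The same is done below for
`wreathType`. -/
theorem cyclesProd_eq_prod {ι : Type} [Fintype ι] (s : Equiv.Perm ι) [Fintype (CycleSet s)]
    (h : ι → ℂ) : cyclesProd s h = ∏ q : CycleSet s, h q.out := by
  unfold cyclesProd
  congr!

variable [Fintype Γ]

theorem wreathType_eq_map (g : Fin n → Γ) (s : Equiv.Perm (Fin n)) [Fintype (CycleSet s)]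
    [DecidableEq (ConjClasses Γ)] (c : ConjClasses Γ) :
    wreathType g s c = (Finset.univ.filter fun q : CycleSet s =>
      ConjClasses.mk (cycleProd g s q.out) = c).val.map fun q => Function.minimalPeriod s q.out := by
  unfold wreathType
  congr!

theorem odd_minimalPeriod_of_wreathType (ρ : OP Γ n) (g : Fin n → Γ) (s : Equiv.Perm (Fin n))
    (h : wreathType g s = ρ.1) (i : Fin n) : Odd (Function.minimalPeriod s i) := by
  classical
  let q : CycleSet s := Quotient.mk _ i
  have h1 : Function.minimalPeriod s q.out = Function.minimalPeriod s i :=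
    apply_out_eq (h := Function.minimalPeriod s)
      (fun i => minimalPeriod_semiconj s.injective (fun _ => rfl) i) i
  rw [← h1]
  refine ρ.2.1 (ConjClasses.mk (cycleProd g s q.out)) _ ?_
  rw [← h, wreathType_eq_map]
  exact Multiset.mem_map_of_mem (fun q : CycleSet s => Function.minimalPeriod s q.out) (by simp)

theorem card_cycleSet_eq_length (ρ : OP Γ n) (g : Fin n → Γ) (s : Equiv.Perm (Fin n))
    (h : wreathType g s = ρ.1) : Nat.card (CycleSet s) = ρ.length := by
  classical
  rw [Nat.card_eq_fintype_card, OP.length, ← Finset.card_univ,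
    Finset.card_eq_sum_card_fiberwise (t := Finset.univ)
    (f := fun q : CycleSet s => ConjClasses.mk (cycleProd g s q.out)) (fun _ _ => by simp)]
  refine Finset.sum_congr rfl fun c _ => ?_
  rw [← h, wreathType_eq_map, Multiset.card_map]
  rfl

theorem cyclesProd_eq_evalProd (ρ : OP Γ n) (g : Fin n → Γ) (s : Equiv.Perm (Fin n))
    (h : wreathType g s = ρ.1) (γ : ClassFn Γ) :
    cyclesProd s (fun i => γ.1 (cycleProd g s i)) = ρ.evalProd γ := by
  classical
  rw [cyclesProd_eq_prod, OP.evalProd,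
    ← Finset.prod_fiberwise Finset.univ
      (fun q : CycleSet s => ConjClasses.mk (cycleProd g s q.out))]
  refine Finset.prod_congr rfl fun c _ => ?_
  have h1 : ∀ q ∈ Finset.univ.filter (fun q : CycleSet s =>
      ConjClasses.mk (cycleProd g s q.out) = c), γ.1 (cycleProd g s q.out) = ClassFn.evalAt γ c := by
    intro q hq
    rw [← (Finset.mem_filter.1 hq).2, ClassFn.evalAt_mk]
  rw [Finset.prod_congr rfl h1, Finset.prod_const, ← h, wreathType_eq_map, Multiset.card_map]
  rfl

theorem spinExt_wreath (ρ : OP Γ n) (g : Fin n → Γ) (s : Equiv.Perm (Fin n))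
    (h : wreathType g s = ρ.1) (γ : ClassFn Γ) :
    (spinExt (Fin n) γ).1 (BG.wreath g s) = 2 ^ ρ.length * ρ.evalProd γ := by
  rw [spinExt_apply, cliffChar_wreath_of_odd g s (odd_minimalPeriod_of_wreathType ρ g s h),
    card_cycleSet_eq_length ρ g s h, ← cyclesProd_eq_evalProd ρ g s h]
  rfl

theorem spinExt_Dpos (ρ : OP Γ n) (γ : ClassFn Γ) (x : BG Γ (Fin n)) (hx : x ∈ Dpos ρ) :
    (spinExt (Fin n) γ).1 x = 2 ^ ρ.length * ρ.evalProd γ := by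
  obtain ⟨g, s, h, hc⟩ := hx
  obtain ⟨y, rfl⟩ := isConj_iff.1 hc
  rw [(spinExt (Fin n) γ).2.1, spinExt_wreath ρ g s h]

theorem spinExt_Dneg (ρ : OP Γ n) (γ : ClassFn Γ) (x : BG Γ (Fin n)) (hx : x ∈ Dneg ρ) :
    (spinExt (Fin n) γ).1 x = -(2 ^ ρ.length * ρ.evalProd γ) := by
  obtain ⟨y, hy, rfl⟩ := hx
  rw [(spinExt (Fin n) γ).2.2.1, spinExt_Dpos ρ γ y hy]

end ClassValues

/-! ### Existence of elements of given type -/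

section Existence

variable {Γ : Type u} [Group Γ]

theorem cycleProd_eq_of_single {ι : Type} {g : ι → Γ} {s : Equiv.Perm ι} {i : ι}
    (hi : 0 < Function.minimalPeriod s i)
    (h : ∀ k, 0 < k → k < Function.minimalPeriod s i → g ((s ^ k)⁻¹ i) = 1) :
    cycleProd g s i = g i := by
  rw [cycleProd]
  obtain ⟨m, hm⟩ := Nat.exists_eq_succ_of_ne_zero hi.ne'
  rw [hm, Nat.succ_eq_add_one, List.range_succ_eq_map, List.map_cons, List.prod_cons, pow_zero,
    inv_one, Equiv.Perm.one_apply, List.map_map, List.prod_eq_one, mul_one]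
  intro y hy
  obtain ⟨k, hk, rfl⟩ := List.mem_map.1 hy
  exact h _ (Nat.succ_pos k) (by rw [hm]; have := List.mem_range.1 hk; omega)

/-- The rotation of each of the cyclic groups `ℤ/d_κ`. -/
def rotation {K : Type*} (d : K → ℕ) : Equiv.Perm (Σ κ : K, ZMod (d κ)) :=
  Equiv.sigmaCongrRight fun _ => Equiv.addRight 1

theorem rotation_pow_apply {K : Type*} (d : K → ℕ) (k : ℕ) (κ : K) (j : ZMod (d κ)) :
    (rotation d ^ k) ⟨κ, j⟩ = ⟨κ, j + k⟩ := by
  induction k generalizing j with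
  | zero => simp
  | succ k ih =>
    rw [pow_succ, Equiv.Perm.mul_apply]
    change (rotation d ^ k) ⟨κ, j + 1⟩ = _
    rw [ih]
    push_cast
    congr 1
    ring

theorem rotation_pow_inv_apply {K : Type*} (d : K → ℕ) (k : ℕ) (κ : K) (j : ZMod (d κ)) :
    (rotation d ^ k)⁻¹ ⟨κ, j⟩ = ⟨κ, j - k⟩ := by
  rw [Equiv.Perm.inv_eq_iff_eq, rotation_pow_apply, sub_add_cancel]

theorem minimalPeriod_rotation {K : Type*} (d : K → ℕ) (κ : K) (j : ZMod (d κ)) :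
    Function.minimalPeriod (rotation d) ⟨κ, j⟩ = d κ := by
  have h : ∀ k : ℕ, Function.IsPeriodicPt (rotation d) k ⟨κ, j⟩ ↔ d κ ∣ k := by
    intro k
    rw [Function.IsPeriodicPt, Function.IsFixedPt, Equiv.Perm.iterate_eq_pow, rotation_pow_apply,
      Sigma.mk.injEq, heq_eq_eq, eq_self, true_and, add_eq_left, ZMod.natCast_eq_zero_iff]
  apply Nat.dvd_antisymm
  · exact ((h _).2 dvd_rfl).minimalPeriod_dvd
  · exact (h _).1 (Function.isPeriodicPt_minimalPeriod _ _)

variable [Fintype Γ] {n : ℕ}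

/-- Needed because `classValue` evaluates at a point chosen by `epsilon`, which lies in D_ρ^+ only
if that class is inhabited. The element is built on a disjoint union of cyclic groups, one for each
part of ρ, each rotated by 1. -/
theorem Dpos_nonempty (ρ : OP Γ n) : (Dpos ρ).Nonempty := by
  classical
  suffices h : ∃ (g : Fin n → Γ) (s : Equiv.Perm (Fin n)), wreathType g s = ρ.1 by
    obtain ⟨g, s, h⟩ := h
    exact ⟨_, g, s, h, IsConj.refl _⟩
  -- The parts of all ρ(c), with equal parts kept distinct. Parts are odd, hence positive, so no
  -- `ZMod 0`, which is infinite, occurs below.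
  let K := Σ c : ConjClasses Γ, (ρ.1 c).ToType
  let d : K → ℕ := fun κ => κ.2.1
  have hd : ∀ κ, 0 < d κ := fun κ =>
    (ρ.2.1 κ.1 κ.2.1 (Multiset.coe_mem)).pos
  have hne : ∀ κ, NeZero (d κ) := fun κ => ⟨(hd κ).ne'⟩
  have hcard : Fintype.card (Σ κ : K, ZMod (d κ)) = n := by
    rw [Fintype.card_sigma, Finset.sum_congr rfl fun κ _ => ZMod.card (d κ), Fintype.sum_sigma]
    refine Eq.trans ?_ ρ.2.2
    refine Finset.sum_congr rfl fun c _ => ?_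
    conv_rhs => rw [← Multiset.map_univ_coe (ρ.1 c)]
    rfl
  let E : (Σ κ : K, ZMod (d κ)) ≃ Fin n := Fintype.equivFinOfCardEq hcard
  let s : Equiv.Perm (Fin n) := E.permCongr (rotation d)
  -- The representative of c sits at position 0 of its cycle and 1 elsewhere, so the cycle product
  -- from 0 has a single nontrivial factor.
  let g : Fin n → Γ := fun i =>
    if (E.symm i).2 = 0 then Quotient.out (E.symm i).1.1 else 1
  have hg : ∀ κ j, g (E ⟨κ, j⟩) = if j = 0 then Quotient.out κ.1 else 1 := fun κ j => by
    simp only [g]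
    rw [Equiv.symm_apply_apply]
  have hs : ∀ x, s (E x) = E (rotation d x) := fun x => by simp [s]
  let Θ : K → CycleSet s := fun κ => Quotient.mk _ (E ⟨κ, 0⟩)
  have hΘ : Function.Bijective Θ := by
    constructor
    · intro κ κ' h
      have h1 : s.SameCycle (E ⟨κ, 0⟩) (E ⟨κ', 0⟩) := Quotient.exact h
      have h2 : ∀ i, (E.symm (s i)).1 = (E.symm i).1 := fun i => by
        obtain ⟨x, rfl⟩ := E.surjective i
        rw [hs, Equiv.symm_apply_apply, Equiv.symm_apply_apply]
        rfl
      have := apply_eq_of_sameCycle (h := fun i => (E.symm i).1) h2 h1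
      simpa using this
    · intro q
      induction q using Quotient.inductionOn with
      | _ i =>
        obtain ⟨⟨κ, j⟩, rfl⟩ := E.surjective i
        refine ⟨κ, Quotient.sound ((sameCycle_semiconj E.injective hs ⟨κ, 0⟩ ⟨κ, j⟩).2 ⟨j.val, ?_⟩)⟩
        rw [zpow_natCast, rotation_pow_apply, zero_add, ZMod.natCast_zmod_val]
  have hper : ∀ κ, Function.minimalPeriod s (Θ κ).out = d κ := by
    intro κ
    rw [apply_out_eq (h := Function.minimalPeriod s)
      (fun i => minimalPeriod_semiconj s.injective (fun _ => rfl) i) (E ⟨κ, 0⟩),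
      minimalPeriod_semiconj E.injective hs, minimalPeriod_rotation]
  have hprod : ∀ κ, ConjClasses.mk (cycleProd g s (Θ κ).out) = κ.1 := by
    intro κ
    have h1 : ∀ i, ConjClasses.mk (cycleProd g s (s i)) = ConjClasses.mk (cycleProd g s i) := by
      intro i
      have := cycleProd_conj (BG.wreath g s) (BG.wreath g s) i
      rw [mul_inv_cancel_right] at this
      exact ConjClasses.mk_eq_mk_iff_isConj.2 (isConj_iff.2 ⟨_, this.symm⟩).symm
    rw [apply_out_eq (h := fun i => ConjClasses.mk (cycleProd g s i)) h1 (E ⟨κ, 0⟩)]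
    have h2 : Function.minimalPeriod s (E ⟨κ, 0⟩) = d κ := by
      rw [minimalPeriod_semiconj E.injective hs, minimalPeriod_rotation]
    rw [cycleProd_eq_of_single (by rw [h2]; exact hd κ)]
    · rw [hg, if_pos rfl]
      exact Quotient.out_eq κ.1
    · intro k hk hk'
      rw [h2] at hk'
      rw [perm_pow_inv_semiconj hs, rotation_pow_inv_apply, hg, if_neg]
      rw [zero_sub, neg_eq_zero, ZMod.natCast_eq_zero_iff]
      exact fun h3 => absurd (Nat.le_of_dvd hk h3) (by omega)
  refine ⟨g, s, funext fun c => ?_⟩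
  rw [wreathType_eq_map]
  have h1 : (Finset.univ.filter fun q : CycleSet s => ConjClasses.mk (cycleProd g s q.out) = c) =
      (Finset.univ : Finset (ρ.1 c).ToType).map
        ⟨fun x => Θ ⟨c, x⟩, hΘ.1.comp sigma_mk_injective⟩ := by
    ext q
    obtain ⟨⟨c', x⟩, rfl⟩ := hΘ.2 q
    simp only [Finset.mem_filter, Finset.mem_univ, true_and, hprod, Finset.mem_map,
      Function.Embedding.coeFn_mk, hΘ.1.eq_iff]
    constructor
    · rintro rfl
      exact ⟨x, rfl⟩
    · rintro ⟨y, hy⟩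
      exact (congrArg Sigma.fst hy).symm
  rw [h1, Finset.map_val, Multiset.map_map]
  conv_rhs => rw [← Multiset.map_univ_coe (ρ.1 c)]
  refine Multiset.map_congr rfl fun x _ => ?_
  exact hper ⟨c, x⟩

end Existence

/-! ### The exponential formula -/

section Exponential

open PowerSeries

theorem coeff_pow_eq_of_coeff_eq {A : Type*} [CommRing A] {N : ℕ} {f g : PowerSeries A}
    (h : ∀ j ≤ N, coeff j f = coeff j g) (d : ℕ) : coeff N (f ^ d) = coeff N (g ^ d) := by
  have h1 : (X : PowerSeries A) ^ (N + 1) ∣ f - g :=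
    X_pow_dvd_iff.2 fun j hj => by rw [map_sub, h j (by omega), sub_self]
  have h2 := X_pow_dvd_iff.1 (h1.trans (sub_dvd_pow_sub_pow f g d)) N (by omega)
  rwa [map_sub, sub_eq_zero] at h2

/-- The coefficients of the exponential of `∑_j ∑_c b(c, j) X ^ j`. -/
theorem coeff_exp_subst {A κ : Type*} [CommRing A] [Algebra ℂ A] [Algebra ℚ A] [Fintype κ]
    [DecidableEq κ] (b : κ × ℕ → A) (hb : ∀ c, b (c, 0) = 0) (N : ℕ) :
    coeff N ((PowerSeries.exp A).subst (PowerSeries.mk fun j => ∑ c, b (c, j))) =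
      ∑ p ∈ (Finset.range (N + 1)).sigma fun d =>
          (Finset.piAntidiag ((Finset.univ : Finset κ) ×ˢ Finset.range (N + 1)) d).filter
            fun k => N = ∑ x ∈ (Finset.univ : Finset κ) ×ˢ Finset.range (N + 1), x.2 * k x,
        ∏ x ∈ (Finset.univ : Finset κ) ×ˢ Finset.range (N + 1),
          ((p.2 x).factorial : ℂ)⁻¹ • b x ^ p.2 x := by
  set S := (Finset.univ : Finset κ) ×ˢ Finset.range (N + 1) with hS
  set h : PowerSeries A := PowerSeries.mk fun j => ∑ c, b (c, j) with hh
  have h0 : constantCoeff h = 0 := by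
    rw [← coeff_zero_eq_constantCoeff_apply, hh, coeff_mk]
    simp [hb]
  rw [coeff_subst' (HasSubst.of_constantCoeff_zero' h0), finsum_eq_sum_of_support_subset
    (s := Finset.range (N + 1)), Finset.sum_sigma]
  swap
  -- The series has no constant term, so its d-th power starts in degree at least d and only d ≤ N
  -- matter.
  · intro d hd
    by_contra hd'
    refine hd ?_
    have h1 : (X : PowerSeries A) ^ d ∣ h ^ d := pow_dvd_pow_of_dvd (X_dvd_iff.2 h0) d
    have hd2 : N < d := by simpa using hd'
    change _ • coeff N (h ^ d) = 0
    rw [X_pow_dvd_iff.1 h1 N hd2, smul_zero]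
  refine Finset.sum_congr rfl fun d _ => ?_
  -- Coefficients beyond degree N do not influence the N-th one, so the series may be replaced by a
  -- finite sum of monomials and the multinomial theorem applies.
  have h2 : coeff N (h ^ d) = coeff N ((∑ x ∈ S, C (b x) * X ^ x.2) ^ d) := by
    refine coeff_pow_eq_of_coeff_eq (fun j hj => ?_) d
    rw [hh, coeff_mk, map_sum, hS, Finset.sum_product]
    refine Finset.sum_congr rfl fun c _ => ?_
    simp_rw [coeff_C_mul, coeff_X_pow]
    rw [Finset.sum_eq_single j (fun i _ hi => by rw [if_neg hi.symm, mul_zero])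
      (fun hj' => absurd (Finset.mem_range.2 (by omega)) hj'), if_pos rfl, mul_one]
  rw [h2, Finset.sum_pow_eq_sum_piAntidiag, map_sum, Finset.smul_sum, Finset.sum_filter]
  refine Finset.sum_congr rfl fun k hk => ?_
  have hd : ∑ x ∈ S, k x = d := (Finset.mem_piAntidiag.1 hk).1
  have h3 : ∏ x ∈ S, (C (b x) * X ^ x.2 : PowerSeries A) ^ k x =
      C (∏ x ∈ S, b x ^ k x) * X ^ (∑ x ∈ S, x.2 * k x) := by
    rw [map_prod, ← Finset.prod_pow_eq_pow_sum, ← Finset.prod_mul_distrib]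
    refine Finset.prod_congr rfl fun x _ => ?_
    rw [mul_pow, map_pow, pow_mul]
  rw [h3, ← map_natCast (C : A →+* PowerSeries A), coeff_C_mul, coeff_C_mul, coeff_X_pow]
  split_ifs with hN
  · rw [mul_one, coeff_exp, Finset.prod_smul, smul_eq_mul, ← mul_assoc, Algebra.smul_def]
    congr 1
    have h4 : algebraMap ℚ A = (algebraMap ℂ A).comp (algebraMap ℚ ℂ) := RingHom.ext_rat _ _
    rw [h4, RingHom.comp_apply, ← map_natCast (algebraMap ℂ A), ← map_mul]
    congr 1
    -- The multinomial coefficient d!/∏ k(x)! against the 1/d! of the exponential leaves ∏ 1/k(x)!.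
    have h5 : (∏ x ∈ S, ((k x).factorial : ℂ)) * (Nat.multinomial S k : ℂ) = d.factorial := by
      rw [← hd, ← Nat.multinomial_spec S k]
      push_cast
      rfl
    have h6 : (∏ x ∈ S, ((k x).factorial : ℂ)) ≠ 0 :=
      Finset.prod_ne_zero_iff.2 fun x _ => Nat.cast_ne_zero.2 (Nat.factorial_ne_zero _)
    have h7 : (d.factorial : ℂ) ≠ 0 := Nat.cast_ne_zero.2 (Nat.factorial_ne_zero _)
    rw [Finset.prod_inv_distrib]
    simp only [map_div₀, map_one, map_natCast]
    rw [← h5] at h7 ⊢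
    have h8 := (mul_ne_zero_iff.1 h7).2
    field_simp
  · rw [mul_zero, mul_zero, smul_zero]

end Exponential

/-! ### The characteristic of the basic spin characters -/

section Characteristic

variable {Γ : Type u} [Group Γ] [Fintype Γ]

theorem zeta_ne_zero (c : ConjClasses Γ) : zeta c ≠ 0 := by
  have : Nonempty c.carrier := by
    obtain ⟨x, rfl⟩ := ConjClasses.mk_surjective c
    exact ⟨⟨x, ConjClasses.mem_carrier_mk⟩⟩
  exact div_ne_zero (Nat.cast_ne_zero.2 Nat.card_pos.ne') (Nat.cast_ne_zero.2 Nat.card_pos.ne')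

open scoped Classical in
theorem pairing_eq_sum_classes (f g : ClassFn Γ) : pairing f g =
    ∑ c : ConjClasses Γ, (zeta c)⁻¹ * ClassFn.evalAt f c * ClassFn.evalAtInv g c := by
  rw [pairing, ← Finset.sum_fiberwise Finset.univ (fun x : Γ => ConjClasses.mk x), Finset.mul_sum]
  refine Finset.sum_congr rfl fun c _ => ?_
  have h1 : ∀ x ∈ Finset.univ.filter (fun x : Γ => ConjClasses.mk x = c),
      f.1 x * g.1 x⁻¹ = ClassFn.evalAt f c * ClassFn.evalAtInv g c := by
    intro x hx
    rw [← (Finset.mem_filter.1 hx).2, ClassFn.evalAt_mk, ClassFn.evalAtInv_mk]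
  have h2 : (Finset.univ.filter (fun x : Γ => ConjClasses.mk x = c)).card =
      Nat.card c.carrier := by
    rw [← Fintype.card_subtype, Nat.card_eq_fintype_card]
    refine Fintype.card_congr (Equiv.subtypeEquivRight fun x => ?_)
    exact ConjClasses.mem_carrier_iff_mk_eq.symm
  rw [Finset.sum_congr rfl h1, Finset.sum_const, h2, zeta, nsmul_eq_mul, inv_div,
    Nat.card_eq_fintype_card (α := Γ)]
  ring

open scoped Classical in
-- Splitting the pairing ⟨γ, γ_i⟩ by conjugacy classes and exchanging the sums over i and c passes
-- from generators indexed by characters to those indexed by classes.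
theorem fockA_eq_sum_fockC (j : {n : ℕ // Odd n}) (γ : ClassFn Γ) :
    fockA j γ = ∑ c : ConjClasses Γ, ((zeta c)⁻¹ * ClassFn.evalAt γ c) • fockC j c := by
  simp only [fockA, fockC, Finset.smul_sum, pairing_eq_sum_classes, Finset.sum_smul, smul_smul]
  exact Finset.sum_comm

open scoped Classical in
/-- The contribution of `c` to the coefficient of `z ^ j` in the generating function. -/
def classTerm (γ : ClassFn Γ) (x : ConjClasses Γ × ℕ) : Fock Γ :=
  if h : Odd x.2 then
    (2 / (x.2 : ℂ) * ((zeta x.1)⁻¹ * ClassFn.evalAt γ x.1)) • fockC ⟨x.2, h⟩ x.1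
  else 0

open scoped Classical in
theorem heisenbergSeries_eq (γ : ClassFn Γ) :
    heisenbergSeries γ = PowerSeries.mk fun j => ∑ c : ConjClasses Γ, classTerm γ (c, j) := by
  unfold heisenbergSeries classTerm
  congr 1
  ext1 j
  by_cases h : Odd j
  · simp only [h, dif_pos]
    rw [fockA_eq_sum_fockC, Finset.smul_sum]
    simp only [smul_smul]
  · simp [h]

theorem classValue_spinExt {n : ℕ} (ρ : OP Γ n) (γ : ClassFn Γ) :
    classValue (spinExt (Fin n) γ) ρ = 2 ^ ρ.length * ρ.evalProd γ :=
  spinExt_Dpos ρ γ _ (Classical.epsilon_spec (Dpos_nonempty ρ))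

open scoped Classical in
-- The default value 0 at even j is harmless: its exponent, the multiplicity of j, is 0.
theorem prod_attach_map_fockC {N : ℕ} {m : Multiset ℕ} (hm : ∀ i ∈ m, Odd i)
    (hN : m.toFinset ⊆ Finset.range (N + 1)) (c : ConjClasses Γ) :
    (m.attach.map fun i => fockC ⟨i.1, hm i.1 i.2⟩ c).prod =
      ∏ j ∈ Finset.range (N + 1), (if h : Odd j then fockC ⟨j, h⟩ c else 0) ^ m.count j := by
  have h1 : (m.attach.map fun i => fockC ⟨i.1, hm i.1 i.2⟩ c) =
      m.map fun j => if h : Odd j then fockC ⟨j, h⟩ c else 0 := by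
    rw [← Multiset.attach_map_val' m fun j => if h : Odd j then fockC ⟨j, h⟩ c else 0]
    refine Multiset.map_congr rfl fun i _ => ?_
    rw [dif_pos (hm i.1 i.2)]
  rw [h1, Finset.prod_multiset_map_count]
  refine Finset.prod_subset hN fun j _ hj => ?_
  rw [Multiset.count_eq_zero.2 (by simpa using hj), pow_zero]

open scoped Classical in
theorem OP.toFinset_subset {N : ℕ} (ρ : OP Γ N) (c : ConjClasses Γ) :
    (ρ.1 c).toFinset ⊆ Finset.range (N + 1) := by
  intro j hj
  have h1 : j ≤ (ρ.1 c).sum := Multiset.le_sum_of_mem (Multiset.mem_toFinset.1 hj)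
  have h2 : (ρ.1 c).sum ≤ N := by
    conv_rhs => rw [← ρ.2.2]
    exact Finset.single_le_sum (f := fun c => (ρ.1 c).sum) (fun _ _ => Nat.zero_le _)
      (Finset.mem_univ c)
  exact Finset.mem_range.2 (by omega)

open scoped Classical in
-- All ingredients are products over pairs (c, j). With multiplicity m, the factors ζ_c^m j^m m! of
-- Z_ρ combine with 2^m γ(c)^m and a_{-j}(c)^m into the m-th term of the exponential series of (2/j)
-- ζ_c⁻¹ γ(c) a_{-j}(c).
theorem smul_fockRho_eq_prod {N : ℕ} (ρ : OP Γ N) (γ : ClassFn Γ) :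
    (ρ.Z⁻¹ * (2 ^ ρ.length * ρ.evalProd γ)) • fockRho ρ =
      ∏ x ∈ (Finset.univ : Finset (ConjClasses Γ)) ×ˢ Finset.range (N + 1),
        (((ρ.1 x.1).count x.2).factorial : ℂ)⁻¹ • classTerm γ x ^ (ρ.1 x.1).count x.2 := by
  rw [OP.Z, OP.length, OP.evalProd, fockRho, ← Finset.prod_pow_eq_pow_sum, ← Finset.prod_inv_distrib,
    ← Finset.prod_mul_distrib, ← Finset.prod_mul_distrib, ← Finset.prod_smul, Finset.prod_product]
  refine Finset.prod_congr rfl fun c _ => ?_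
  have hsub := ρ.toFinset_subset c
  rw [prod_attach_map_fockC (ρ.2.1 c) hsub]
  have hcard : ∑ j ∈ Finset.range (N + 1), (ρ.1 c).count j = Multiset.card (ρ.1 c) :=
    Multiset.sum_count_eq_card fun a ha => hsub (Multiset.mem_toFinset.2 ha)
  have h1 : ∏ i ∈ (ρ.1 c).toFinset, ((i : ℂ) ^ (ρ.1 c).count i * ((ρ.1 c).count i).factorial) =
      ∏ i ∈ Finset.range (N + 1), ((i : ℂ) ^ (ρ.1 c).count i * ((ρ.1 c).count i).factorial) := by
    refine Finset.prod_subset hsub fun j _ hj => ?_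
    rw [Multiset.count_eq_zero.2 (by simpa using hj)]
    simp
  rw [h1, ← hcard, ← Finset.prod_pow_eq_pow_sum, ← Finset.prod_pow_eq_pow_sum,
    ← Finset.prod_pow_eq_pow_sum, ← Finset.prod_mul_distrib, ← Finset.prod_inv_distrib,
    ← Finset.prod_mul_distrib, ← Finset.prod_mul_distrib, ← Finset.prod_smul]
  refine Finset.prod_congr rfl fun j _ => ?_
  by_cases hj : Odd j
  · simp only [classTerm, hj, dif_pos, smul_pow, smul_smul]
    congr 1
    have hz := zeta_ne_zero c
    have hj0 : (j : ℂ) ≠ 0 := Nat.cast_ne_zero.2 hj.pos.ne'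
    have hf : (((ρ.1 c).count j).factorial : ℂ) ≠ 0 := Nat.cast_ne_zero.2 (Nat.factorial_ne_zero _)
    simp only [mul_pow, div_pow, inv_pow]
    field_simp
  · have h0 : (ρ.1 c).count j = 0 := Multiset.count_eq_zero.2 fun h => hj (ρ.2.1 c j h)
    rw [h0]
    simp

open scoped Classical in
theorem sum_count_mul {N : ℕ} (ρ : OP Γ N) :
    ∑ x ∈ (Finset.univ : Finset (ConjClasses Γ)) ×ˢ Finset.range (N + 1),
      x.2 * (ρ.1 x.1).count x.2 = N := by
  rw [Finset.sum_product]
  refine Eq.trans (Finset.sum_congr rfl fun c _ => ?_) ρ.2.2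
  rw [Finset.sum_multiset_count_of_subset _ _ (ρ.toFinset_subset c)]
  exact Finset.sum_congr rfl fun j _ => by rw [smul_eq_mul, mul_comm]

/-- Sending ρ to its multiplicity function identifies the two sums: the exponents on the right not
obtained in this way involve an even j, where `classTerm` vanishes. -/
theorem chDeg_spinExt (N : ℕ) (γ : ClassFn Γ) : chDeg N (spinExt (Fin N) γ) =
    PowerSeries.coeff N ((PowerSeries.exp (Fock Γ)).subst (heisenbergSeries γ)) := by
  classical
  rw [heisenbergSeries_eq, coeff_exp_subst _ (fun c => by simp [classTerm])]
  change ∑ ρ : OP Γ N, (ρ.Z⁻¹ * classValue (spinExt (Fin N) γ) ρ) • fockRho ρ = _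
  set S := (Finset.univ : Finset (ConjClasses Γ)) ×ˢ Finset.range (N + 1) with hS
  -- The first index is the total number of parts and is forced by the second, so injectivity only
  -- concerns multiplicities.
  refine Finset.sum_of_injOn
    (fun ρ => ⟨∑ x ∈ S, (ρ.1 x.1).count x.2, fun x => (ρ.1 x.1).count x.2⟩) ?_ ?_ ?_ ?_
  · intro ρ _ ρ' _ h
    refine Subtype.ext (funext fun c => Multiset.ext.2 fun j => ?_)
    exact congrFun (eq_of_heq (Sigma.mk.inj h).2) (c, j)
  · intro ρ _
    rw [Finset.mem_coe, Finset.mem_sigma, Finset.mem_filter, Finset.mem_piAntidiag]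
    have h1 := sum_count_mul ρ
    refine ⟨?_, ⟨rfl, fun x hx => ?_⟩, h1.symm⟩
    -- There are at most N parts, since each part is odd and hence at least 1.
    · refine Finset.mem_range.2 (Nat.lt_succ_of_le ?_)
      conv_rhs => rw [← h1]
      refine Finset.sum_le_sum fun x _ => ?_
      by_cases hx : (ρ.1 x.1).count x.2 = 0
      · simp [hx]
      · exact Nat.le_mul_of_pos_left _
          (ρ.2.1 x.1 x.2 (Multiset.count_ne_zero.1 hx)).pos
    · exact Finset.mem_product.2 ⟨Finset.mem_univ _, ρ.toFinset_subset x.1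
        (Multiset.mem_toFinset.2 (Multiset.count_ne_zero.1 hx))⟩
  · rintro ⟨d, k⟩ hk hk'
    rw [Finset.mem_sigma, Finset.mem_filter, Finset.mem_piAntidiag] at hk
    obtain ⟨-, ⟨hkd, hkS⟩, hkN⟩ := hk
    dsimp only at hkd hkS hkN
    by_contra hne
    refine hk' ?_
    -- A nonzero summand has k supported on odd j, so k is the multiplicity function of the
    -- multisets `r` built from it.
    have hodd : ∀ x, k x ≠ 0 → Odd x.2 := by
      intro x hx
      by_contra h
      refine hne (Finset.prod_eq_zero (hkS x hx) ?_)
      dsimp only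
      rw [classTerm, dif_neg h, zero_pow hx, smul_zero]
    let r : ConjClasses Γ → Multiset ℕ := fun c =>
      ∑ j ∈ Finset.range (N + 1), Multiset.replicate (k (c, j)) j
    have hr : ∀ c j, (r c).count j = k (c, j) := by
      intro c j
      simp only [r, Multiset.count_sum', Multiset.count_replicate]
      rw [Finset.sum_ite_eq']
      split_ifs with h
      · rfl
      · by_contra h2
        exact h (Finset.mem_product.1 (hkS (c, j) (Ne.symm h2))).2
    refine ⟨⟨r, fun c i hi => hodd (c, i) ?_, ?_⟩, Finset.mem_coe.2 (Finset.mem_univ _), ?_⟩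
    · rw [← hr]
      exact Multiset.count_ne_zero.2 hi
    · rw [hkN, hS, Finset.sum_product]
      refine Finset.sum_congr rfl fun c _ => ?_
      simp only [r]
      rw [Multiset.sum_sum]
      exact Finset.sum_congr rfl fun j _ => by
        rw [Multiset.sum_replicate, smul_eq_mul, mul_comm]
    · simp only [hr]
      rw [hkd]
  · intro ρ _
    rw [classValue_spinExt, smul_fockRho_eq_prod]

theorem ch_of (N : ℕ) (f : SpinClassFn Γ (Fin N)) :
    ch (DirectSum.of (fun n => SpinClassFn Γ (Fin n)) N f) = chDeg N f := by
  rw [ch, ← DirectSum.lof_eq_of ℂ, DirectSum.toModule_lof]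

end Characteristic

end SpinHyperoctahedral

end

/-! ### The proposition -/

open SpinHyperoctahedral in
theorem mainTheorem9 {Γ : Type*} [Group Γ] [Fintype Γ] :
    (∃! χ : ∀ n : ℕ, ClassFn Γ → SpinClassFn Γ (Fin n), IsBasicSpinExtension χ) ∧
    ∀ χ : ∀ n : ℕ, ClassFn Γ → SpinClassFn Γ (Fin n), IsBasicSpinExtension χ →
      (∀ (n : ℕ) (β γ : ClassFn Γ), (χ n (β - γ)).1 =
        ∑ m : Fin (n + 1), (-1 : ℂ) ^ (m : ℕ) • spinInd m (χ (n - m) β).1 (χ m γ).1) ∧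
      (∀ γ : ClassFn Γ,
        PowerSeries.mk (fun n => ch (DirectSum.of (fun n => SpinClassFn Γ (Fin n)) n (χ n γ))) =
          (PowerSeries.exp (Fock Γ)).subst (heisenbergSeries γ)) ∧
      (∀ (n : ℕ) (γ : ClassFn Γ) (ρ : OP Γ n),
        (∀ x ∈ Dpos ρ, (χ n γ).1 x = 2 ^ ρ.length * ρ.evalProd γ) ∧
        (∀ x ∈ Dneg ρ, (χ n γ).1 x = -(2 ^ ρ.length * ρ.evalProd γ))) := by
  refine ⟨⟨_, isBasicSpinExtension_spinExt, fun χ h =>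
    h.unique isBasicSpinExtension_spinExt⟩, fun χ h => ?_⟩
  -- By uniqueness χ is the explicit `spinExt`, for which all the claims have been established.
  obtain rfl := h.unique isBasicSpinExtension_spinExt
  refine ⟨fun n β γ => spinExt_sub n β γ, fun γ => ?_,
    fun n γ ρ => ⟨fun x hx => spinExt_Dpos ρ γ x hx, fun x hx => spinExt_Dneg ρ γ x hx⟩⟩
  ext1 N
  rw [PowerSeries.coeff_mk, ch_of, chDeg_spinExt]
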